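/- **Setting.** Let $m,p\ge 0$ be integers, let $\Theta\subset\mathbb R^{p}$ be open, and for each $\theta\in\Theta$ let $Y_\theta$ be a random vector in $\mathbb R^{m}$. For a family $(X_\theta)_{\theta\in\Theta}$ of random vectors in $\mathbb R^m$ write $M_X(s;\theta)=\mathbb E(e^{sX_\theta})$, $K_X=\log M_X$ for its moment and cumulant generating functions, $\mathcal S_\theta=\{s\in\mathbb R^m:\mathbb E(e^{sX_\theta})<\infty\}$ and $\mathcal S=\{(s,\theta):\theta\in\Theta,\ s\in\mathcal S_\theta\}$; $M_X(s+\mathrm i\phi;\theta)$ is defined by the same formula for $s\in\mathcal S_\theta$, $\phi\in\mathbb R^m$. Primes denote derivatives in $s$. A saddlepoint $\hat s=\hat s(\theta;x)$ is a solution $\hat s\in\mathcal S_\theta$ of $K_X'(\hat s;\theta)=x$ (under the assumptions below it is unique whenever $(\hat s,\theta)\in\operatorname{int}\mathcal S$), and the saddlepoint approximation to the likelihood is $$\hat L(\theta;x)=\frac{\exp\big(K_X(\hat s;\theta)-\hat s x\big)}{\sqrt{\det\big(2\pi K_X''(\hat s;\theta)\big)}}.$$ The true likelihood $L(\theta;x)$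 is the value at $x$ of the (necessarily unique) continuous density of $X_\theta$ with respect to Lebesgue measure, when there is one. Let $M_0,K_0,\mathcal S,\hat s_0(\theta;y)$ be these objects for the family $(Y_\theta)$, and let $\mathcal Y^o$ be the set of pairs $(y,\theta)\in\mathbb R^m\times\Theta$ for which the saddlepoint $\hat s_0(\theta;y)$ exists and $(\hat s_0(\theta;y),\theta)\in\operatorname{int}\mathcal S$. For $n\in\mathbb N$ let $X_\theta=Y^{(1)}+\dots+Y^{(n)}$ be the sum of $n$ i.i.d. copies of $Y_\theta$ (so that $M=M_0^n$ and $K=nK_0$), put $x=ny$, and let $L,\hat L$ (which depend on $n$) be the likelihood and the saddlepoint approximation for the family $(X_\theta)$. **Assumptions.** (Decay) There is a continuous $\delta:\operatorname{int}\mathcal S\to(0,\infty)$ with $$\left|\frac{M_0(s+\mathrm i\phi;\theta)}{M_0(s;\theta)}\right|\le\big(1+\delta(s,\theta)|\phi|^2\big)^{-\delta(s,\theta)}\qquad\text{for all }\phi\in\mathbb R^m,\ (s,\theta)\in\operatorname{int}\mathcal S.$$ (Growth) There is a continuous $\gamma:\operatorname{int}\mathcal S\to(0,\infty)$ such that, for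 $k\in\{0,1\}$, $1\le k+\ell\le 6$ and for $k=2$, $0\le\ell\le2$, all partial derivatives below exist, are continuous in $(s,\phi,\theta)$, and satisfy $$\left|\frac{\partial^{k+\ell}M_0}{\partial\theta_{i_1}\cdots\partial\theta_{i_k}\partial s_{j_1}\cdots\partial s_{j_\ell}}(s+\mathrm i\phi;\theta)\right|\le\gamma(s,\theta)(1+|\phi|)^{\gamma(s,\theta)}\qquad\text{for all }\phi\in\mathbb R^m,\ (s,\theta)\in\operatorname{int}\mathcal S.$$ **Theorem (Gradient error bound).** For every fixed $(y,\theta)\in\operatorname{int}\mathcal Y^o$, $$\nabla_\theta\log\hat L(\theta;x)=\nabla_\theta\log L(\theta;x)+O(1/n)\qquad\text{as }n\to\infty .$$ Moreover, for every compact $C\subset\operatorname{int}\mathcal Y^o$ there are $n_0\in\mathbb N$ and $A\in\mathbb R$ such that $|\nabla_\theta\log\hat L(\theta;x)-\nabla_\theta\log L(\theta;x)|\le A/n$ for all $n\ge n_0$ and all $(y,\theta)\in C$. Both assertions include that the likelihoods and gradients exist for the $n$ concerned (for large $n$ in the first, for all $n\ge n_0$ in the second): for all $\theta'$ in a neighbourhood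 of $\theta$ the vector $X_{\theta'}$ has a continuous density, a saddlepoint exists at $(\theta',x)$, and $L(\theta';x)$ and $\hat L(\theta';x)$ are positive, and $\log L(\cdot;x)$ and $\log\hat L(\cdot;x)$ are differentiable at $\theta$. -/

import Mathlib

open MeasureTheory Filter Topology

noncomputable section

namespace Saddle

/-- Column vectors (observations, parameters) and row vectors (dual variables), with the
Euclidean norm. -/
abbrev Vec (d : ℕ) := EuclideanSpace ℝ (Fin d)

/-- The `j`-th standard basis vector. -/
abbrev basisVec {d : ℕ} (j : Fin d) : Vec d := EuclideanSpace.single j (1 : ℝ)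

section Family

/-! Throughout, `μ θ` is the law of a random vector `X_θ` in `ℝ^m`, for a parameter `θ ∈ ℝ^p`. -/

variable {m p : ℕ}

/-- The moment generating function `M(s;θ) = E exp(s X_θ)` at a real argument. -/
def mgf (μ : Vec p → Measure (Vec m)) (s : Vec m) (θ : Vec p) : ℝ :=
  ∫ x, Real.exp (inner ℝ s x) ∂(μ θ)

/-- The moment generating function `M(s + iφ;θ) = E exp((s + iφ) X_θ)` at a complex argument. -/
def mgfC (μ : Vec p → Measure (Vec m)) (s φ : Vec m) (θ : Vec p) : ℂ :=
  ∫ x, Complex.exp (∑ j, ((s j : ℂ) + Complex.I * (φ j : ℂ)) * (x j : ℂ)) ∂(μ θ)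

/-- The cumulant generating function `K = log M`. -/
def cgf (μ : Vec p → Measure (Vec m)) (s : Vec m) (θ : Vec p) : ℝ :=
  Real.log (mgf μ s θ)

/-- The Hessian matrix `K''(s;θ)` in the variable `s`. -/
def cgfHess (μ : Vec p → Measure (Vec m)) (s : Vec m) (θ : Vec p) : Matrix (Fin m) (Fin m) ℝ :=
  Matrix.of fun i j =>
    lineDeriv ℝ (fun s' => lineDeriv ℝ (fun s'' => cgf μ s'' θ) s' (basisVec j)) s (basisVec i)

/-- `S_θ`, the set of real `s` with `E exp(s X_θ) < ∞`. -/
def mgfDomainAt (μ : Vec p → Measure (Vec m)) (θ : Vec p) : Set (Vec m) :=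
  {s | Integrable (fun x => Real.exp (inner ℝ s x)) (μ θ)}

/-- `S = {(s,θ) : θ ∈ Θ, s ∈ S_θ}`. -/
def mgfDomain (Θ : Set (Vec p)) (μ : Vec p → Measure (Vec m)) : Set (Vec m × Vec p) :=
  {q | q.2 ∈ Θ ∧ q.1 ∈ mgfDomainAt μ q.2}

/-- `s ∈ S_θ` solves the saddlepoint equation `K'(s;θ) = x`. The derivative is taken within
`S_θ`; at interior points of `S_θ` this is the ordinary gradient. -/
def IsSaddlepoint (μ : Vec p → Measure (Vec m)) (θ : Vec p) (x s : Vec m) : Prop :=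
  s ∈ mgfDomainAt μ θ ∧
    HasGradientWithinAt (fun s' => cgf μ s' θ) x (mgfDomainAt μ θ) s

open Classical in
/-- The saddlepoint `ŝ(θ;x)` (with value `0` if the saddlepoint equation has no solution). -/
def saddlepoint (μ : Vec p → Measure (Vec m)) (θ : Vec p) (x : Vec m) : Vec m :=
  if h : ∃ s, IsSaddlepoint μ θ x s then h.choose else 0

/-- `X^o`: the pairs `(x,θ)`, `θ ∈ Θ`, for which the saddlepoint exists and
`(ŝ(θ;x),θ)` is an interior point of `S`. -/
def saddleDomain (Θ : Set (Vec p)) (μ : Vec p → Measure (Vec m)) : Set (Vec m × Vec p) :=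
  {q | q.2 ∈ Θ ∧ (∃ s, IsSaddlepoint μ q.2 q.1 s) ∧
    (saddlepoint μ q.2 q.1, q.2) ∈ interior (mgfDomain Θ μ)}

/-- The saddlepoint approximation to the likelihood,
`L̂(θ;x) = exp(K(ŝ;θ) - ŝ x) / √(det(2π K''(ŝ;θ)))` with `ŝ = ŝ(θ;x)`. -/
def saddleLikelihood (μ : Vec p → Measure (Vec m)) (θ : Vec p) (x : Vec m) : ℝ :=
  Real.exp (cgf μ (saddlepoint μ θ x) θ - inner ℝ (saddlepoint μ θ x) x) /
    Real.sqrt ((2 * Real.pi) • cgfHess μ (saddlepoint μ θ x) θ).det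

/-- `f` is a continuous probability density of the law `ρ` with respect to Lebesgue measure. -/
def IsContDensity (ρ : Measure (Vec m)) (f : Vec m → ℝ) : Prop :=
  Continuous f ∧ (∀ x, 0 ≤ f x) ∧ ρ = volume.withDensity (fun x => ENNReal.ofReal (f x))

/-- A law has at most one continuous density. -/
theorem IsContDensity.unique {ρ : Measure (Vec m)} [IsFiniteMeasure ρ] {f g : Vec m → ℝ}
    (hf : IsContDensity ρ f) (hg : IsContDensity ρ g) : f = g := by
  obtain ⟨hfc, hf0, hfρ⟩ := hf
  obtain ⟨hgc, hg0, hgρ⟩ := hg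
  have hfin : ∫⁻ x, ENNReal.ofReal (f x) ≠ ⊤ := by
    have h := measure_ne_top ρ Set.univ
    rw [hfρ, withDensity_apply _ MeasurableSet.univ, Measure.restrict_univ] at h
    exact h
  have h1 : (fun x => ENNReal.ofReal (f x)) =ᵐ[volume] fun x => ENNReal.ofReal (g x) :=
    (withDensity_eq_iff hfc.measurable.ennreal_ofReal.aemeasurable
      hgc.measurable.ennreal_ofReal.aemeasurable hfin).1 (hfρ.symm.trans hgρ)
  have h2 : f =ᵐ[volume] g := by
    filter_upwards [h1] with x hx
    exact (ENNReal.ofReal_eq_ofReal_iff (hf0 x) (hg0 x)).1 hx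
  exact Continuous.ae_eq_iff_eq volume hfc hgc |>.1 h2

open Classical in
/-- The true likelihood `L(θ;x)`: the value at `x` of the continuous density of `X_θ`
(and `0` if there is no continuous density). -/
def likelihood (μ : Vec p → Measure (Vec m)) (θ : Vec p) (x : Vec m) : ℝ :=
  if h : ∃ f, IsContDensity (μ θ) f then h.choose x else 0

/-- The law of `X_θ = Y^{(1)} + ⋯ + Y^{(n)}`, where the `Y^{(i)}` are independent with law
`ν θ`. -/
def sumLaw (ν : Vec p → Measure (Vec m)) (n : ℕ) (θ : Vec p) : Measure (Vec m) :=
  (Measure.pi (fun _ : Fin n => ν θ)).map (fun y => ∑ i, y i)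

/-! ### Partial derivatives of the complex MGF -/

/-- `∂F/∂s_j`, for a function of `(s, φ, θ)`. -/
def dS (j : Fin m) (F : Vec m → Vec m → Vec p → ℂ) : Vec m → Vec m → Vec p → ℂ :=
  fun s φ θ => lineDeriv ℝ (fun s' => F s' φ θ) s (basisVec j)

/-- `∂F/∂θ_i`, for a function of `(s, φ, θ)`. -/
def dTheta (i : Fin p) (F : Vec m → Vec m → Vec p → ℂ) : Vec m → Vec m → Vec p → ℂ :=
  fun s φ θ => lineDeriv ℝ (fun θ' => F s φ θ') θ (basisVec i)

/-- `∂^{k+ℓ} M / ∂θ_{i_1} ⋯ ∂θ_{i_k} ∂s_{j_1} ⋯ ∂s_{j_ℓ}` at `(s + iφ; θ)`, for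
`I = [i_1, …, i_k]` and `J = [j_1, …, j_ℓ]`. -/
def mgfPartial (μ : Vec p → Measure (Vec m)) (I : List (Fin p)) (J : List (Fin m)) :
    Vec m → Vec m → Vec p → ℂ :=
  I.foldr dTheta (J.foldr dS (mgfC μ))

/-- The outermost differentiation in `mgfPartial μ I J` is legitimate at `(s + iφ; θ)`. -/
def MgfPartialExists (μ : Vec p → Measure (Vec m)) :
    List (Fin p) → List (Fin m) → Vec m → Vec m → Vec p → Prop
  | i :: I, J, s, φ, θ =>
      LineDifferentiableAt ℝ (fun θ' => mgfPartial μ I J s φ θ') θ (basisVec i)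
  | [], j :: J, s, φ, θ =>
      LineDifferentiableAt ℝ (fun s' => mgfPartial μ [] J s' φ θ) s (basisVec j)
  | [], [], _, _, _ => True

/-- The decay bound on the MGF. -/
def DecayBound (Θ : Set (Vec p)) (μ : Vec p → Measure (Vec m)) : Prop :=
  ∃ δ : Vec m × Vec p → ℝ,
    ContinuousOn δ (interior (mgfDomain Θ μ)) ∧
    ∀ s θ, (s, θ) ∈ interior (mgfDomain Θ μ) →
      0 < δ (s, θ) ∧
      ∀ φ : Vec m,
        ‖mgfC μ s φ θ / (mgf μ s θ : ℂ)‖ ≤ (1 + δ (s, θ) * ‖φ‖ ^ 2) ^ (-δ (s, θ))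

/-- The orders `k` (in `θ`) and `ℓ` (in `s`) of the partial derivatives that are controlled. -/
def ControlledOrder (k l : ℕ) : Prop :=
  (k ≤ 1 ∧ 1 ≤ k + l ∧ k + l ≤ 6) ∨ (k = 2 ∧ l ≤ 2)

/-- The growth bound on the partial derivatives of the MGF: all partial derivatives of the
controlled orders exist, are continuous in `(s, φ, θ)` and grow at most polynomially in `φ`. -/
def GrowthBound (Θ : Set (Vec p)) (μ : Vec p → Measure (Vec m)) : Prop :=
  ∃ γ : Vec m × Vec p → ℝ,
    ContinuousOn γ (interior (mgfDomain Θ μ)) ∧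
    (∀ q ∈ interior (mgfDomain Θ μ), 0 < γ q) ∧
    ∀ (I : List (Fin p)) (J : List (Fin m)), ControlledOrder I.length J.length →
      (∀ s θ, (s, θ) ∈ interior (mgfDomain Θ μ) → ∀ φ : Vec m,
        MgfPartialExists μ I J s φ θ ∧
        ‖mgfPartial μ I J s φ θ‖ ≤ γ (s, θ) * (1 + ‖φ‖) ^ γ (s, θ)) ∧
      ContinuousOn (fun r : Vec m × Vec m × Vec p => mgfPartial μ I J r.1 r.2.1 r.2.2)
        {r | (r.1, r.2.2) ∈ interior (mgfDomain Θ μ)}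

/-- The log-likelihoods `log L(·;x)` and `log L̂(·;x)` and their gradients make sense at `θ`:
for all parameters near `θ`, the law has a continuous density, which is positive at `x`, and the
saddlepoint and a positive saddlepoint approximation exist; and both log-likelihoods are
differentiable at `θ`. -/
def LogGradientsExist (μ : Vec p → Measure (Vec m)) (θ : Vec p) (x : Vec m) : Prop :=
  (∀ᶠ θ' in 𝓝 θ,
    (∃ f, IsContDensity (μ θ') f) ∧ 0 < likelihood μ θ' x ∧
    (∃ s, IsSaddlepoint μ θ' x s) ∧ 0 < saddleLikelihood μ θ' x) ∧
  DifferentiableAt ℝ (fun θ' => Real.log (likelihood μ θ' x)) θ ∧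
  DifferentiableAt ℝ (fun θ' => Real.log (saddleLikelihood μ θ' x)) θ

/-- `∇_θ log L̂(θ;x) - ∇_θ log L(θ;x)`. -/
def gradientError (μ : Vec p → Measure (Vec m)) (θ : Vec p) (x : Vec m) : Vec p :=
  gradient (fun θ' => Real.log (saddleLikelihood μ θ' x)) θ -
    gradient (fun θ' => Real.log (likelihood μ θ' x)) θ

end Family

end Saddle

end

noncomputable section

namespace Saddle

/-! ### Moments of the envelope -/

/-! Fix (y, θ), let s be the saddlepoint of the single-copy family at θ, and keep this s frozen
while θ' varies near θ. Fourier inversion along s + iℝ^m gives L(θ'; ny) = (2π)^{-m} e^{-n s y} Re ∫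
e^{-inφy} M₀(s+iφ; θ')ⁿ dφ. Tilt the law of Y_θ by e^{sx}; because s is the saddlepoint, the tilted
law has mean y. Let u be its characteristic function after centring at y, let v(φ) = e^{-iφy}, and
let N(φ) = ∂_{θ_i}M₀(s+iφ)/M₀(s). Differentiation under the integral gives ∂_i log L = n Re J / Re I
with I = ∫ uⁿ and J = ∫ N v u^{n-1}.

For the approximation, K₀' = y along the saddlepoint curve, so the motion of s drops out of the
derivative of the exponent. What remains is ∂_i log L̂ = n a + τ, where a = ∂_{θ_i}M₀/M₀ at s, τ =
-½ tr(K₀''⁻¹ dK₀''), and dK₀'' is the total derivative along the curve. It therefore suffices to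
prove Re I ≥ c n^{-m/2} and J = (a + τ/n) I + O(n^{-m/2-2}).

The expansion of J rests on two exact identities rather than on Gaussian integrals. Put T_w(φ) = ∫
(x-y)·w e^{i(x-y)·φ}, which is -i ∂_w u. Integration by parts gives ∫ u^{n-1} T_β = 0 for a constant
vector β and -i ∫ u^{n-1} T_{Lφ} = (tr L / n) I for a linear map L. Take β = -σ, where σ is the
velocity of the saddlepoint in θ_i, and L = -½ K₀''⁻¹ dK₀'', so that tr L = τ. Then N v and a u +
T_β - i T_{Lφ} agree to second order at φ = 0, and their difference is v times i·o(φ) plus a quartic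
remainder of polynomial growth, where o is real, odd and cubic. Integrated against u^{n-1}, the
quartic part has the required order. The cubic part seems to lose half a power of n, but oddness
leaves only the imaginary part of v u^{n-1}, which is small of order |φ| + n|φ|³, and the half power
comes back (`exists_norm_integral_sub_le`).

The decay hypothesis enters three times: it bounds the moments of |u|ⁿ (`env_moment`), it forces a
quantitatively nondegenerate variance (`le_variance`), and with it the lower bound for I
(`exists_le_re_integral_centeredChar_pow`). The same nondegeneracy makes the saddlepoint unique and
differentiable in (y, θ). All constants depend only on bounds for δ, γ, M₀ and |y| at the
saddlepoint, and these are uniform on compact sets. -/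

/-- The envelope `(1 + δ|φ|²)^{-δ}` in the decay bound. -/
def env {m : ℕ} (δ : ℝ) (φ : Vec m) : ℝ := (1 + δ * ‖φ‖ ^ 2) ^ (-δ)

section Envelope

variable {m : ℕ}

theorem one_le_env_base {δ : ℝ} (hδ : 0 < δ) (φ : Vec m) : 1 ≤ 1 + δ * ‖φ‖ ^ 2 := by
  have : 0 ≤ δ * ‖φ‖ ^ 2 := by positivity
  linarith

theorem env_pos {δ : ℝ} (hδ : 0 < δ) (φ : Vec m) : 0 < env δ φ :=
  Real.rpow_pos_of_pos (lt_of_lt_of_le one_pos (one_le_env_base hδ φ)) _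

theorem continuous_env {δ : ℝ} (hδ : 0 < δ) : Continuous (env δ : Vec m → ℝ) := by
  unfold env
  refine Continuous.rpow_const (by fun_prop) fun φ => Or.inl ?_
  exact (lt_of_lt_of_le one_pos (one_le_env_base hδ φ)).ne'

theorem env_anti {δ δ' : ℝ} (hδ : 0 < δ) (h : δ ≤ δ') (φ : Vec m) : env δ' φ ≤ env δ φ := by
  have h1 := one_le_env_base hδ φ
  unfold env
  calc (1 + δ' * ‖φ‖ ^ 2) ^ (-δ') ≤ (1 + δ * ‖φ‖ ^ 2) ^ (-δ') := by
        apply Real.rpow_le_rpow_of_nonpos (by linarith) (by gcongr) (by linarith)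
    _ ≤ _ := Real.rpow_le_rpow_of_exponent_le h1 (by linarith)

/-- After rescaling, the powers of the envelope decrease with the exponent. -/
theorem env_smul_pow_le {δ : ℝ} (hδ : 0 < δ) {n₁ n : ℕ} (h1 : 1 ≤ n₁) (hn : n₁ ≤ n) (ψ : Vec m) :
    env δ ((Real.sqrt n)⁻¹ • ψ) ^ n ≤ env δ ((Real.sqrt n₁)⁻¹ • ψ) ^ n₁ := by
  have hn1 : (0 : ℝ) < n₁ := by exact_mod_cast h1
  have hn0 : (0 : ℝ) < n := by exact_mod_cast (lt_of_lt_of_le h1 hn)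
  have key : ∀ k : ℕ, 0 < (k : ℝ) → env δ ((Real.sqrt k)⁻¹ • ψ) ^ k
      = ((1 + δ * ‖ψ‖ ^ 2 / k) ^ (k : ℝ)) ^ (-δ) := by
    intro k hk
    have hb : 0 ≤ 1 + δ * ‖ψ‖ ^ 2 / k := by positivity
    unfold env
    rw [norm_smul, mul_pow, norm_inv, Real.norm_of_nonneg (Real.sqrt_nonneg _), inv_pow,
      Real.sq_sqrt hk.le, ← Real.rpow_natCast, ← Real.rpow_mul (by positivity),
      ← Real.rpow_mul hb, show δ * ((k : ℝ)⁻¹ * ‖ψ‖ ^ 2) = δ * ‖ψ‖ ^ 2 / k by ring,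
      mul_comm (-δ)]
  rw [key n hn0, key n₁ hn1]
  apply Real.rpow_le_rpow_of_nonpos (by positivity) _ (by linarith)
  have hnn : (1 : ℝ) ≤ n / n₁ := by
    rw [le_div_iff₀ hn1]; simpa using (by exact_mod_cast hn : (n₁ : ℝ) ≤ n)
  -- Bernoulli with exponent n/n₁ ≥ 1: this is the monotonicity of (1 + q/k)^k in k.
  have h := one_add_mul_self_le_rpow_one_add (s := δ * ‖ψ‖ ^ 2 / n) (p := n / n₁)
    (by have : 0 ≤ δ * ‖ψ‖ ^ 2 / n := by positivity
        linarith) hnn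
  calc (1 + δ * ‖ψ‖ ^ 2 / n₁) ^ (n₁ : ℝ)
      = (1 + (n / n₁ : ℝ) * (δ * ‖ψ‖ ^ 2 / n)) ^ (n₁ : ℝ) := by
        congr 2; field_simp
    _ ≤ ((1 + δ * ‖ψ‖ ^ 2 / n) ^ (n / n₁ : ℝ)) ^ (n₁ : ℝ) := by
        apply Real.rpow_le_rpow (by positivity) h hn1.le
    _ = (1 + δ * ‖ψ‖ ^ 2 / n) ^ (n : ℝ) := by
        rw [← Real.rpow_mul (by positivity)]
        congr 1; field_simp

/-- The n₁-th power of the envelope decays like |ψ|^{-2δn₁}, so it beats the polynomial factor and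
the dimension once 2δn₁ exceeds m + k + G. Comparing the base with c(1 + |ψ|)² reduces everything to
a power of 1 + |ψ|. -/
theorem integrable_env_rescaled {δ : ℝ} (hδ : 0 < δ) (k G n₁ : ℕ) (h1 : 1 ≤ n₁)
    (h : (m : ℝ) + k + G < 2 * δ * n₁) :
    Integrable fun ψ : Vec m =>
      ‖ψ‖ ^ k * (1 + ‖ψ‖) ^ G * env δ ((Real.sqrt n₁)⁻¹ • ψ) ^ n₁ := by
  have hn1 : (0 : ℝ) < n₁ := by exact_mod_cast h1
  set c : ℝ := min 1 (δ / n₁) / 2 with hc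
  have hc0 : 0 < c := by have := lt_min one_pos (div_pos hδ hn1); positivity
  have hbase : ∀ ψ : Vec m, c * (1 + ‖ψ‖) ^ 2 ≤ 1 + δ * ‖ψ‖ ^ 2 / n₁ := by
    intro ψ
    have e1 : min 1 (δ / n₁) ≤ 1 := min_le_left _ _
    have e2 : min 1 (δ / n₁) ≤ δ / n₁ := min_le_right _ _
    have e3 : 0 < min 1 (δ / n₁) := lt_min one_pos (div_pos hδ hn1)
    have e4 : (1 + ‖ψ‖) ^ 2 ≤ 2 * (1 + ‖ψ‖ ^ 2) := by nlinarith [sq_nonneg (1 - ‖ψ‖)]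
    calc c * (1 + ‖ψ‖) ^ 2 ≤ c * (2 * (1 + ‖ψ‖ ^ 2)) := by gcongr
      _ = min 1 (δ / n₁) * 1 + min 1 (δ / n₁) * ‖ψ‖ ^ 2 := by rw [hc]; ring
      _ ≤ 1 * 1 + δ / n₁ * ‖ψ‖ ^ 2 := by gcongr
      _ = _ := by ring
  have hint : Integrable fun ψ : Vec m =>
      c ^ (-(δ * n₁)) * (1 + ‖ψ‖) ^ (-(2 * δ * n₁ - k - G)) := by
    apply Integrable.const_mul
    apply integrable_one_add_norm
    simp only [finrank_euclideanSpace, Fintype.card_fin]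
    linarith
  refine hint.mono' ?_ (Eventually.of_forall fun ψ => ?_)
  · refine Continuous.aestronglyMeasurable ?_
    have := (continuous_env (m := m) hδ).comp (continuous_const_smul ((Real.sqrt n₁)⁻¹))
    exact Continuous.mul (by fun_prop) (this.pow _)
  · have hp : (0 : ℝ) < 1 + ‖ψ‖ := by positivity
    have he : env δ ((Real.sqrt n₁)⁻¹ • ψ) ^ n₁ = (1 + δ * ‖ψ‖ ^ 2 / n₁) ^ (-(δ * n₁)) := by
      unfold env
      rw [norm_smul, mul_pow, norm_inv, Real.norm_of_nonneg (Real.sqrt_nonneg _), inv_pow,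
        Real.sq_sqrt hn1.le, ← Real.rpow_natCast, ← Real.rpow_mul (by positivity),
        show δ * ((n₁ : ℝ)⁻¹ * ‖ψ‖ ^ 2) = δ * ‖ψ‖ ^ 2 / n₁ by ring, neg_mul]
    rw [Real.norm_of_nonneg (by have := (env_pos hδ ((Real.sqrt n₁)⁻¹ • ψ)).le; positivity), he]
    calc ‖ψ‖ ^ k * (1 + ‖ψ‖) ^ G * (1 + δ * ‖ψ‖ ^ 2 / n₁) ^ (-(δ * n₁))
        ≤ (1 + ‖ψ‖) ^ k * (1 + ‖ψ‖) ^ G * (c * (1 + ‖ψ‖) ^ 2) ^ (-(δ * n₁)) := by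
          gcongr ?_ ^ _ * _ * ?_
          · linarith
          · exact Real.rpow_le_rpow_of_nonpos (by positivity) (hbase ψ)
              (by have := mul_pos hδ hn1; linarith)
      _ = _ := by
          rw [Real.mul_rpow hc0.le (by positivity), ← Real.rpow_natCast (1 + ‖ψ‖) 2,
            ← Real.rpow_natCast (1 + ‖ψ‖) k, ← Real.rpow_natCast (1 + ‖ψ‖) G,
            ← Real.rpow_mul hp.le, ← Real.rpow_add hp, mul_left_comm, ← Real.rpow_add hp]
          congr 2
          push_cast
          ring

/-- Moments of the `n`-th power of the envelope are of the order `n^{-(m+k)/2}`. -/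
theorem env_moment (δ : ℝ) (hδ : 0 < δ) (k G : ℕ) :
    ∃ (n₁ : ℕ) (C : ℝ), 1 ≤ n₁ ∧ 0 ≤ C ∧ ∀ n ≥ n₁,
      Integrable (fun φ : Vec m => ‖φ‖ ^ k * (1 + ‖φ‖) ^ G * env δ φ ^ n) ∧
      ∫ φ : Vec m, ‖φ‖ ^ k * (1 + ‖φ‖) ^ G * env δ φ ^ n ≤ C / Real.sqrt n ^ (m + k) := by
  obtain ⟨n₀, hn₀⟩ := exists_nat_gt (((m : ℝ) + k + G) / (2 * δ))
  have h1 : 1 ≤ n₀ + 1 := by omega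
  have hbig : (m : ℝ) + k + G < 2 * δ * (n₀ + 1 : ℕ) := by
    rw [div_lt_iff₀ (by positivity)] at hn₀
    push_cast
    nlinarith
  have hI := integrable_env_rescaled (m := m) hδ k G (n₀ + 1) h1 hbig
  have hI0 : ∀ ψ : Vec m,
      0 ≤ ‖ψ‖ ^ k * (1 + ‖ψ‖) ^ G * env δ ((Real.sqrt (n₀ + 1 : ℕ))⁻¹ • ψ) ^ (n₀ + 1) := by
    intro ψ
    have := (env_pos hδ ((Real.sqrt (n₀ + 1 : ℕ))⁻¹ • ψ)).le
    positivity
  refine ⟨n₀ + 1, _, h1, integral_nonneg (μ := volume) hI0, fun n hn => ?_⟩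
  have hnpos : (0 : ℝ) < n := by exact_mod_cast (lt_of_lt_of_le h1 hn)
  have hn1 : (1 : ℝ) ≤ n := by exact_mod_cast (le_trans h1 hn)
  set R : ℝ := Real.sqrt n with hR
  have hRpos : 0 < R := Real.sqrt_pos.2 hnpos
  have hR1 : 1 ≤ R := by rw [hR]; exact Real.one_le_sqrt.2 hn1
  set F : Vec m → ℝ := fun φ => ‖φ‖ ^ k * (1 + ‖φ‖) ^ G * env δ φ ^ n with hF
  have hFc : Continuous F := by
    have := continuous_env (m := m) hδ
    exact Continuous.mul (by fun_prop) (this.pow _)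
  have hF0 : ∀ φ, 0 ≤ F φ := fun φ => by have := (env_pos hδ φ).le; positivity
  -- With φ = ψ/√n the factor |φ|^k yields n^{-k/2}, and the rescaled envelope power is dominated by
  -- the fixed one at n₀ + 1; the Jacobian supplies the remaining n^{-m/2}.
  have hle : ∀ ψ : Vec m, F (R⁻¹ • ψ) ≤ (R ^ k)⁻¹ *
      (‖ψ‖ ^ k * (1 + ‖ψ‖) ^ G * env δ ((Real.sqrt (n₀ + 1 : ℕ))⁻¹ • ψ) ^ (n₀ + 1)) := by
    intro ψ
    have e1 := env_smul_pow_le hδ h1 hn ψ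
    have e0 := (env_pos hδ (R⁻¹ • ψ)).le
    have e2 : ‖R⁻¹ • ψ‖ = R⁻¹ * ‖ψ‖ := by
      rw [norm_smul, norm_inv, Real.norm_of_nonneg hRpos.le]
    have e3 : R⁻¹ * ‖ψ‖ ≤ ‖ψ‖ := by
      have : R⁻¹ ≤ 1 := inv_le_one_of_one_le₀ hR1
      nlinarith [norm_nonneg ψ]
    calc F (R⁻¹ • ψ) = (R⁻¹ * ‖ψ‖) ^ k * (1 + R⁻¹ * ‖ψ‖) ^ G * env δ (R⁻¹ • ψ) ^ n := by
          simp only [hF, e2]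
      _ ≤ (R⁻¹ * ‖ψ‖) ^ k * (1 + ‖ψ‖) ^ G *
            env δ ((Real.sqrt (n₀ + 1 : ℕ))⁻¹ • ψ) ^ (n₀ + 1) := by gcongr
      _ = _ := by rw [mul_pow, inv_pow]; ring
  have hint' : Integrable fun ψ : Vec m => F (R⁻¹ • ψ) := by
    refine (hI.const_mul (R ^ k)⁻¹).mono'
      (hFc.comp (continuous_const_smul _)).aestronglyMeasurable (Eventually.of_forall fun ψ => ?_)
    rw [Real.norm_of_nonneg (hF0 _)]
    exact hle ψ
  have hint : Integrable F := (integrable_comp_smul_iff volume F (inv_ne_zero hRpos.ne')).1 hint'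
  refine ⟨hint, ?_⟩
  have hsc := Measure.integral_comp_smul volume F R⁻¹
  simp only [finrank_euclideanSpace, Fintype.card_fin, inv_pow, inv_inv, smul_eq_mul] at hsc
  rw [abs_of_pos (by positivity)] at hsc
  have h3 : ∫ ψ : Vec m, F (R⁻¹ • ψ) ≤ (R ^ k)⁻¹ * ∫ ψ : Vec m,
      ‖ψ‖ ^ k * (1 + ‖ψ‖) ^ G * env δ ((Real.sqrt (n₀ + 1 : ℕ))⁻¹ • ψ) ^ (n₀ + 1) := by
    rw [← integral_const_mul]
    exact integral_mono hint' (hI.const_mul _) hle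
  rw [hsc] at h3
  rw [le_div_iff₀ (by positivity), pow_add]
  calc (∫ φ, F φ) * (R ^ m * R ^ k) = (R ^ m * ∫ φ, F φ) * R ^ k := by ring
    _ ≤ ((R ^ k)⁻¹ * _) * R ^ k := by gcongr
    _ = _ := by field_simp

/-- The same bound for exponents that are slightly smaller than `n`. -/
theorem env_moment_sub (δ : ℝ) (hδ : 0 < δ) (k G : ℕ) :
    ∃ (n₁ : ℕ) (C : ℝ), 3 ≤ n₁ ∧ 0 ≤ C ∧ ∀ n ≥ n₁, ∀ j ≤ 2,
      Integrable (fun φ : Vec m => ‖φ‖ ^ k * (1 + ‖φ‖) ^ G * env δ φ ^ (n - j)) ∧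
      ∫ φ : Vec m, ‖φ‖ ^ k * (1 + ‖φ‖) ^ G * env δ φ ^ (n - j) ≤
        C / Real.sqrt n ^ (m + k) := by
  obtain ⟨n₁, C, h1, hC, h⟩ := env_moment (m := m) δ hδ k G
  refine ⟨n₁ + 2, C * 2 ^ (m + k), by omega, by positivity, fun n hn j hj => ?_⟩
  obtain ⟨hi, hb⟩ := h (n - j) (by omega)
  refine ⟨hi, hb.trans ?_⟩
  have hn3 : 3 ≤ n := by omega
  -- True for j ≤ 2 as soon as n ≥ 3. It lets √(n - j) be replaced by √n at the price of the factor
  -- 2^(m + k).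
  have hnj : (n : ℝ) ≤ 4 * (n - j : ℕ) := by
    have : n ≤ 4 * (n - j) := by omega
    exact_mod_cast this
  have hs : Real.sqrt n ≤ 2 * Real.sqrt (n - j : ℕ) := by
    rw [show (2 : ℝ) = Real.sqrt 4 by
      rw [show (4 : ℝ) = 2 ^ 2 by norm_num, Real.sqrt_sq (by norm_num)],
      ← Real.sqrt_mul (by norm_num)]
    exact Real.sqrt_le_sqrt hnj
  have hnp : 0 < Real.sqrt n := Real.sqrt_pos.2 (by exact_mod_cast (by omega : 0 < n))
  have hnp' : 0 < Real.sqrt (n - j : ℕ) :=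
    Real.sqrt_pos.2 (by exact_mod_cast (by omega : 0 < n - j))
  rw [div_le_div_iff₀ (by positivity) (by positivity), mul_assoc, ← mul_pow]
  gcongr

end Envelope

/-! ### Expansion of characteristic integrals -/

section Expansion

/-- For |a| ≤ 1 this is the exponential tail bound with e^{|a|} ≤ 3. For |a| ≥ 1 the exponential has
modulus 1 and each of the j terms is at most |a|^j. -/
theorem norm_cexp_mul_I_sub_sum_le (a : ℝ) (j : ℕ) :
    ‖Complex.exp (a * Complex.I) -
      ∑ k ∈ Finset.range j, (a * Complex.I) ^ k / (k.factorial : ℂ)‖ ≤ (j + 3) * |a| ^ j := by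
  have hna : ‖(a : ℂ) * Complex.I‖ = |a| := by simp
  rcases le_total |a| 1 with h | h
  · refine (Complex.norm_exp_sub_sum_le_norm_mul_exp _ j).trans ?_
    rw [hna, mul_comm]
    have h3 : Real.exp |a| ≤ 3 :=
      (Real.exp_le_exp.2 h).trans (by have := Real.exp_one_lt_d9; linarith)
    have : (0 : ℝ) ≤ j := by positivity
    gcongr
    linarith
  · refine (norm_sub_le _ _).trans ?_
    rw [Complex.norm_exp_ofReal_mul_I]
    have h1 : ∀ k ∈ Finset.range j, ‖(a * Complex.I) ^ k / (k.factorial : ℂ)‖ ≤ |a| ^ j := by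
      intro k hk
      rw [norm_div, norm_pow, hna, Complex.norm_natCast]
      calc |a| ^ k / (k.factorial : ℝ) ≤ |a| ^ k :=
            div_le_self (by positivity) (by exact_mod_cast Nat.factorial_pos k)
        _ ≤ |a| ^ j := pow_le_pow_right₀ h (Finset.mem_range.1 hk).le
    have h2 := norm_sum_le_of_le _ h1
    simp only [Finset.sum_const, Finset.card_range, nsmul_eq_mul] at h2
    have h3 : 1 ≤ |a| ^ j := one_le_pow₀ h
    nlinarith

variable {Ω : Type*} [MeasurableSpace Ω] {π : Measure Ω}

/-- Products of a weight of order `A w` and `j ≤ 4` factors of order `t w` are integrable when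
`w ^ 5` is, with the obvious bound. -/
theorem integrable_mul_pow_of_le {w f g : Ω → ℝ} {A t : ℝ} (j : ℕ) (hj : j ≤ 4)
    (hw1 : ∀ x, 1 ≤ w x) (hw : Integrable (fun x => w x ^ 5) π)
    (hf : AEStronglyMeasurable f π) (hg : AEStronglyMeasurable g π)
    (hfA : ∀ x, |f x| ≤ A * w x) (hgt : ∀ x, |g x| ≤ t * w x) :
    Integrable (fun x => f x * g x ^ j) π ∧ Integrable (fun x => |f x| * |g x| ^ j) π ∧
      ∫ x, |f x| * |g x| ^ j ∂π ≤ A * t ^ j * ∫ x, w x ^ 5 ∂π := by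
  -- The signs of A and t are read off at a point. On an empty space they are unconstrained, but
  -- then the measure is zero.
  rcases isEmpty_or_nonempty Ω with hΩ | ⟨⟨x₀⟩⟩
  · have : π = 0 := Measure.eq_zero_of_isEmpty π
    subst this
    simp
  have hA : 0 ≤ A := by
    have := (abs_nonneg _).trans (hfA x₀)
    have := hw1 x₀
    nlinarith
  have ht : 0 ≤ t := by
    have := (abs_nonneg _).trans (hgt x₀)
    have := hw1 x₀
    nlinarith
  have hle : ∀ x, |f x| * |g x| ^ j ≤ A * t ^ j * w x ^ 5 := by
    intro x
    have h1 := hw1 x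
    calc |f x| * |g x| ^ j ≤ (A * w x) * (t * w x) ^ j := by
          gcongr
          · exact hfA x
          · exact hgt x
      _ = A * t ^ j * w x ^ (j + 1) := by rw [mul_pow, pow_succ]; ring
      _ ≤ A * t ^ j * w x ^ 5 := by
          have : j + 1 ≤ 5 := by omega
          gcongr
  have hI : Integrable (fun x => |f x| * |g x| ^ j) π := by
    refine (hw.const_mul (A * t ^ j)).mono' (hf.norm.mul (hg.norm.pow j))
      (Eventually.of_forall fun x => ?_)
    rw [Real.norm_of_nonneg (by positivity)]
    exact hle x
  refine ⟨?_, hI, ?_⟩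
  · refine hI.mono' (hf.mul (hg.pow j)) (Eventually.of_forall fun x => ?_)
    simp
  · rw [← integral_const_mul]
    exact integral_mono hI (hw.const_mul _) hle

theorem integrable_mul_cexp {w f g : Ω → ℝ} {A : ℝ} (hw1 : ∀ x, 1 ≤ w x)
    (hw : Integrable (fun x => w x ^ 5) π)
    (hf : AEStronglyMeasurable f π) (hg : AEStronglyMeasurable g π)
    (hfA : ∀ x, |f x| ≤ A * w x) :
    Integrable (fun x => (f x : ℂ) * Complex.exp (g x * Complex.I)) π := by
  have hI := (integrable_mul_pow_of_le (t := 0) (g := fun _ => 0) 0 (by norm_num) hw1 hw hf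
    aestronglyMeasurable_const hfA (by simp)).1
  simp only [pow_zero, mul_one] at hI
  refine hI.norm.mono' ?_ (Eventually.of_forall fun x => ?_)
  · exact (Complex.continuous_ofReal.comp_aestronglyMeasurable hf).mul
      (Complex.continuous_exp.comp_aestronglyMeasurable
        ((Complex.continuous_ofReal.comp_aestronglyMeasurable hg).mul_const _))
  · rw [norm_mul, Complex.norm_exp_ofReal_mul_I]
    simp

/-- Taylor expansion of `∫ f e^{ig}` in powers of `g`. -/
theorem norm_integral_mul_cexp_sub_le {w f g : Ω → ℝ} {A t : ℝ} (j : ℕ) (hj : j ≤ 4)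
    (hw1 : ∀ x, 1 ≤ w x) (hw : Integrable (fun x => w x ^ 5) π)
    (hf : AEStronglyMeasurable f π) (hg : AEStronglyMeasurable g π)
    (hfA : ∀ x, |f x| ≤ A * w x) (hgt : ∀ x, |g x| ≤ t * w x) :
    ‖(∫ x, (f x : ℂ) * Complex.exp (g x * Complex.I) ∂π) -
      ∑ k ∈ Finset.range j, Complex.I ^ k / (k.factorial : ℂ) *
        ((∫ x, f x * g x ^ k ∂π : ℝ) : ℂ)‖ ≤ (j + 3) * (A * t ^ j * ∫ x, w x ^ 5 ∂π) := by
  have hk : ∀ k ∈ Finset.range j, Integrable (fun x => Complex.I ^ k / (k.factorial : ℂ) *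
      ((f x * g x ^ k : ℝ) : ℂ)) π := fun k hk =>
    ((integrable_mul_pow_of_le k (by have := Finset.mem_range.1 hk; omega) hw1 hw hf hg hfA
      hgt).1.ofReal).const_mul _
  have hE := integrable_mul_cexp hw1 hw hf hg hfA
  have h1 : (∫ x, (f x : ℂ) * Complex.exp (g x * Complex.I) ∂π) -
      ∑ k ∈ Finset.range j, Complex.I ^ k / (k.factorial : ℂ) *
        ((∫ x, f x * g x ^ k ∂π : ℝ) : ℂ) =
      ∫ x, (f x : ℂ) * (Complex.exp (g x * Complex.I) -
        ∑ k ∈ Finset.range j, (g x * Complex.I) ^ k / (k.factorial : ℂ)) ∂π := by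
    have h2 : ∀ k ∈ Finset.range j, Complex.I ^ k / (k.factorial : ℂ) *
        ((∫ x, f x * g x ^ k ∂π : ℝ) : ℂ) = ∫ x, Complex.I ^ k / (k.factorial : ℂ) *
      ((f x * g x ^ k : ℝ) : ℂ) ∂π := by
      intro k _
      rw [integral_const_mul]
      congr 1
      exact integral_ofReal.symm
    rw [Finset.sum_congr rfl h2, ← integral_finsetSum _ hk, ← integral_sub hE
      (integrable_finsetSum _ hk)]
    refine integral_congr_ae (Eventually.of_forall fun x => ?_)
    simp only [mul_sub, Finset.mul_sum]
    congr 1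
    refine Finset.sum_congr rfl fun k _ => ?_
    push_cast
    rw [mul_pow]
    ring
  obtain ⟨-, hI, hle⟩ := integrable_mul_pow_of_le j hj hw1 hw hf hg hfA hgt
  rw [h1]
  calc _ ≤ ∫ x, (j + 3) * (|f x| * |g x| ^ j) ∂π := by
        refine norm_integral_le_of_norm_le (hI.const_mul _) (Eventually.of_forall fun x => ?_)
        rw [norm_mul, Complex.norm_real, Real.norm_eq_abs]
        calc _ ≤ |f x| * ((j + 3) * |g x| ^ j) := by
              gcongr
              exact norm_cexp_mul_I_sub_sum_le _ _
          _ = _ := by ring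
    _ ≤ _ := by
        rw [integral_const_mul]
        gcongr

end Expansion

/-! ### Powers of characteristic functions -/

/-- Telescoping. At n = 0 the truncated exponent n - 1 is harmless because of the factor n. -/
theorem norm_pow_sub_pow_le {a b : ℂ} {r : ℝ} (ha : ‖a‖ ≤ r) (hb : ‖b‖ ≤ r) (n : ℕ) :
    ‖a ^ n - b ^ n‖ ≤ n * ‖a - b‖ * r ^ (n - 1) := by
  have hr : 0 ≤ r := (norm_nonneg a).trans ha
  induction n with
  | zero => simp
  | succ n ih =>
    have h1 : a ^ (n + 1) - b ^ (n + 1) = a * (a ^ n - b ^ n) + (a - b) * b ^ n := by ring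
    rw [h1]
    calc _ ≤ ‖a‖ * ‖a ^ n - b ^ n‖ + ‖a - b‖ * ‖b‖ ^ n := by
          refine (norm_add_le _ _).trans ?_
          rw [norm_mul, norm_mul, norm_pow]
      _ ≤ r * (n * ‖a - b‖ * r ^ (n - 1)) + ‖a - b‖ * r ^ n := by gcongr
      _ = _ := by
          rcases n with _ | n
          · simp
          · simp only [Nat.add_sub_cancel, pow_succ]
            push_cast
            ring

/-- The integral of an odd real function against a Hermitian function only sees the imaginary
part. -/
theorem integral_odd_mul_hermitian {m : ℕ} {o : Vec m → ℝ} {h : Vec m → ℂ}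
    (ho : ∀ φ, o (-φ) = -o φ) (hh : ∀ φ, h (-φ) = starRingEnd ℂ (h φ))
    (hint : Integrable fun φ => (o φ : ℂ) * h φ) :
    ∫ φ, (o φ : ℂ) * h φ = ∫ φ, (o φ : ℂ) * (((h φ).im : ℂ) * Complex.I) := by
  have h1 : ∫ φ, (o φ : ℂ) * h φ = ∫ φ, -((o φ : ℂ) * starRingEnd ℂ (h φ)) := by
    rw [← integral_neg_eq_self]
    refine integral_congr_ae (Eventually.of_forall fun φ => ?_)
    simp [ho, hh]
  have hint' : Integrable fun φ => -((o φ : ℂ) * starRingEnd ℂ (h φ)) := by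
    have := hint.comp_neg
    refine this.congr (Eventually.of_forall fun φ => ?_)
    simp [ho, hh]
  -- Adding the integral to its reflection under φ ↦ -φ replaces h by h - h̄ = 2i Im h.
  have h2 : (2 : ℂ) * ∫ φ, (o φ : ℂ) * h φ =
      2 * ∫ φ, (o φ : ℂ) * (((h φ).im : ℂ) * Complex.I) := by
    rw [two_mul]
    nth_rewrite 2 [h1]
    rw [← integral_add hint hint', ← integral_const_mul]
    refine integral_congr_ae (Eventually.of_forall fun φ => ?_)
    apply Complex.ext
    · simp
    · simp
      ring
  exact mul_left_cancel₀ two_ne_zero h2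

/-- The characteristic function of `X - y` when `X` has law `π`. -/
def centeredChar {m : ℕ} (π : Measure (Vec m)) (y φ : Vec m) : ℂ :=
  ∫ x, Complex.exp ((inner ℝ (x - y) φ : ℝ) * Complex.I) ∂π

/-! ### The centred characteristic function and exact integration by parts -/

section CenteredChar

variable {m : ℕ} {π : Measure (Vec m)} {y : Vec m} {B δ : ℝ}

theorem centeredChar_neg (φ : Vec m) :
    centeredChar π y (-φ) = starRingEnd ℂ (centeredChar π y φ) := by
  unfold centeredChar
  rw [← integral_conj]
  refine integral_congr_ae (Eventually.of_forall fun x => ?_)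
  simp [← Complex.exp_conj]

theorem centeredChar_eq (φ : Vec m) :
    centeredChar π y φ = Complex.exp (-((inner ℝ y φ : ℝ) * Complex.I)) *
      ∫ x, Complex.exp ((inner ℝ x φ : ℝ) * Complex.I) ∂π := by
  unfold centeredChar
  rw [← integral_const_mul]
  refine integral_congr_ae (Eventually.of_forall fun x => ?_)
  simp only [← Complex.exp_add, inner_sub_left]
  congr 1
  push_cast
  ring

theorem norm_centeredChar_le (hdec : ∀ φ : Vec m,
    ‖∫ x, Complex.exp ((inner ℝ x φ : ℝ) * Complex.I) ∂π‖ ≤ env δ φ) (φ : Vec m) :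
    ‖centeredChar π y φ‖ ≤ env δ φ := by
  rw [centeredChar_eq, norm_mul]
  have : ‖Complex.exp (-((inner ℝ y φ : ℝ) * Complex.I))‖ = 1 := by
    rw [← neg_mul, ← Complex.ofReal_neg, Complex.norm_exp_ofReal_mul_I]
  rw [this, one_mul]
  exact hdec φ

theorem continuous_integral_mul_cexp {f : Vec m → ℝ} (hf : Integrable f π) :
    Continuous fun φ : Vec m =>
      ∫ x, (f x : ℂ) * Complex.exp ((inner ℝ (x - y) φ : ℝ) * Complex.I) ∂π := by
  refine continuous_of_dominated (bound := fun x => |f x|) (fun φ => ?_) (fun φ => ?_) hf.norm ?_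
  · refine (Complex.continuous_ofReal.comp_aestronglyMeasurable hf.1).mul ?_
    exact Continuous.aestronglyMeasurable (by fun_prop)
  · refine Eventually.of_forall fun x => ?_
    rw [norm_mul, Complex.norm_exp_ofReal_mul_I]
    simp
  · exact Eventually.of_forall fun x => by fun_prop

/-- The weight 1 + |y| + |x| dominates 1, |x| and |x - y| at once, so a single fifth moment of it
controls every integral that occurs below. -/
theorem abs_inner_sub_le (x w : Vec m) :
    |inner ℝ (x - y) w| ≤ ‖w‖ * (1 + ‖y‖ + ‖x‖) := by
  calc _ ≤ ‖x - y‖ * ‖w‖ := abs_real_inner_le_norm _ _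
    _ ≤ (‖x‖ + ‖y‖) * ‖w‖ := by gcongr; exact norm_sub_le _ _
    _ ≤ _ := by nlinarith [norm_nonneg w]

theorem abs_inner_le (x w : Vec m) : |inner ℝ x w| ≤ ‖w‖ * (1 + ‖y‖ + ‖x‖) := by
  calc _ ≤ ‖x‖ * ‖w‖ := abs_real_inner_le_norm _ _
    _ ≤ _ := by nlinarith [norm_nonneg w, norm_nonneg y, mul_nonneg (norm_nonneg w) (norm_nonneg y)]

theorem one_le_weight (x : Vec m) : 1 ≤ 1 + ‖y‖ + ‖x‖ := by
  have := norm_nonneg x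
  have := norm_nonneg y
  linarith

theorem integrable_inner_sub (hw : Integrable (fun x : Vec m => (1 + ‖y‖ + ‖x‖) ^ 5) π)
    (w : Vec m) : Integrable (fun x => inner ℝ (x - y) w) π := by
  have := (integrable_mul_pow_of_le (π := π) (w := fun x => 1 + ‖y‖ + ‖x‖)
    (f := fun x : Vec m => inner ℝ (x - y) w) (g := fun _ => 0) (A := ‖w‖) (t := 0) 0
    (by norm_num) one_le_weight hw (Continuous.aestronglyMeasurable (by fun_prop))
    aestronglyMeasurable_const (fun x => abs_inner_sub_le x w) (by simp)).1
  simpa using this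

variable [IsProbabilityMeasure π]

theorem continuous_centeredChar : Continuous (centeredChar π y) := by
  have := continuous_integral_mul_cexp (π := π) (y := y) (integrable_const (1 : ℝ))
  show Continuous fun φ => centeredChar π y φ
  simpa [centeredChar] using! this

theorem one_le_of_weight (hw : Integrable (fun x : Vec m => (1 + ‖y‖ + ‖x‖) ^ 5) π)
    (hwB : ∫ x, (1 + ‖y‖ + ‖x‖) ^ 5 ∂π ≤ B) : 1 ≤ B := by
  refine le_trans ?_ hwB
  have : ∫ _ : Vec m, (1 : ℝ) ∂π ≤ ∫ x, (1 + ‖y‖ + ‖x‖) ^ 5 ∂π :=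
    integral_mono (integrable_const _) hw fun x => one_le_pow₀ (one_le_weight x)
  simpa using this

/-- Differentiation under the integral, with the integrable bound |(x - y)·w|. It identifies the
transforms with weight (x - y)·w as derivatives of the characteristic function, which is what makes
the integrations by parts exact. -/
theorem hasLineDerivAt_centeredChar
    (hw : Integrable (fun x : Vec m => (1 + ‖y‖ + ‖x‖) ^ 5) π) (φ w : Vec m) :
    HasLineDerivAt ℝ (centeredChar π y)
      (Complex.I * ∫ x, ((inner ℝ (x - y) w : ℝ) : ℂ) *
        Complex.exp ((inner ℝ (x - y) φ : ℝ) * Complex.I) ∂π) φ w := by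
  have hI := (integrable_inner_sub hw w).norm
  have key := hasDerivAt_integral_of_dominated_loc_of_deriv_le (μ := π) (𝕜 := ℝ) (x₀ := (0 : ℝ))
    (s := Set.univ) (bound := fun x => ‖inner ℝ (x - y) w‖)
    (F := fun t x => Complex.exp ((inner ℝ (x - y) (φ + t • w) : ℝ) * Complex.I))
    (F' := fun t x => Complex.I * (((inner ℝ (x - y) w : ℝ) : ℂ) *
        Complex.exp ((inner ℝ (x - y) (φ + t • w) : ℝ) * Complex.I)))
    Filter.univ_mem
    (Eventually.of_forall fun t => Continuous.aestronglyMeasurable (by fun_prop))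
    ((integrable_const (1 : ℝ)).mono' (Continuous.aestronglyMeasurable (by fun_prop))
      (Eventually.of_forall fun x => by rw [Complex.norm_exp_ofReal_mul_I]))
    (Continuous.aestronglyMeasurable (by fun_prop))
    (Eventually.of_forall fun x t _ => by
      rw [norm_mul, norm_mul, Complex.norm_exp_ofReal_mul_I]; simp)
    hI
    (Eventually.of_forall fun x t _ => by
      have h1 : HasDerivAt (fun t : ℝ => ((inner ℝ (x - y) (φ + t • w) : ℝ) : ℂ) * Complex.I)
          (((inner ℝ (x - y) w : ℝ) : ℂ) * Complex.I) t := by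
        have : HasDerivAt (fun t : ℝ => inner ℝ (x - y) (φ + t • w)) (inner ℝ (x - y) w) t := by
          simp only [inner_add_right, inner_smul_right]
          simpa using! ((hasDerivAt_id t).mul_const (inner ℝ (x - y) w)).const_add
            (inner ℝ (x - y) φ)
        exact this.ofReal_comp.mul_const _
      convert! h1.cexp using 1
      ring)
  have h2 := key.2
  unfold HasLineDerivAt centeredChar
  simpa [integral_const_mul] using! h2

theorem hasLineDerivAt_centeredChar_pow
    (hw : Integrable (fun x : Vec m => (1 + ‖y‖ + ‖x‖) ^ 5) π) (φ w : Vec m) (n : ℕ) :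
    HasLineDerivAt ℝ (fun φ => centeredChar π y φ ^ n)
      (n * centeredChar π y φ ^ (n - 1) * (Complex.I * ∫ x, ((inner ℝ (x - y) w : ℝ) : ℂ) *
        Complex.exp ((inner ℝ (x - y) φ : ℝ) * Complex.I) ∂π)) φ w := by
  have h := (hasLineDerivAt_centeredChar hw φ w)
  unfold HasLineDerivAt at h ⊢
  simpa using! h.pow n

/-- Integration by parts against a constant direction. -/
theorem integral_inner_const_mul_pow_eq_zero
    (hw : Integrable (fun x : Vec m => (1 + ‖y‖ + ‖x‖) ^ 5) π) (β : Vec m) (n : ℕ) (hn : n ≠ 0)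
    (hint : Integrable fun φ => centeredChar π y φ ^ n)
    (hint' : Integrable fun φ => centeredChar π y φ ^ (n - 1) *
      ∫ x, ((inner ℝ (x - y) β : ℝ) : ℂ) *
        Complex.exp ((inner ℝ (x - y) φ : ℝ) * Complex.I) ∂π) :
    ∫ φ, centeredChar π y φ ^ (n - 1) * ∫ x, ((inner ℝ (x - y) β : ℝ) : ℂ) *
        Complex.exp ((inner ℝ (x - y) φ : ℝ) * Complex.I) ∂π = 0 := by
  -- Integration by parts against the constant function 1: the integral of ∂_β(uⁿ) vanishes, and
  -- ∂_β(uⁿ) is n i u^{n-1} times the weighted transform.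
  have h := integral_bilinear_hasLineDerivAt_right_eq_neg_left_of_integrable (μ := volume)
    (f := fun _ : Vec m => (1 : ℂ)) (f' := fun _ => 0) (v := β)
    (g := fun φ => centeredChar π y φ ^ n)
    (g' := fun φ => n * centeredChar π y φ ^ (n - 1) * (Complex.I *
      ∫ x, ((inner ℝ (x - y) β : ℝ) : ℂ) *
        Complex.exp ((inner ℝ (x - y) φ : ℝ) * Complex.I) ∂π))
    (B := ContinuousLinearMap.mul ℝ ℂ) (by simp)
    (by
      simp only [ContinuousLinearMap.mul_apply', one_mul]
      refine (hint'.const_mul (n * Complex.I)).congr (Eventually.of_forall fun φ => ?_)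
      simp only
      ring)
    (by simpa using hint)
    (fun φ _ => by
      unfold HasLineDerivAt
      exact hasDerivAt_const _ _)
    (fun φ _ => hasLineDerivAt_centeredChar_pow hw φ β n)
  simp only [ContinuousLinearMap.mul_apply', one_mul, zero_mul, integral_zero, neg_zero] at h
  have h2 : (n * Complex.I : ℂ) * ∫ φ, centeredChar π y φ ^ (n - 1) *
      ∫ x, ((inner ℝ (x - y) β : ℝ) : ℂ) *
        Complex.exp ((inner ℝ (x - y) φ : ℝ) * Complex.I) ∂π = 0 := by
    rw [← h, ← integral_const_mul]
    refine integral_congr_ae (Eventually.of_forall fun φ => ?_)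
    simp only
    ring
  exact (mul_eq_zero.1 h2).resolve_left (by simp [hn])

/-- Integration by parts against a linear vector field. -/
theorem integral_inner_linear_mul_pow
    (hw : Integrable (fun x : Vec m => (1 + ‖y‖ + ‖x‖) ^ 5) π) (L : Vec m →L[ℝ] Vec m)
    (n : ℕ)
    (hint : Integrable fun φ => centeredChar π y φ ^ n)
    (hint1 : ∀ j, Integrable fun φ => ((L φ j : ℝ) : ℂ) * centeredChar π y φ ^ n)
    (hint' : ∀ j, Integrable fun φ => ((L φ j : ℝ) : ℂ) * (centeredChar π y φ ^ (n - 1) *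
      ∫ x, ((inner ℝ (x - y) (basisVec j) : ℝ) : ℂ) *
        Complex.exp ((inner ℝ (x - y) φ : ℝ) * Complex.I) ∂π)) :
    n * Complex.I * ∫ φ, centeredChar π y φ ^ (n - 1) * ∫ x, ((inner ℝ (x - y) (L φ) : ℝ) : ℂ) *
        Complex.exp ((inner ℝ (x - y) φ : ℝ) * Complex.I) ∂π =
      -((∑ j, L (basisVec j) j : ℝ) : ℂ) * ∫ φ, centeredChar π y φ ^ n := by
  have hcol : ∀ j, n * Complex.I * ∫ φ, ((L φ j : ℝ) : ℂ) * (centeredChar π y φ ^ (n - 1) *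
      ∫ x, ((inner ℝ (x - y) (basisVec j) : ℝ) : ℂ) *
        Complex.exp ((inner ℝ (x - y) φ : ℝ) * Complex.I) ∂π) =
      -((L (basisVec j) j : ℝ) : ℂ) * ∫ φ, centeredChar π y φ ^ n := by
    intro j
    -- One coordinate of the field φ ↦ Lφ at a time; the j-th coordinate contributes the diagonal
    -- entry L_jj, and the sum over j is the divergence tr L.
    have h := integral_bilinear_hasLineDerivAt_right_eq_neg_left_of_integrable (μ := volume)
      (f := fun φ : Vec m => ((L φ j : ℝ) : ℂ)) (f' := fun _ => ((L (basisVec j) j : ℝ) : ℂ))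
      (v := basisVec j)
      (g := fun φ => centeredChar π y φ ^ n)
      (g' := fun φ => n * centeredChar π y φ ^ (n - 1) * (Complex.I *
        ∫ x, ((inner ℝ (x - y) (basisVec j) : ℝ) : ℂ) *
          Complex.exp ((inner ℝ (x - y) φ : ℝ) * Complex.I) ∂π))
      (B := ContinuousLinearMap.mul ℝ ℂ)
      (by simpa using hint.const_mul _)
      (by
        simp only [ContinuousLinearMap.mul_apply']
        refine ((hint' j).const_mul (n * Complex.I)).congr (Eventually.of_forall fun φ => ?_)
        simp only
        ring)
      (by simpa using hint1 j)
      (fun φ _ => by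
        have h1 : HasFDerivAt (fun φ : Vec m => ((L φ j : ℝ) : ℂ))
            (Complex.ofRealCLM ∘L (EuclideanSpace.proj j) ∘L L) φ :=
          (Complex.ofRealCLM ∘L (EuclideanSpace.proj j) ∘L L).hasFDerivAt
        simpa using! h1.hasLineDerivAt (basisVec j))
      (fun φ _ => hasLineDerivAt_centeredChar_pow hw φ (basisVec j) n)
    simp only [ContinuousLinearMap.mul_apply'] at h
    rw [integral_const_mul] at h
    rw [neg_mul, ← h, ← integral_const_mul]
    refine integral_congr_ae (Eventually.of_forall fun φ => ?_)
    simp only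
    ring
  have hsum : ∀ φ, centeredChar π y φ ^ (n - 1) * ∫ x, ((inner ℝ (x - y) (L φ) : ℝ) : ℂ) *
        Complex.exp ((inner ℝ (x - y) φ : ℝ) * Complex.I) ∂π =
      ∑ j, ((L φ j : ℝ) : ℂ) * (centeredChar π y φ ^ (n - 1) *
      ∫ x, ((inner ℝ (x - y) (basisVec j) : ℝ) : ℂ) *
        Complex.exp ((inner ℝ (x - y) φ : ℝ) * Complex.I) ∂π) := by
    intro φ
    have hj : ∀ j ∈ Finset.univ, Integrable (fun x => ((L φ j : ℝ) : ℂ) *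
        (((inner ℝ (x - y) (basisVec j) : ℝ) : ℂ) *
          Complex.exp ((inner ℝ (x - y) φ : ℝ) * Complex.I))) π := fun j _ =>
      (integrable_mul_cexp (π := π) (w := fun x : Vec m => 1 + ‖y‖ + ‖x‖)
        (f := fun x => inner ℝ (x - y) (basisVec j)) (g := fun x => inner ℝ (x - y) φ)
        one_le_weight hw
        (Continuous.aestronglyMeasurable (by fun_prop))
        (Continuous.aestronglyMeasurable (by fun_prop))
        (fun x => abs_inner_sub_le x _)).const_mul _
    have h1 : ∫ x, ((inner ℝ (x - y) (L φ) : ℝ) : ℂ) *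
        Complex.exp ((inner ℝ (x - y) φ : ℝ) * Complex.I) ∂π =
        ∑ j, ((L φ j : ℝ) : ℂ) * ∫ x, ((inner ℝ (x - y) (basisVec j) : ℝ) : ℂ) *
        Complex.exp ((inner ℝ (x - y) φ : ℝ) * Complex.I) ∂π := by
      simp only [← integral_const_mul]
      rw [← integral_finsetSum _ hj]
      refine integral_congr_ae (Eventually.of_forall fun x => ?_)
      simp only [← mul_assoc, ← Finset.sum_mul]
      congr 1
      have : inner ℝ (x - y) (L φ) = ∑ j, L φ j * inner ℝ (x - y) (basisVec j) := by
        simp [PiLp.inner_apply]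
      rw [this]
      push_cast
      rfl
    rw [h1, Finset.mul_sum]
    refine Finset.sum_congr rfl fun j _ => ?_
    ring
  simp_rw [hsum]
  rw [integral_finsetSum _ fun j _ => hint' j, Finset.mul_sum,
    Finset.sum_congr rfl fun j _ => hcol j, ← Finset.sum_mul]
  push_cast
  rw [Finset.sum_neg_distrib]

end CenteredChar

/-! ### Nondegenerate variance and the lower bound for the integral of uⁿ -/

section LowerBound

variable {m : ℕ} {π : Measure (Vec m)} {y : Vec m} {B δ : ℝ}

theorem variance_le
    (hw : Integrable (fun x : Vec m => (1 + ‖y‖ + ‖x‖) ^ 5) π)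
    (hwB : ∫ x, (1 + ‖y‖ + ‖x‖) ^ 5 ∂π ≤ B) (φ : Vec m) :
    ∫ x, inner ℝ (x - y) φ ^ 2 ∂π ≤ B * ‖φ‖ ^ 2 := by
  have h := (integrable_mul_pow_of_le (π := π) (w := fun x : Vec m => 1 + ‖y‖ + ‖x‖)
    (f := fun _ => 1) (g := fun x => inner ℝ (x - y) φ) (A := 1) (t := ‖φ‖) 2 (by norm_num)
    one_le_weight hw aestronglyMeasurable_const (Continuous.aestronglyMeasurable (by fun_prop))
    (fun x => by simpa using one_le_weight x) (fun x => abs_inner_sub_le x φ)).2.2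
  simp only [abs_one, one_mul, sq_abs] at h
  refine h.trans ?_
  rw [mul_comm]
  gcongr

variable [IsProbabilityMeasure π]

theorem norm_centeredChar_sub_le
    (hw : Integrable (fun x : Vec m => (1 + ‖y‖ + ‖x‖) ^ 5) π)
    (hwB : ∫ x, (1 + ‖y‖ + ‖x‖) ^ 5 ∂π ≤ B) (hmean : ∀ w, ∫ x, inner ℝ (x - y) w ∂π = 0)
    (φ : Vec m) :
    ‖centeredChar π y φ - ((1 - (∫ x, inner ℝ (x - y) φ ^ 2 ∂π) / 2 : ℝ) : ℂ)‖ ≤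
      6 * B * ‖φ‖ ^ 3 := by
  have h := norm_integral_mul_cexp_sub_le (π := π) (w := fun x : Vec m => 1 + ‖y‖ + ‖x‖)
    (f := fun _ => 1) (g := fun x => inner ℝ (x - y) φ) (A := 1) (t := ‖φ‖) 3 (by norm_num)
    one_le_weight hw aestronglyMeasurable_const (Continuous.aestronglyMeasurable (by fun_prop))
    (fun x => by simpa using one_le_weight x) (fun x => abs_inner_sub_le x φ)
  have e : ∑ k ∈ Finset.range 3, Complex.I ^ k / (k.factorial : ℂ) *
        ((∫ x, 1 * inner ℝ (x - y) φ ^ k ∂π : ℝ) : ℂ) =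
      ((1 - (∫ x, inner ℝ (x - y) φ ^ 2 ∂π) / 2 : ℝ) : ℂ) := by
    simp [Finset.sum_range_succ, hmean φ]
    ring
  rw [e] at h
  simp only [Complex.ofReal_one, one_mul] at h
  refine h.trans ?_
  push_cast
  have : (0 : ℝ) ≤ ‖φ‖ ^ 3 := by positivity
  nlinarith

theorem abs_im_centeredChar_le
    (hw : Integrable (fun x : Vec m => (1 + ‖y‖ + ‖x‖) ^ 5) π)
    (hwB : ∫ x, (1 + ‖y‖ + ‖x‖) ^ 5 ∂π ≤ B) (hmean : ∀ w, ∫ x, inner ℝ (x - y) w ∂π = 0)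
    (φ : Vec m) : |(centeredChar π y φ).im| ≤ 6 * B * ‖φ‖ ^ 3 := by
  refine le_trans ?_ (norm_centeredChar_sub_le hw hwB hmean φ)
  refine le_trans (le_of_eq ?_) (Complex.abs_im_le_norm _)
  rw [Complex.sub_im, Complex.ofReal_im, sub_zero]

/-- The decay of the characteristic function forces a nondegenerate covariance. -/
theorem le_variance (hδ : 0 < δ)
    (hw : Integrable (fun x : Vec m => (1 + ‖y‖ + ‖x‖) ^ 5) π)
    (hwB : ∫ x, (1 + ‖y‖ + ‖x‖) ^ 5 ∂π ≤ B) (hmean : ∀ w, ∫ x, inner ℝ (x - y) w ∂π = 0)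
    (hdec : ∀ φ : Vec m, ‖∫ x, Complex.exp ((inner ℝ x φ : ℝ) * Complex.I) ∂π‖ ≤ env δ φ)
    (φ : Vec m) :
    2 * δ ^ 2 * ‖φ‖ ^ 2 ≤ ∫ x, inner ℝ (x - y) φ ^ 2 ∂π := by
  set V := ∫ x, inner ℝ (x - y) φ ^ 2 ∂π with hV
  -- On the ray tφ the real part of u is at least 1 - t²V/2 - O(t³) and at most the envelope. Divide
  -- by t² and let t → 0: the denominators tend to 1 and the cubic term disappears.
  have key : ∀ t : ℝ, 0 < t → 2 * (δ ^ 2 * ‖φ‖ ^ 2 / ((1 + δ * (t * ‖φ‖) ^ 2) *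
      (1 + δ * (δ * (t * ‖φ‖) ^ 2)))) - 12 * B * ‖φ‖ ^ 3 * t ≤ V := by
    intro t ht
    have h1 := norm_centeredChar_sub_le hw hwB hmean (t • φ)
    have h2 := norm_centeredChar_le hdec (y := y) (t • φ)
    have hVt : ∫ x, inner ℝ (x - y) (t • φ) ^ 2 ∂π = t ^ 2 * V := by
      simp only [inner_smul_right, mul_pow, hV, integral_const_mul]
    have hn : ‖t • φ‖ = t * ‖φ‖ := by rw [norm_smul, Real.norm_of_nonneg ht.le]
    rw [hVt, hn] at h1
    set q := δ * (t * ‖φ‖) ^ 2 with hq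
    have hq0 : 0 ≤ q := by positivity
    -- Uses log(1 + q) ≥ q/(1 + q) and e^z ≥ 1 + z, so that the envelope is visibly below 1 by a
    -- multiple of q.
    have henv : env δ (t • φ) ≤ 1 - δ * q / ((1 + q) * (1 + δ * q)) := by
      unfold env
      rw [hn]
      have hl : q / (1 + q) ≤ Real.log (1 + q) := by
        have := Real.one_sub_inv_le_log_of_pos (by linarith : 0 < 1 + q)
        refine le_trans (le_of_eq ?_) this
        field_simp
        ring
      have e1 : (1 + q) ^ (-δ) = (Real.exp (δ * Real.log (1 + q)))⁻¹ := by
        rw [Real.rpow_def_of_pos (by linarith), ← Real.exp_neg]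
        congr 1; ring
      rw [e1]
      have e2 : 1 + δ * (q / (1 + q)) ≤ Real.exp (δ * Real.log (1 + q)) := by
        have := Real.add_one_le_exp (δ * Real.log (1 + q))
        have : δ * (q / (1 + q)) ≤ δ * Real.log (1 + q) := by gcongr
        linarith
      calc _ ≤ (1 + δ * (q / (1 + q)))⁻¹ := by
            apply inv_anti₀ (by positivity) e2
        _ ≤ _ := by
          have h3 : δ * q / ((1 + q) * (1 + δ * q)) ≤ δ * q / (1 + q + δ * q) := by
            gcongr
            nlinarith [mul_nonneg (mul_nonneg hδ.le hq0) hq0]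
          have h4 : (1 + δ * (q / (1 + q)))⁻¹ = 1 - δ * q / (1 + q + δ * q) := by
            field_simp
            ring
          linarith
    have h3 : 1 - t ^ 2 * V / 2 - 6 * B * (t * ‖φ‖) ^ 3 ≤ env δ (t • φ) := by
      have e := Complex.abs_re_le_norm (centeredChar π y (t • φ) -
        ((1 - t ^ 2 * V / 2 : ℝ) : ℂ))
      rw [Complex.sub_re, Complex.ofReal_re] at e
      have e' := (abs_le.1 (e.trans h1)).1
      have e'' := (Complex.re_le_norm (centeredChar π y (t • φ))).trans h2
      linarith
    have h4 : δ * q / ((1 + q) * (1 + δ * q)) =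
        t ^ 2 * (δ ^ 2 * ‖φ‖ ^ 2 / ((1 + q) * (1 + δ * q))) := by
      rw [← mul_div_assoc]
      congr 1
      rw [hq]; ring
    rw [h4] at henv
    have h5 : t ^ 2 * (2 * (δ ^ 2 * ‖φ‖ ^ 2 / ((1 + q) * (1 + δ * q))) - 12 * B * ‖φ‖ ^ 3 * t) ≤
        t ^ 2 * V := by nlinarith
    exact le_of_mul_le_mul_left h5 (by positivity)
  have hlim : Tendsto (fun t : ℝ => 2 * (δ ^ 2 * ‖φ‖ ^ 2 / ((1 + δ * (t * ‖φ‖) ^ 2) *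
      (1 + δ * (δ * (t * ‖φ‖) ^ 2)))) - 12 * B * ‖φ‖ ^ 3 * t) (𝓝[>] 0)
      (𝓝 (2 * (δ ^ 2 * ‖φ‖ ^ 2 / ((1 + δ * (0 * ‖φ‖) ^ 2) *
      (1 + δ * (δ * (0 * ‖φ‖) ^ 2)))) - 12 * B * ‖φ‖ ^ 3 * 0)) := by
    refine tendsto_nhdsWithin_of_tendsto_nhds (ContinuousAt.tendsto ?_)
    refine ContinuousAt.sub (ContinuousAt.mul continuousAt_const
      (ContinuousAt.div (by fun_prop) (by fun_prop) (by simp))) (by fun_prop)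
  have := le_of_tendsto hlim (eventually_nhdsWithin_of_forall fun t ht => key t ht)
  simpa [mul_assoc] using this

/-- The integral of the `n`-th power of the characteristic function is at least of the order
`n^{-m/2}`, with constants that depend on `π` only through `δ` and `B`. -/
theorem exists_le_re_integral_centeredChar_pow (m : ℕ) (δ B : ℝ) (hδ : 0 < δ) :
    ∃ (n₀ : ℕ) (c : ℝ), 1 ≤ n₀ ∧ 0 < c ∧ ∀ (π : Measure (Vec m)) [IsProbabilityMeasure π]
      (y : Vec m), Integrable (fun x : Vec m => (1 + ‖y‖ + ‖x‖) ^ 5) π →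
      ∫ x, (1 + ‖y‖ + ‖x‖) ^ 5 ∂π ≤ B → (∀ w, ∫ x, inner ℝ (x - y) w ∂π = 0) →
      (∀ φ : Vec m, ‖∫ x, Complex.exp ((inner ℝ x φ : ℝ) * Complex.I) ∂π‖ ≤ env δ φ) →
      ∀ n ≥ n₀, Integrable (fun φ => centeredChar π y φ ^ n) ∧
        c / Real.sqrt n ^ m ≤ (∫ φ, centeredChar π y φ ^ n).re := by
  -- The weight is at least 1 and the law has mass 1, so for B < 1 there is no admissible law.
  rcases lt_or_ge B 1 with hB | hB
  · exact ⟨1, 1, le_rfl, one_pos, fun π _ y hw hwB _ _ => absurd (one_le_of_weight hw hwB)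
      (not_le.2 hB)⟩
  obtain ⟨n₁, C₁, hn₁, hC₁, h₁⟩ := env_moment_sub (m := m) δ hδ 3 1
  obtain ⟨n₂, C₂, hn₂, hC₂, h₂⟩ := env_moment_sub (m := m) δ hδ 0 0
  -- c₀ n^{-m/2} is the integral of exp(-nB|φ|²/2), which lies below the Gaussian exp(-nV/2).
  set c₀ : ℝ := Real.sqrt (2 * Real.pi / B) ^ m with hc₀
  have hc₀pos : 0 < c₀ := by
    have := Real.pi_pos
    positivity
  set K : ℝ := (6 * B + B ^ 2) * C₁ with hK
  have hK0 : 0 ≤ K := by positivity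
  obtain ⟨n₃, hn₃⟩ := exists_nat_gt ((2 * K / c₀) ^ 2)
  refine ⟨n₁ + n₂ + n₃, c₀ / 2, by omega, by positivity, ?_⟩
  intro π _ y hw hwB hmean hdec n hn
  set u := centeredChar π y with hu
  set V : Vec m → ℝ := fun φ => ∫ x, inner ℝ (x - y) φ ^ 2 ∂π with hV
  have hVnn : ∀ φ, 0 ≤ V φ := fun φ => integral_nonneg fun x => sq_nonneg _
  have hVle : ∀ φ, V φ ≤ B * ‖φ‖ ^ 2 := fun φ => variance_le hw hwB φ
  have hnpos : (0 : ℝ) < n := by exact_mod_cast (by omega : 0 < n)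
  have hue : ∀ φ, ‖u φ‖ ≤ env δ φ := norm_centeredChar_le hdec
  -- The comparison Gaussian lies under the same envelope as u: V ≥ 2δ²|φ|² and log(1 + δ|φ|²) ≤
  -- δ|φ|². The telescoped difference of n-th powers can then be bounded by envelope powers.
  have hge : ∀ φ, Real.exp (-(V φ / 2)) ≤ env δ φ := by
    intro φ
    have h1 := le_variance hδ hw hwB hmean hdec φ
    have h2 := Real.log_le_sub_one_of_pos (by have := one_le_env_base hδ φ; linarith :
      0 < 1 + δ * ‖φ‖ ^ 2)
    unfold env
    rw [Real.rpow_def_of_pos (by have := one_le_env_base hδ φ; linarith)]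
    apply Real.exp_le_exp.2
    have : 2 * δ ^ 2 * ‖φ‖ ^ 2 ≤ V φ := h1
    nlinarith
  -- Both functions equal 1 - V/2 up to third order: u with error 6B|φ|³, the Gaussian with error
  -- (V/2)² ≤ B²|φ|⁴.
  have hdiff : ∀ φ, ‖u φ - (Real.exp (-(V φ / 2)) : ℂ)‖ ≤
      (6 * B + B ^ 2) * (‖φ‖ ^ 3 * (1 + ‖φ‖) ^ 1) := by
    intro φ
    have h1 : ‖u φ - ((1 - V φ / 2 : ℝ) : ℂ)‖ ≤ 6 * B * ‖φ‖ ^ 3 :=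
      norm_centeredChar_sub_le hw hwB hmean φ
    set z := V φ / 2 with hz
    have hz0 : 0 ≤ z := by have := hVnn φ; positivity
    have hz1 : z ≤ B * ‖φ‖ ^ 2 := by have := hVle φ; have := hVnn φ; linarith
    have h2 : |Real.exp (-z) - (1 - z)| ≤ z ^ 2 := by
      have e1 : 1 - z ≤ Real.exp (-z) := by have := Real.add_one_le_exp (-z); linarith
      have e2 : Real.exp (-z) ≤ (1 + z)⁻¹ := by
        rw [Real.exp_neg]
        exact inv_anti₀ (by linarith) (by have := Real.add_one_le_exp z; linarith)
      rw [abs_of_nonneg (by linarith)]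
      have e3 : (1 + z)⁻¹ ≤ 1 - z + z ^ 2 := by
        rw [inv_le_iff_one_le_mul₀ (by linarith)]
        nlinarith [pow_nonneg hz0 3]
      linarith
    have h3 : ‖((1 - z : ℝ) : ℂ) - (Real.exp (-z) : ℂ)‖ ≤ B ^ 2 * ‖φ‖ ^ 4 := by
      rw [← Complex.ofReal_sub, Complex.norm_real, Real.norm_eq_abs, abs_sub_comm]
      refine h2.trans ?_
      calc z ^ 2 ≤ (B * ‖φ‖ ^ 2) ^ 2 := by gcongr
        _ = _ := by ring
    calc _ ≤ 6 * B * ‖φ‖ ^ 3 + B ^ 2 * ‖φ‖ ^ 4 := by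
          have := norm_add_le (u φ - ((1 - z : ℝ) : ℂ)) (((1 - z : ℝ) : ℂ) - (Real.exp (-z) : ℂ))
          rw [sub_add_sub_cancel] at this
          linarith
      _ ≤ _ := by
        have e1 : 0 ≤ B * ‖φ‖ ^ 4 := by positivity
        have e2 : 0 ≤ B ^ 2 * ‖φ‖ ^ 3 := by positivity
        nlinarith
  have hVm : StronglyMeasurable V :=
    StronglyMeasurable.integral_prod_right (f := fun φ x => inner ℝ (x - y) φ ^ 2)
      (Continuous.stronglyMeasurable (by fun_prop))
  obtain ⟨hi0, -⟩ := h₂ n (by omega) 0 (by norm_num)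
  simp only [pow_zero, one_mul, Nat.sub_zero] at hi0
  have hui : Integrable fun φ => u φ ^ n := by
    refine hi0.mono' ((continuous_centeredChar (π := π) (y := y)).pow n).aestronglyMeasurable
      (Eventually.of_forall fun φ => ?_)
    rw [norm_pow]
    exact pow_le_pow_left₀ (norm_nonneg _) (hue φ) n
  have hgi : Integrable fun φ => (Real.exp (-(V φ / 2)) : ℂ) ^ n := by
    refine hi0.mono' (Continuous.comp_stronglyMeasurable
      (g := fun v : ℝ => (Real.exp (-(v / 2)) : ℂ) ^ n) (by fun_prop) hVm).aestronglyMeasurable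
      (Eventually.of_forall fun φ => ?_)
    rw [norm_pow, Complex.norm_real, Real.norm_of_nonneg (Real.exp_pos _).le]
    exact pow_le_pow_left₀ (Real.exp_pos _).le (hge φ) n
  refine ⟨hui, ?_⟩
  set R := Real.sqrt n with hR
  have hRpos : 0 < R := Real.sqrt_pos.2 hnpos
  have hR2 : R ^ 2 = n := Real.sq_sqrt hnpos.le
  -- Telescoping costs a factor n, the cubic difference gains n^{-3/2}; the error is thus smaller
  -- than the main term by n^{-1/2}.
  have herr : ‖(∫ φ, u φ ^ n) - ∫ φ, (Real.exp (-(V φ / 2)) : ℂ) ^ n‖ ≤ K / R / R ^ m := by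
    obtain ⟨hi1, hb1⟩ := h₁ n (by omega) 1 (by norm_num)
    rw [← integral_sub hui hgi]
    calc _ ≤ ∫ φ : Vec m, (n * (6 * B + B ^ 2)) * (‖φ‖ ^ 3 * (1 + ‖φ‖) ^ 1 * env δ φ ^ (n - 1)) := by
          refine norm_integral_le_of_norm_le (hi1.const_mul _) (Eventually.of_forall fun φ => ?_)
          refine (norm_pow_sub_pow_le (hue φ) ?_ n).trans ?_
          · rw [Complex.norm_real, Real.norm_of_nonneg (Real.exp_pos _).le]
            exact hge φ
          · have := hdiff φ
            have := (env_pos hδ φ).le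
            calc _ ≤ n * ((6 * B + B ^ 2) * (‖φ‖ ^ 3 * (1 + ‖φ‖) ^ 1)) * env δ φ ^ (n - 1) := by
                  gcongr
              _ = _ := by ring
      _ ≤ (n * (6 * B + B ^ 2)) * (C₁ / R ^ (m + 3)) := by
          rw [integral_const_mul]
          gcongr
      _ = _ := by
          rw [← hR2, hK]
          field_simp
          ring
  have hgauss : c₀ / R ^ m ≤ (∫ φ, (Real.exp (-(V φ / 2)) : ℂ) ^ n).re := by
    have e1 : ∫ φ, (Real.exp (-(V φ / 2)) : ℂ) ^ n =
        ((∫ φ, Real.exp (-(V φ / 2)) ^ n : ℝ) : ℂ) := by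
      rw [← integral_complex_ofReal]
      simp
    rw [e1, Complex.ofReal_re]
    have e2 := GaussianFourier.integral_rexp_neg_mul_sq_norm (V := Vec m)
      (b := n * B / 2) (by positivity)
    have e3 : (Real.pi / (n * B / 2)) ^ (Module.finrank ℝ (Vec m) / 2 : ℝ) = c₀ / R ^ m := by
      rw [finrank_euclideanSpace, Fintype.card_fin, hc₀, ← div_pow, hR, ← Real.sqrt_div' _ hnpos.le,
        Real.sqrt_eq_rpow, ← Real.rpow_natCast, ← Real.rpow_mul (by have := Real.pi_pos; positivity)]
      congr 1
      · field_simp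
      · ring
    rw [← e3, ← e2]
    refine integral_mono_of_nonneg (Eventually.of_forall fun φ => (Real.exp_pos _).le) ?_
      (Eventually.of_forall fun φ => ?_)
    · have := hgi.re
      refine this.congr (Eventually.of_forall fun φ => ?_)
      beta_reduce
      rw [← Complex.ofReal_pow]
      exact Complex.ofReal_re _
    · simp only
      rw [← Real.exp_nat_mul]
      apply Real.exp_le_exp.2
      have := hVle φ
      nlinarith
  -- The threshold n₃ was chosen so that the error eats at most half of the Gaussian main term.
  have hsmall : K / R ≤ c₀ / 2 := by
    rw [div_le_iff₀ hRpos]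
    have h1 : 2 * K / c₀ ≤ R := by
      apply Real.le_sqrt_of_sq_le
      have : (n₃ : ℝ) ≤ n := by exact_mod_cast (by omega : n₃ ≤ n)
      linarith
    rw [div_le_iff₀ hc₀pos] at h1
    linarith
  have h5 := (Complex.abs_re_le_norm _).trans herr
  rw [Complex.sub_re] at h5
  have h6 := (abs_le.1 h5).1
  have h7 : K / R / R ^ m ≤ c₀ / 2 / R ^ m := by gcongr
  have h8 : c₀ / R ^ m = c₀ / 2 / R ^ m + c₀ / 2 / R ^ m := by ring
  linarith

end LowerBound

/-- The bound for differences of powers, applied to a and its conjugate. -/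
theorem abs_im_pow_le {a : ℂ} {r : ℝ} (ha : ‖a‖ ≤ r) (k : ℕ) :
    |(a ^ k).im| ≤ k * |a.im| * r ^ (k - 1) := by
  have h := norm_pow_sub_pow_le ha (b := starRingEnd ℂ a) (by simpa using ha) k
  have e : ∀ z : ℂ, ‖z - starRingEnd ℂ z‖ = 2 * |z.im| := by
    intro z
    rw [Complex.sub_conj]
    simp
  rw [← map_pow, e, e] at h
  linarith

/-! ### Second-order expansion of the Fourier integral -/

section Laplace

variable {m : ℕ} {π : Measure (Vec m)} {y : Vec m} {B δ : ℝ}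

theorem stronglyMeasurable_integral_mul_cexp [SFinite π] {f : Vec m → Vec m → ℝ}
    (hf : Continuous fun q : Vec m × Vec m => f q.1 q.2) (z : Vec m) :
    StronglyMeasurable fun φ : Vec m =>
      ∫ x, (f φ x : ℂ) * Complex.exp ((inner ℝ (x - z) φ : ℝ) * Complex.I) ∂π :=
  StronglyMeasurable.integral_prod_right
    (f := fun φ x => (f φ x : ℂ) * Complex.exp ((inner ℝ (x - z) φ : ℝ) * Complex.I))
    (Continuous.stronglyMeasurable (by
      have := Complex.continuous_ofReal.comp hf
      exact Continuous.mul this (by fun_prop)))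

theorem norm_integral_inner_mul_cexp_le
    (hw : Integrable (fun x : Vec m => (1 + ‖y‖ + ‖x‖) ^ 5) π)
    (hwB : ∫ x, (1 + ‖y‖ + ‖x‖) ^ 5 ∂π ≤ B) (w φ : Vec m) :
    ‖∫ x, ((inner ℝ (x - y) w : ℝ) : ℂ) *
        Complex.exp ((inner ℝ (x - y) φ : ℝ) * Complex.I) ∂π‖ ≤ 3 * B * ‖w‖ := by
  have h := norm_integral_mul_cexp_sub_le (π := π) (w := fun x : Vec m => 1 + ‖y‖ + ‖x‖)
    (f := fun x => inner ℝ (x - y) w) (g := fun x => inner ℝ (x - y) φ) (A := ‖w‖) (t := ‖φ‖) 0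
    (by norm_num) one_le_weight hw (Continuous.aestronglyMeasurable (by fun_prop))
    (Continuous.aestronglyMeasurable (by fun_prop))
    (fun x => abs_inner_sub_le x w) (fun x => abs_inner_sub_le x φ)
  simp only [Finset.range_zero, Finset.sum_empty, sub_zero, Nat.cast_zero, zero_add, pow_zero,
    mul_one] at h
  refine h.trans ?_
  have := norm_nonneg w
  nlinarith

/-- The fourth-order Taylor remainder of the integrand, up to an odd cubic term. -/
theorem exists_odd_remainder [IsProbabilityMeasure π] (G : ℕ)
    (hw : Integrable (fun x : Vec m => (1 + ‖y‖ + ‖x‖) ^ 5) π)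
    (hwB : ∫ x, (1 + ‖y‖ + ‖x‖) ^ 5 ∂π ≤ B) (hmean : ∀ w, ∫ x, inner ℝ (x - y) w ∂π = 0)
    {β : Vec m} {L : Vec m →L[ℝ] Vec m} {ν₀ : ℝ} {N : Vec m → ℂ} {b D c₃ : Vec m → ℝ}
    (hβ : ‖β‖ ≤ B) (hL : ‖L‖ ≤ B) (hν₀ : |ν₀| ≤ B)
    (hN : ∀ φ, ‖N φ - (ν₀ + Complex.I * b φ - (D φ : ℂ) / 2 - Complex.I * c₃ φ)‖ ≤
      B * ‖φ‖ ^ 4 * (1 + ‖φ‖) ^ G)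
    (hc₃c : Continuous c₃) (hc₃o : ∀ φ, c₃ (-φ) = -c₃ φ) (hc₃ : ∀ φ, |c₃ φ| ≤ B * ‖φ‖ ^ 3)
    (hb : ∀ φ, b φ = ν₀ * ∫ x, inner ℝ x φ ∂π + ∫ x, inner ℝ (x - y) β * inner ℝ x φ ∂π)
    (hD : ∀ φ, D φ = ν₀ * ∫ x, inner ℝ x φ ^ 2 ∂π + ∫ x, inner ℝ (x - y) β * inner ℝ x φ ^ 2 ∂π
      - 2 * ∫ x, inner ℝ (x - y) (L φ) * inner ℝ x φ ∂π) :
    ∃ o : Vec m → ℝ, StronglyMeasurable o ∧ (∀ φ, o (-φ) = -o φ) ∧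
      (∀ φ, |o φ| ≤ 21 * B ^ 2 * ‖φ‖ ^ 3) ∧
      ∀ φ, ‖N φ - ν₀ * (∫ x, Complex.exp ((inner ℝ x φ : ℝ) * Complex.I) ∂π) -
        (∫ x, ((inner ℝ (x - y) β : ℝ) : ℂ) *
          Complex.exp ((inner ℝ x φ : ℝ) * Complex.I) ∂π) +
        Complex.I * (∫ x, ((inner ℝ (x - y) (L φ) : ℝ) : ℂ) *
          Complex.exp ((inner ℝ x φ : ℝ) * Complex.I) ∂π) - Complex.I * o φ‖ ≤
        21 * B ^ 2 * (‖φ‖ ^ 4 * (1 + ‖φ‖) ^ G) := by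
  have hB := one_le_of_weight hw hwB
  have hLφ : ∀ φ, ‖L φ‖ ≤ B * ‖φ‖ := fun φ =>
    (L.le_opNorm φ).trans (mul_le_mul_of_nonneg_right hL (norm_nonneg _))
  have hmom : ∀ (f : Vec m → ℝ) (A : ℝ) (j : ℕ) (φ : Vec m), j ≤ 4 → Continuous f →
      (∀ x, |f x| ≤ A * (1 + ‖y‖ + ‖x‖)) → |∫ x, f x * inner ℝ x φ ^ j ∂π| ≤
        A * ‖φ‖ ^ j * B := by
    intro f A j φ hj hf hfA
    obtain ⟨-, hi, hle⟩ := integrable_mul_pow_of_le (π := π) (w := fun x : Vec m => 1 + ‖y‖ + ‖x‖)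
      (f := f) (g := fun x => inner ℝ x φ) (A := A) (t := ‖φ‖) j hj
      one_le_weight hw hf.aestronglyMeasurable (Continuous.aestronglyMeasurable (by fun_prop))
      hfA (fun x => abs_inner_le x φ)
    have hA : 0 ≤ A := by
      have := (abs_nonneg _).trans (hfA 0)
      have := one_le_weight (y := y) (0 : Vec m)
      nlinarith
    calc _ ≤ ∫ x, |f x| * |inner ℝ x φ| ^ j ∂π := by
          rw [← Real.norm_eq_abs]
          refine norm_integral_le_of_norm_le hi (Eventually.of_forall fun x => ?_)
          simp
      _ ≤ _ := hle.trans (by gcongr)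
  have hexp : ∀ (f : Vec m → ℝ) (A : ℝ) (j : ℕ) (φ : Vec m), j ≤ 4 → Continuous f →
      (∀ x, |f x| ≤ A * (1 + ‖y‖ + ‖x‖)) →
      ‖(∫ x, (f x : ℂ) * Complex.exp ((inner ℝ x φ : ℝ) * Complex.I) ∂π) -
      ∑ k ∈ Finset.range j, Complex.I ^ k / (k.factorial : ℂ) *
        ((∫ x, f x * inner ℝ x φ ^ k ∂π : ℝ) : ℂ)‖ ≤ (j + 3) * (A * ‖φ‖ ^ j * B) := by
    intro f A j φ hj hf hfA
    have hA : 0 ≤ A := by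
      have := (abs_nonneg _).trans (hfA 0)
      have := one_le_weight (y := y) (0 : Vec m)
      nlinarith
    refine (norm_integral_mul_cexp_sub_le (π := π) (w := fun x : Vec m => 1 + ‖y‖ + ‖x‖)
      (f := f) (g := fun x => inner ℝ x φ) (A := A) (t := ‖φ‖) j hj
      one_le_weight hw hf.aestronglyMeasurable (Continuous.aestronglyMeasurable (by fun_prop))
      hfA (fun x => abs_inner_le x φ)).trans ?_
    gcongr
  have hf1 : ∀ x : Vec m, |(1 : ℝ)| ≤ 1 * (1 + ‖y‖ + ‖x‖) := fun x => by
    simpa using one_le_weight x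
  -- The coefficient of i in the cubic terms: -c₃ from N, the third-order terms of the transforms
  -- with weights 1 and (x - y)·β, and only the second-order term of the transform with weight (x -
  -- y)·Lφ, since Lφ already carries one power of φ.
  refine ⟨fun φ => -c₃ φ + ν₀ / 6 * ∫ x, 1 * inner ℝ x φ ^ 3 ∂π +
    1 / 6 * ∫ x, inner ℝ (x - y) β * inner ℝ x φ ^ 3 ∂π -
    1 / 2 * ∫ x, inner ℝ (x - y) (L φ) * inner ℝ x φ ^ 2 ∂π, ?_, ?_, ?_, ?_⟩
  · have h1 : StronglyMeasurable fun φ : Vec m => ∫ x, 1 * inner ℝ x φ ^ 3 ∂π :=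
      StronglyMeasurable.integral_prod_right (f := fun φ x => 1 * inner ℝ x φ ^ 3)
        (Continuous.stronglyMeasurable (by fun_prop))
    have h2 : StronglyMeasurable fun φ : Vec m => ∫ x, inner ℝ (x - y) β * inner ℝ x φ ^ 3 ∂π :=
      StronglyMeasurable.integral_prod_right
        (f := fun φ x => inner ℝ (x - y) β * inner ℝ x φ ^ 3)
        (Continuous.stronglyMeasurable (by fun_prop))
    have h3 : StronglyMeasurable fun φ : Vec m =>
        ∫ x, inner ℝ (x - y) (L φ) * inner ℝ x φ ^ 2 ∂π :=
      StronglyMeasurable.integral_prod_right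
        (f := fun φ x => inner ℝ (x - y) (L φ) * inner ℝ x φ ^ 2)
        (Continuous.stronglyMeasurable (by fun_prop))
    exact ((hc₃c.stronglyMeasurable.neg.add (h1.const_mul _)).add (h2.const_mul _)).sub
      (h3.const_mul _)
  · intro φ
    simp only [hc₃o, inner_neg_right, map_neg, Odd.neg_pow (by decide : Odd 3), even_two.neg_pow,
      mul_neg, neg_mul, integral_neg]
    ring
  · intro φ
    have h1 := hmom (fun _ => 1) 1 3 φ (by norm_num) continuous_const hf1
    have h2 := hmom (fun x => inner ℝ (x - y) β) ‖β‖ 3 φ (by norm_num) (by fun_prop)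
      (fun x => abs_inner_sub_le x β)
    have h3 := hmom (fun x => inner ℝ (x - y) (L φ)) ‖L φ‖ 2 φ (by norm_num) (by fun_prop)
      (fun x => abs_inner_sub_le x _)
    have hp : 0 ≤ ‖φ‖ ^ 3 := by positivity
    have h2' : ‖β‖ * ‖φ‖ ^ 3 * B ≤ B * ‖φ‖ ^ 3 * B := by gcongr
    have h3' : ‖L φ‖ * ‖φ‖ ^ 2 * B ≤ (B * ‖φ‖) * ‖φ‖ ^ 2 * B := by gcongr; exact hLφ φ
    have h1' : |ν₀ / 6 * ∫ x, 1 * inner ℝ x φ ^ 3 ∂π| ≤ B / 6 * (1 * ‖φ‖ ^ 3 * B) := by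
      rw [abs_mul, abs_div, abs_of_pos (by norm_num : (0 : ℝ) < 6)]
      gcongr
    have hB2 : B * ‖φ‖ ^ 3 ≤ B ^ 2 * ‖φ‖ ^ 3 := by
      gcongr
      nlinarith
    have hB3 : 0 ≤ B ^ 2 * ‖φ‖ ^ 3 := by positivity
    have h4 := hc₃ φ
    rw [abs_le] at h1' h2 h3 h4 ⊢
    constructor <;> nlinarith
  · intro φ
    have h1 := hexp (fun _ => 1) 1 4 φ (by norm_num) continuous_const hf1
    have h2 := hexp (fun x => inner ℝ (x - y) β) ‖β‖ 4 φ (by norm_num) (by fun_prop)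
      (fun x => abs_inner_sub_le x β)
    have h3 := hexp (fun x => inner ℝ (x - y) (L φ)) ‖L φ‖ 3 φ (by norm_num) (by fun_prop)
      (fun x => abs_inner_sub_le x _)
    have h0 := hN φ
    simp only [Complex.ofReal_one, one_mul] at h1
    set W₁ := ∫ x, Complex.exp ((inner ℝ x φ : ℝ) * Complex.I) ∂π
    set Wβ := ∫ x, ((inner ℝ (x - y) β : ℝ) : ℂ) *
          Complex.exp ((inner ℝ x φ : ℝ) * Complex.I) ∂π
    set WL := ∫ x, ((inner ℝ (x - y) (L φ) : ℝ) : ℂ) *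
          Complex.exp ((inner ℝ x φ : ℝ) * Complex.I) ∂π
    set S₁ := ∑ k ∈ Finset.range 4, Complex.I ^ k / (k.factorial : ℂ) *
        ((∫ x, inner ℝ x φ ^ k ∂π : ℝ) : ℂ) with hS₁
    set Sβ := ∑ k ∈ Finset.range 4, Complex.I ^ k / (k.factorial : ℂ) *
        ((∫ x, inner ℝ (x - y) β * inner ℝ x φ ^ k ∂π : ℝ) : ℂ) with hSβ
    set SL := ∑ k ∈ Finset.range 3, Complex.I ^ k / (k.factorial : ℂ) *
        ((∫ x, inner ℝ (x - y) (L φ) * inner ℝ x φ ^ k ∂π : ℝ) : ℂ) with hSL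
    set P : ℂ := ν₀ + Complex.I * b φ - (D φ : ℂ) / 2 - Complex.I * c₃ φ with hP
    have hsum : ∀ o : ℂ, N φ - ν₀ * W₁ - Wβ + Complex.I * WL - Complex.I * o =
        (N φ - P) - ν₀ * (W₁ - S₁) - (Wβ - Sβ) + Complex.I * (WL - SL) +
          (P - ν₀ * S₁ - Sβ + Complex.I * SL - Complex.I * o) := by
      intro o; ring
    rw [hsum]
    -- Orders 0 to 2 cancel by `hmean`, `hb` and `hD`; what survives at order 3 is exactly i times
    -- the odd function chosen above.
    have hzero : P - ν₀ * S₁ - Sβ + Complex.I * SL - Complex.I *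
        ((-c₃ φ + ν₀ / 6 * ∫ x, 1 * inner ℝ x φ ^ 3 ∂π +
        1 / 6 * ∫ x, inner ℝ (x - y) β * inner ℝ x φ ^ 3 ∂π -
        1 / 2 * ∫ x, inner ℝ (x - y) (L φ) * inner ℝ x φ ^ 2 ∂π : ℝ) : ℂ) = 0 := by
      have hI3 : Complex.I ^ 3 = -Complex.I := by
        rw [pow_succ, Complex.I_sq]; ring
      rw [hP, hb, hD, hS₁, hSβ, hSL]
      simp only [Finset.sum_range_succ, Finset.range_zero, Finset.sum_empty, pow_zero, pow_one,
        mul_one, one_mul, hmean, integral_const, probReal_univ, smul_eq_mul, hI3, Complex.I_sq]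
      push_cast
      simp only [Nat.factorial]
      push_cast
      linear_combination ((∫ x, inner ℝ (x - y) (L φ) * inner ℝ x φ ∂π : ℝ) : ℂ) * Complex.I_sq
    rw [hzero, add_zero]
    have hp : 0 ≤ ‖φ‖ ^ 4 := by positivity
    have hG : 1 ≤ (1 + ‖φ‖) ^ G := one_le_pow₀ (by have := norm_nonneg φ; linarith)
    have hpG : ‖φ‖ ^ 4 ≤ ‖φ‖ ^ 4 * (1 + ‖φ‖) ^ G := le_mul_of_one_le_right hp hG
    have t1 : ‖(ν₀ : ℂ) * (W₁ - S₁)‖ ≤ 7 * (B ^ 2 * ‖φ‖ ^ 4) := by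
      rw [norm_mul, Complex.norm_real, Real.norm_eq_abs]
      calc _ ≤ B * (((4 : ℕ) + 3) * (‖φ‖ ^ 4 * B)) := by gcongr
        _ = _ := by push_cast; ring
    have t2 : ‖Wβ - Sβ‖ ≤ 7 * (B ^ 2 * ‖φ‖ ^ 4) := by
      calc _ ≤ ((4 : ℕ) + 3) * (‖β‖ * ‖φ‖ ^ 4 * B) := h2
        _ ≤ ((4 : ℕ) + 3) * (B * ‖φ‖ ^ 4 * B) := by gcongr
        _ = _ := by push_cast; ring
    have t3 : ‖Complex.I * (WL - SL)‖ ≤ 6 * (B ^ 2 * ‖φ‖ ^ 4) := by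
      rw [norm_mul, Complex.norm_I, one_mul]
      calc _ ≤ ((3 : ℕ) + 3) * (‖L φ‖ * ‖φ‖ ^ 3 * B) := h3
        _ ≤ ((3 : ℕ) + 3) * ((B * ‖φ‖) * ‖φ‖ ^ 3 * B) := by gcongr; exact hLφ φ
        _ = _ := by push_cast; ring
    have t4 := norm_add_le ((N φ - P) - ν₀ * (W₁ - S₁) - (Wβ - Sβ)) (Complex.I * (WL - SL))
    have t5 := norm_sub_le ((N φ - P) - ν₀ * (W₁ - S₁)) (Wβ - Sβ)
    have t6 := norm_sub_le (N φ - P) (ν₀ * (W₁ - S₁))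
    have t7 : B * ‖φ‖ ^ 4 * (1 + ‖φ‖) ^ G ≤ B ^ 2 * (‖φ‖ ^ 4 * (1 + ‖φ‖) ^ G) := by
      rw [mul_assoc]
      gcongr
      nlinarith
    have t8 : B ^ 2 * ‖φ‖ ^ 4 ≤ B ^ 2 * (‖φ‖ ^ 4 * (1 + ‖φ‖) ^ G) := by gcongr
    linarith

end Laplace

section Laplace

/-- Second-order Laplace expansion of `∫ N v u^{n-1}` relative to `∫ u^n`, where `u` is the
characteristic function of the centred variable and `v φ = exp (-iφy)`. The constants depend on
the law only through `δ`, `B`. -/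
theorem exists_norm_integral_sub_le (m G : ℕ) (δ B : ℝ) (hδ : 0 < δ) :
    ∃ (n₀ : ℕ) (C : ℝ), 1 ≤ n₀ ∧ 0 ≤ C ∧ ∀ (π : Measure (Vec m)) [IsProbabilityMeasure π]
      (y β : Vec m) (L : Vec m →L[ℝ] Vec m) (ν₀ : ℝ) (N : Vec m → ℂ) (b D c₃ : Vec m → ℝ),
      Integrable (fun x : Vec m => (1 + ‖y‖ + ‖x‖) ^ 5) π →
      ∫ x, (1 + ‖y‖ + ‖x‖) ^ 5 ∂π ≤ B → (∀ w, ∫ x, inner ℝ (x - y) w ∂π = 0) →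
      (∀ φ : Vec m, ‖∫ x, Complex.exp ((inner ℝ x φ : ℝ) * Complex.I) ∂π‖ ≤ env δ φ) →
      ‖β‖ ≤ B → ‖L‖ ≤ B → |ν₀| ≤ B → ‖y‖ ≤ B → Continuous N →
      (∀ φ, ‖N φ - (ν₀ + Complex.I * b φ - (D φ : ℂ) / 2 - Complex.I * c₃ φ)‖ ≤
        B * ‖φ‖ ^ 4 * (1 + ‖φ‖) ^ G) →
      Continuous c₃ → (∀ φ, c₃ (-φ) = -c₃ φ) → (∀ φ, |c₃ φ| ≤ B * ‖φ‖ ^ 3) →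
      (∀ φ, b φ = ν₀ * ∫ x, inner ℝ x φ ∂π + ∫ x, inner ℝ (x - y) β * inner ℝ x φ ∂π) →
      (∀ φ, D φ = ν₀ * ∫ x, inner ℝ x φ ^ 2 ∂π +
        ∫ x, inner ℝ (x - y) β * inner ℝ x φ ^ 2 ∂π -
        2 * ∫ x, inner ℝ (x - y) (L φ) * inner ℝ x φ ∂π) →
      ∀ n ≥ n₀,
        ‖(∫ φ, N φ * Complex.exp (-((inner ℝ y φ : ℝ) * Complex.I)) *
          centeredChar π y φ ^ (n - 1)) -
          (ν₀ + ((∑ j, L (basisVec j) j : ℝ) : ℂ) / n) * ∫ φ, centeredChar π y φ ^ n‖ ≤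
        C / Real.sqrt n ^ (m + 4) := by
  -- The moments needed: orders 0, 1 and 3 only for integrability, order 4 with growth G for the
  -- Taylor remainder, and orders 4 and 6 for the odd term, where the sixth moment goes with the (n
  -- - 2)-nd power.
  obtain ⟨n₁, C₁, hn₁, hC₁, h₁⟩ := env_moment_sub (m := m) δ hδ 0 0
  obtain ⟨n₂, C₂, hn₂, hC₂, h₂⟩ := env_moment_sub (m := m) δ hδ 1 0
  obtain ⟨n₃, C₃, hn₃, hC₃, h₃⟩ := env_moment_sub (m := m) δ hδ 4 G
  obtain ⟨n₄, C₄, hn₄, hC₄, h₄⟩ := env_moment_sub (m := m) δ hδ 4 0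
  obtain ⟨n₅, C₅, hn₅, hC₅, h₅⟩ := env_moment_sub (m := m) δ hδ 6 0
  obtain ⟨n₆, C₆, hn₆, hC₆, h₆⟩ := env_moment_sub (m := m) δ hδ 3 0
  rcases lt_or_ge B 1 with hB | hB
  · exact ⟨1, 0, le_rfl, le_rfl, fun π _ y β L ν₀ N b D c₃ hw hwB =>
      absurd (one_le_of_weight hw hwB) (not_le.2 hB)⟩
  set K := 21 * B ^ 2 with hK
  have hK0 : 0 ≤ K := by positivity
  refine ⟨n₁ + n₂ + n₃ + n₄ + n₅ + n₆, K * C₃ + K * B * C₄ + 6 * B * K * C₅, by omega,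
    by positivity, ?_⟩
  intro π _ y β L ν₀ N b D c₃ hw hwB hmean hdec hβ hL hν₀ hy hNc hN hc₃c hc₃o hc₃ hb hD n hn
  obtain ⟨o, hom, hoo, hoK, hrem⟩ := exists_odd_remainder G hw hwB hmean hβ hL hν₀ hN hc₃c hc₃o
    hc₃ hb hD
  have hn1 : n ≠ 0 := by omega
  have hnpos : (0 : ℝ) < n := by exact_mod_cast Nat.pos_of_ne_zero hn1
  set u := centeredChar π y with hu
  have huc : Continuous u := continuous_centeredChar
  have hue : ∀ φ, ‖u φ‖ ≤ env δ φ := norm_centeredChar_le hdec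
  have huek : ∀ φ k, ‖u φ ^ k‖ ≤ env δ φ ^ k := fun φ k => by
    rw [norm_pow]; exact pow_le_pow_left₀ (norm_nonneg _) (hue φ) k
  have he0 : ∀ φ : Vec m, 0 ≤ env δ φ := fun φ => (env_pos hδ φ).le
  set v : Vec m → ℂ := fun φ => Complex.exp (-((inner ℝ y φ : ℝ) * Complex.I)) with hv
  have hvc : Continuous v := by fun_prop
  have hvn : ∀ φ, ‖v φ‖ = 1 := fun φ => by
    simp only [hv]
    rw [← neg_mul, ← Complex.ofReal_neg, Complex.norm_exp_ofReal_mul_I]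
  have hLφ : ∀ φ, ‖L φ‖ ≤ B * ‖φ‖ := fun φ =>
    (L.le_opNorm φ).trans (mul_le_mul_of_nonneg_right hL (norm_nonneg _))
  set T : Vec m → Vec m → ℂ := fun w φ => ∫ x, ((inner ℝ (x - y) w : ℝ) : ℂ) *
    Complex.exp ((inner ℝ (x - y) φ : ℝ) * Complex.I) ∂π with hT
  have hTn : ∀ w φ, ‖T w φ‖ ≤ 3 * B * ‖w‖ := norm_integral_inner_mul_cexp_le hw hwB
  have hTc : ∀ w, Continuous (T w) := fun w => continuous_integral_mul_cexp
    (integrable_inner_sub hw w)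
  have hTL : StronglyMeasurable fun φ => T (L φ) φ :=
    stronglyMeasurable_integral_mul_cexp (f := fun φ x => inner ℝ (x - y) (L φ)) (by fun_prop) y
  have hvT : ∀ w φ, v φ * (∫ x, ((inner ℝ (x - y) w : ℝ) : ℂ) *
          Complex.exp ((inner ℝ x φ : ℝ) * Complex.I) ∂π) = T w φ := by
    intro w φ
    simp only [hv, hT]
    rw [← integral_const_mul]
    refine integral_congr_ae (Eventually.of_forall fun x => ?_)
    simp only
    rw [mul_left_comm, ← Complex.exp_add, inner_sub_left x y φ]
    congr 2
    push_cast
    ring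
  -- integrability
  obtain ⟨i00, -⟩ := h₁ n (by omega) 0 (by norm_num)
  obtain ⟨i01, -⟩ := h₁ n (by omega) 1 (by norm_num)
  obtain ⟨i10, -⟩ := h₂ n (by omega) 0 (by norm_num)
  obtain ⟨i11, -⟩ := h₂ n (by omega) 1 (by norm_num)
  obtain ⟨i4G, b4G⟩ := h₃ n (by omega) 1 (by norm_num)
  obtain ⟨i4, b4⟩ := h₄ n (by omega) 1 (by norm_num)
  obtain ⟨i6, b6⟩ := h₅ n (by omega) 2 (by norm_num)
  obtain ⟨i3, -⟩ := h₆ n (by omega) 1 (by norm_num)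
  simp only [pow_zero, one_mul, mul_one, Nat.sub_zero, pow_one] at i00 i01 i10 i11 i4 b4 i6 b6 i3
  have hIu : Integrable fun φ => u φ ^ n :=
    i00.mono' (huc.pow n).aestronglyMeasurable (Eventually.of_forall fun φ => huek φ n)
  have hIT : ∀ w, Integrable fun φ => u φ ^ (n - 1) * T w φ := fun w => by
    refine (i01.const_mul (3 * B * ‖w‖)).mono' ((huc.pow _).mul (hTc w)).aestronglyMeasurable
      (Eventually.of_forall fun φ => ?_)
    rw [norm_mul, mul_comm]
    exact mul_le_mul (hTn w φ) (huek φ _) (norm_nonneg _) (by positivity)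
  have hLj : ∀ j φ, ‖((L φ j : ℝ) : ℂ)‖ ≤ B * ‖φ‖ := fun j φ => by
    rw [Complex.norm_real]
    exact (PiLp.norm_apply_le (L φ) j).trans (hLφ φ)
  have hLjc : ∀ j, Continuous fun φ => ((L φ j : ℝ) : ℂ) := fun j => by fun_prop
  have hIL : ∀ j, Integrable fun φ => ((L φ j : ℝ) : ℂ) * u φ ^ n := fun j => by
    refine (i10.const_mul B).mono' ((hLjc j).mul (huc.pow _)).aestronglyMeasurable
      (Eventually.of_forall fun φ => ?_)
    rw [norm_mul, ← mul_assoc]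
    exact mul_le_mul (hLj j φ) (huek φ _) (norm_nonneg _) (by positivity)
  have hILT : ∀ j, Integrable fun φ => ((L φ j : ℝ) : ℂ) *
      (u φ ^ (n - 1) * T (basisVec j) φ) := fun j => by
    refine (i11.const_mul (B * (3 * B))).mono'
      ((hLjc j).mul ((huc.pow _).mul (hTc _))).aestronglyMeasurable
      (Eventually.of_forall fun φ => ?_)
    rw [norm_mul, norm_mul]
    have e1 : ‖T (basisVec j) φ‖ ≤ 3 * B := by simpa using hTn (basisVec j) φ
    have := he0 φ
    calc _ ≤ (B * ‖φ‖) * (env δ φ ^ (n - 1) * (3 * B)) := by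
          gcongr
          · exact hLj j φ
          · exact huek φ _
      _ = _ := by ring
  have hITL : Integrable fun φ => u φ ^ (n - 1) * T (L φ) φ := by
    refine (i11.const_mul (3 * B * B)).mono'
      ((huc.pow _).aestronglyMeasurable.mul hTL.aestronglyMeasurable)
      (Eventually.of_forall fun φ => ?_)
    rw [norm_mul]
    have := he0 φ
    calc _ ≤ env δ φ ^ (n - 1) * (3 * B * (B * ‖φ‖)) := by
          gcongr
          · exact huek φ _
          · exact (hTn _ φ).trans (by gcongr; exact hLφ φ)
      _ = _ := by ring
  have hIo : Integrable fun φ => (o φ : ℂ) * (v φ * u φ ^ (n - 1)) := by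
    refine (i3.const_mul K).mono'
      ((Complex.continuous_ofReal.comp_stronglyMeasurable hom).aestronglyMeasurable.mul
        (hvc.mul (huc.pow _)).aestronglyMeasurable) (Eventually.of_forall fun φ => ?_)
    rw [norm_mul, norm_mul, hvn, one_mul, Complex.norm_real, ← mul_assoc]
    exact mul_le_mul (hoK φ) (huek φ _) (norm_nonneg _) (by positivity)
  -- the remainder
  set r : Vec m → ℂ := fun φ =>
    (N φ * v φ * u φ ^ (n - 1) - ν₀ * u φ ^ n - u φ ^ (n - 1) * T β φ) +
      Complex.I * (u φ ^ (n - 1) * T (L φ) φ) -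
      Complex.I * ((o φ : ℂ) * (v φ * u φ ^ (n - 1))) with hr
  have hrle : ∀ φ, ‖r φ‖ ≤ K * (‖φ‖ ^ 4 * (1 + ‖φ‖) ^ G * env δ φ ^ (n - 1)) := by
    intro φ
    have e : r φ = (N φ - ν₀ * (∫ x, Complex.exp ((inner ℝ x φ : ℝ) * Complex.I) ∂π) -
        (∫ x, ((inner ℝ (x - y) β : ℝ) : ℂ) *
          Complex.exp ((inner ℝ x φ : ℝ) * Complex.I) ∂π) +
        Complex.I * (∫ x, ((inner ℝ (x - y) (L φ) : ℝ) : ℂ) *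
          Complex.exp ((inner ℝ x φ : ℝ) * Complex.I) ∂π) - Complex.I * o φ) *
          (v φ * u φ ^ (n - 1)) := by
      have e1 : u φ ^ n = u φ ^ (n - 1) * (v φ *
          ∫ x, Complex.exp ((inner ℝ x φ : ℝ) * Complex.I) ∂π) := by
        rw [← centeredChar_eq, ← hu, ← pow_succ, Nat.sub_add_cancel (by omega)]
      simp only [hr]
      rw [e1, ← hvT, ← hvT]
      ring
    rw [e, norm_mul, norm_mul, hvn, one_mul]
    calc _ ≤ K * (‖φ‖ ^ 4 * (1 + ‖φ‖) ^ G) * env δ φ ^ (n - 1) :=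
          mul_le_mul (hrem φ) (huek φ _) (norm_nonneg _) (by positivity)
      _ = _ := by ring
  have hIr : Integrable r := by
    refine (i4G.const_mul K).mono' ?_ (Eventually.of_forall hrle)
    refine (((Continuous.aestronglyMeasurable (by fun_prop)).sub
      (hIT β).1).add (hITL.1.const_mul _)).sub (hIo.1.const_mul _)
  -- split the integral
  have hsplit : (∫ φ, N φ * v φ * u φ ^ (n - 1)) =
      ν₀ * (∫ φ, u φ ^ n) + (∫ φ, u φ ^ (n - 1) * T β φ) -
        Complex.I * (∫ φ, u φ ^ (n - 1) * T (L φ) φ) +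
        Complex.I * (∫ φ, (o φ : ℂ) * (v φ * u φ ^ (n - 1))) + ∫ φ, r φ := by
    have j1 : Integrable fun φ => ν₀ * u φ ^ n + u φ ^ (n - 1) * T β φ :=
      (hIu.const_mul _).add (hIT β)
    have j2 : Integrable fun φ => ν₀ * u φ ^ n + u φ ^ (n - 1) * T β φ -
        Complex.I * (u φ ^ (n - 1) * T (L φ) φ) := j1.sub (hITL.const_mul _)
    have j3 : Integrable fun φ => ν₀ * u φ ^ n + u φ ^ (n - 1) * T β φ -
        Complex.I * (u φ ^ (n - 1) * T (L φ) φ) +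
        Complex.I * ((o φ : ℂ) * (v φ * u φ ^ (n - 1))) := j2.add (hIo.const_mul _)
    rw [← integral_const_mul, ← integral_const_mul, ← integral_const_mul,
      ← integral_add (hIu.const_mul _) (hIT β), ← integral_sub j1 (hITL.const_mul _),
      ← integral_add j2 (hIo.const_mul _), ← integral_add j3 hIr]
    refine integral_congr_ae (Eventually.of_forall fun φ => ?_)
    simp only [hr]
    ring
  have hβ0 : (∫ φ, u φ ^ (n - 1) * T β φ) = 0 :=
    integral_inner_const_mul_pow_eq_zero hw β n hn1 hIu (hIT β)
  have hLtr := integral_inner_linear_mul_pow hw L n hIu hIL hILT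
  change n * Complex.I * (∫ φ, u φ ^ (n - 1) * T (L φ) φ) = _ at hLtr
  -- This is the source of the 1/n correction in the expansion: the linear field contributes its
  -- trace.
  have hLtr' : Complex.I * (∫ φ, u φ ^ (n - 1) * T (L φ) φ) =
      -(((∑ j, L (basisVec j) j : ℝ) : ℂ) / n) * ∫ φ, u φ ^ n := by
    have hnc : (n : ℂ) ≠ 0 := by exact_mod_cast hn1
    rw [← mul_right_inj' hnc, ← mul_assoc, hLtr]
    field_simp
    rfl
  rw [hsplit, hβ0, hLtr']
  have hform : ∀ a t U O R : ℂ, a * U + 0 - -t * U + O + R - (a + t) * U = O + R := by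
    intros; ring
  rw [hform]
  -- the odd term
  have hodd : ‖∫ φ, (o φ : ℂ) * (v φ * u φ ^ (n - 1))‖ ≤
      K * B * (C₄ / Real.sqrt n ^ (m + 4)) + n * (6 * B * K) * (C₅ / Real.sqrt n ^ (m + 6)) := by
    rw [integral_odd_mul_hermitian hoo _ hIo]
    · calc _ ≤ ∫ φ, (K * B * (‖φ‖ ^ 4 * env δ φ ^ (n - 1)) +
            n * (6 * B * K) * (‖φ‖ ^ 6 * env δ φ ^ (n - 2))) := by
            refine norm_integral_le_of_norm_le ((i4.const_mul _).add (i6.const_mul _))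
              (Eventually.of_forall fun φ => ?_)
            rw [norm_mul, norm_mul, Complex.norm_I, mul_one, Complex.norm_real, Complex.norm_real,
              Real.norm_eq_abs, Real.norm_eq_abs]
            -- Im v is at most B|φ|. The mean is zero, so Im u is cubic, and taking the power
            -- multiplies it by at most n and costs one more envelope factor.
            have e1 : |(v φ * u φ ^ (n - 1)).im| ≤
                B * ‖φ‖ * env δ φ ^ (n - 1) + n * (6 * B * ‖φ‖ ^ 3) * env δ φ ^ (n - 2) := by
              rw [Complex.mul_im]
              have v1 : |(v φ).im| ≤ B * ‖φ‖ := by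
                simp only [hv]
                rw [← neg_mul, ← Complex.ofReal_neg, Complex.exp_ofReal_mul_I_im]
                calc _ ≤ |-inner ℝ y φ| := Real.abs_sin_le_abs
                  _ ≤ ‖y‖ * ‖φ‖ := by rw [abs_neg]; exact abs_real_inner_le_norm _ _
                  _ ≤ _ := by gcongr
              have v2 : |(v φ).re| ≤ 1 := (Complex.abs_re_le_norm _).trans (hvn φ).le
              have v3 := abs_im_pow_le (hue φ) (n - 1)
              have v4 : |(centeredChar π y φ).im| ≤ 6 * B * ‖φ‖ ^ 3 :=
                abs_im_centeredChar_le hw hwB hmean φ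
              have v5 : |(u φ ^ (n - 1)).re| ≤ env δ φ ^ (n - 1) :=
                (Complex.abs_re_le_norm _).trans (huek φ _)
              have v6 : ((n - 1 : ℕ) : ℝ) ≤ n := by exact_mod_cast Nat.sub_le n 1
              have := he0 φ
              calc _ ≤ |(v φ).re * (u φ ^ (n - 1)).im| + |(v φ).im * (u φ ^ (n - 1)).re| :=
                    abs_add_le _ _
                _ ≤ 1 * (n * (6 * B * ‖φ‖ ^ 3) * env δ φ ^ (n - 1 - 1)) +
                    B * ‖φ‖ * env δ φ ^ (n - 1) := by
                    rw [abs_mul, abs_mul]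
                    gcongr
                    exact v3.trans (by gcongr)
                _ = _ := by rw [Nat.sub_sub]; ring
            calc _ ≤ K * ‖φ‖ ^ 3 * (B * ‖φ‖ * env δ φ ^ (n - 1) +
                  n * (6 * B * ‖φ‖ ^ 3) * env δ φ ^ (n - 2)) :=
                  mul_le_mul (hoK φ) e1 (abs_nonneg _) (by positivity)
              _ = _ := by ring
        _ ≤ _ := by
            rw [integral_add (i4.const_mul _) (i6.const_mul _), integral_const_mul,
              integral_const_mul]
            gcongr
    · intro φ
      simp only [map_mul, map_pow]
      congr 1
      · simp [hv, ← Complex.exp_conj]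
      · rw [hu, centeredChar_neg]
  have hrint : ‖∫ φ, r φ‖ ≤ K * (C₃ / Real.sqrt n ^ (m + 4)) := by
    refine (norm_integral_le_of_norm_le (i4G.const_mul K) (Eventually.of_forall hrle)).trans ?_
    rw [integral_const_mul]
    gcongr
  have hR2 : Real.sqrt n ^ 2 = n := Real.sq_sqrt hnpos.le
  have hRpos : 0 < Real.sqrt n := Real.sqrt_pos.2 hnpos
  -- The factor n is paid for by the two extra powers in the sixth moment.
  have h6 : n * (6 * B * K) * (C₅ / Real.sqrt n ^ (m + 6)) =
      6 * B * K * C₅ / Real.sqrt n ^ (m + 4) := by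
    rw [show m + 6 = m + 4 + 2 by ring, pow_add _ (m + 4) 2, hR2]
    field_simp
  rw [h6] at hodd
  calc _ ≤ ‖Complex.I * ∫ φ, (o φ : ℂ) * (v φ * u φ ^ (n - 1))‖ + ‖∫ φ, r φ‖ := norm_add_le _ _
    _ ≤ (K * B * (C₄ / Real.sqrt n ^ (m + 4)) + 6 * B * K * C₅ / Real.sqrt n ^ (m + 4)) +
        K * (C₃ / Real.sqrt n ^ (m + 4)) := by
        rw [norm_mul, Complex.norm_I, one_mul]
        exact add_le_add hodd hrint
    _ = _ := by ring

end Laplace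

/-! ### Calculus -/

section Calculus

variable {ι V F : Type*} [NormedAddCommGroup V] [NormedSpace ℝ V]
  [NormedAddCommGroup F] [NormedSpace ℝ F]

theorem _root_.HasLineDerivAt.hasDerivAt_add_smul {f : V → F} {f' : F} {x v : V} {t : ℝ}
    (h : HasLineDerivAt ℝ f f' (x + t • v) v) : HasDerivAt (fun t : ℝ => f (x + t • v)) f' t := by
  have h1 : HasDerivAt (fun s : ℝ => f (x + t • v + s • v)) f' (t - t) := by
    rw [sub_self]; exact h
  have h2 := h1.comp_sub_const t t
  refine h2.congr_of_eventuallyEq (Eventually.of_forall fun s => ?_)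
  simp only [add_assoc, ← add_smul]
  congr 3
  ring

/-- A function with continuous partial derivatives is strictly differentiable. -/
theorem exists_hasStrictFDerivAt_of_hasLineDerivAt [Fintype ι] [FiniteDimensional ℝ V]
    (b : Module.Basis ι ℝ V) {f : V → F} {g : ι → V → F} {x₀ : V}
    (hd : ∀ i, ∀ᶠ x in 𝓝 x₀, HasLineDerivAt ℝ f (g i x) x (b i))
    (hc : ∀ i, ContinuousAt (g i) x₀) :
    ∃ L : V →L[ℝ] F, HasStrictFDerivAt f L x₀ ∧ ∀ i, L (b i) = g i x₀ := by
  classical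
  set M : ℝ := ∑ i, ‖b i‖ with hM
  have hM0 : 0 ≤ M := Finset.sum_nonneg fun i _ => norm_nonneg _
  -- Coordinates are moved one at a time, by induction on the set of moved coordinates. The base
  -- point x may be any point near x₀, and this is what yields strict differentiability.
  have key : ∀ S : Finset ι, ∀ ε > 0, ∃ r > 0, ∀ x, ‖x - x₀‖ < r → ∀ c : ι → ℝ,
      (∀ i, |c i| < r) → ‖f (x + ∑ i ∈ S, c i • b i) - f x - ∑ i ∈ S, c i • g i x₀‖ ≤
        ε * ∑ i ∈ S, |c i| := by
    intro S
    induction S using Finset.induction_on with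
    | empty => exact fun ε _ => ⟨1, one_pos, fun x _ c _ => by simp⟩
    | insert j S hj ih =>
      intro ε hε
      obtain ⟨r₁, hr₁, h₁⟩ := ih ε hε
      obtain ⟨ρ, hρ, h₂⟩ := Metric.eventually_nhds_iff.1
        ((hd j).and (Metric.continuousAt_iff'.1 (hc j) ε hε))
      -- With increments below ρ/(1 + M), where M is the sum of the norms of the basis vectors,
      -- every intermediate point stays within ρ of x₀.
      refine ⟨min r₁ (ρ / (1 + M)), by positivity, fun x hx c hcr => ?_⟩
      have hx1 : ‖x - x₀‖ < r₁ := hx.trans_le (min_le_left _ _)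
      have hx2 : ‖x - x₀‖ < ρ / (1 + M) := hx.trans_le (min_le_right _ _)
      have hc1 : ∀ i, |c i| < r₁ := fun i => (hcr i).trans_le (min_le_left _ _)
      have hc2 : ∀ i, |c i| ≤ ρ / (1 + M) := fun i => ((hcr i).trans_le (min_le_right _ _)).le
      set x' := x + ∑ i ∈ S, c i • b i with hx'
      have hseg : ∀ t ∈ Set.Icc (0 : ℝ) 1, dist (x' + t • (c j • b j)) x₀ < ρ := by
        intro t ht
        have e1 : x' + t • (c j • b j) - x₀ =
            (x - x₀) + ∑ i ∈ insert j S, (if i = j then t * c i else c i) • b i := by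
          rw [Finset.sum_insert hj, if_pos rfl, Finset.sum_congr rfl (g := fun i => c i • b i)
            (fun i hi => by rw [if_neg (fun h : i = j => hj (h ▸ hi))]), hx', smul_smul]
          abel
        have e2 : ‖∑ i ∈ insert j S, (if i = j then t * c i else c i) • b i‖ ≤
            ρ / (1 + M) * M := by
          calc _ ≤ ∑ i ∈ insert j S, ρ / (1 + M) * ‖b i‖ := by
                refine norm_sum_le_of_le _ fun i _ => ?_
                rw [norm_smul]
                gcongr
                split_ifs with h
                · rw [norm_mul, Real.norm_of_nonneg ht.1, Real.norm_eq_abs]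
                  have := hc2 i
                  have := abs_nonneg (c i)
                  nlinarith [ht.2]
                · exact hc2 i
            _ ≤ _ := by
                rw [← Finset.mul_sum]
                gcongr
                exact Finset.sum_le_sum_of_subset_of_nonneg (Finset.subset_univ _)
                  fun i _ _ => norm_nonneg _
        rw [dist_eq_norm, e1]
        calc _ ≤ ‖x - x₀‖ + ρ / (1 + M) * M := (norm_add_le _ _).trans (by gcongr)
          _ < ρ / (1 + M) + ρ / (1 + M) * M := by gcongr
          _ = ρ := by field_simp
      have hmv : ‖f (x' + c j • b j) - f x' - c j • g j x₀‖ ≤ ε * |c j| := by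
        have hder : ∀ t ∈ Set.Icc (0 : ℝ) 1, HasDerivWithinAt
            (fun t : ℝ => f (x' + t • (c j • b j)) - t • (c j • g j x₀))
            (c j • g j (x' + t • (c j • b j)) - c j • g j x₀) (Set.Icc 0 1) t := by
          intro t ht
          have e1 := (h₂ (hseg t ht)).1.smul (c j)
          have e2 := e1.hasDerivAt_add_smul
          have e3 : HasDerivAt (fun t : ℝ => t • (c j • g j x₀)) ((1 : ℝ) • (c j • g j x₀)) t :=
            (hasDerivAt_id t).smul_const _
          rw [one_smul] at e3
          exact (e2.sub e3).hasDerivWithinAt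
        have h3 := norm_image_sub_le_of_norm_deriv_le_segment_01' hder (C := ε * |c j|) (by
          intro t ht
          rw [← smul_sub, norm_smul, Real.norm_eq_abs, mul_comm]
          have := (h₂ (hseg t (Set.Ico_subset_Icc_self ht))).2
          rw [dist_eq_norm] at this
          gcongr)
        simp only [one_smul, zero_smul, add_zero, sub_zero] at h3
        convert h3 using 2
        abel
      rw [Finset.sum_insert hj, Finset.sum_insert hj, Finset.sum_insert hj]
      have e : f (x + (c j • b j + ∑ i ∈ S, c i • b i)) - f x -
          (c j • g j x₀ + ∑ i ∈ S, c i • g i x₀) =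
          (f (x' + c j • b j) - f x' - c j • g j x₀) +
            (f x' - f x - ∑ i ∈ S, c i • g i x₀) := by
        rw [hx', show x + (c j • b j + ∑ i ∈ S, c i • b i) =
          x + ∑ i ∈ S, c i • b i + c j • b j by abel]
        abel
      rw [e, mul_add]
      exact (norm_add_le _ _).trans (add_le_add hmv (h₁ x hx1 c hc1))
  let L : V →L[ℝ] F := LinearMap.toContinuousLinearMap (b.constr ℝ fun i => g i x₀)
  have hL : ∀ i, L (b i) = g i x₀ := fun i => by simp [L]
  refine ⟨L, ?_, hL⟩
  let R : V →L[ℝ] (ι → ℝ) := LinearMap.toContinuousLinearMap b.equivFun.toLinearMap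
  have hR : ∀ v i, R v i = b.repr v i := fun v i => rfl
  have hRle : ∀ v, ∑ i, |R v i| ≤ Fintype.card ι * ‖R‖ * ‖v‖ := by
    intro v
    calc ∑ i, |R v i| ≤ ∑ _i : ι, ‖R‖ * ‖v‖ := by
          refine Finset.sum_le_sum fun i _ => ?_
          rw [← Real.norm_eq_abs]
          exact (norm_le_pi_norm (R v) i).trans (R.le_opNorm v)
      _ = _ := by simp [mul_assoc]
  rw [hasStrictFDerivAt_iff_isLittleO, Asymptotics.isLittleO_iff]
  intro ε hε
  -- The divisor absorbs the comparison of the sum of the coordinates with the norm; the added 1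
  -- keeps it positive.
  obtain ⟨r, hr, h⟩ := key Finset.univ (ε / (Fintype.card ι * ‖R‖ + 1)) (by positivity)
  have h1 : ∀ᶠ p : V × V in 𝓝 (x₀, x₀), ‖p.2 - x₀‖ < r := by
    have : Tendsto (fun p : V × V => ‖p.2 - x₀‖) (𝓝 (x₀, x₀)) (𝓝 ‖x₀ - x₀‖) :=
      Continuous.tendsto (by fun_prop) _
    rw [sub_self, norm_zero] at this
    exact this.eventually (gt_mem_nhds hr)
  have h2 : ∀ᶠ p : V × V in 𝓝 (x₀, x₀), ∀ i, |R (p.1 - p.2) i| < r := by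
    rw [eventually_all]
    intro i
    have : Tendsto (fun p : V × V => |R (p.1 - p.2) i|) (𝓝 (x₀, x₀)) (𝓝 |R (x₀ - x₀) i|) :=
      Continuous.tendsto (by fun_prop) _
    rw [sub_self, map_zero, Pi.zero_apply, abs_zero] at this
    exact this.eventually (gt_mem_nhds hr)
  filter_upwards [h1, h2] with p hp1 hp2
  have h3 := h p.2 hp1 (fun i => R (p.1 - p.2) i) hp2
  have e1 : ∑ i, R (p.1 - p.2) i • b i = p.1 - p.2 := by
    simp only [hR]
    exact b.sum_repr _
  have e2 : ∑ i, R (p.1 - p.2) i • g i x₀ = L (p.1 - p.2) := by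
    nth_rewrite 2 [← e1]
    rw [map_sum]
    refine Finset.sum_congr rfl fun i _ => ?_
    rw [map_smul, hL]
  rw [e1, e2, add_sub_cancel] at h3
  refine h3.trans ?_
  have h4 := hRle (p.1 - p.2)
  calc _ ≤ ε / (Fintype.card ι * ‖R‖ + 1) * (Fintype.card ι * ‖R‖ * ‖p.1 - p.2‖) := by gcongr
    _ ≤ ε / (Fintype.card ι * ‖R‖ + 1) * ((Fintype.card ι * ‖R‖ + 1) * ‖p.1 - p.2‖) := by
        gcongr
        linarith
    _ = _ := by field_simp

/-- Interchange of two partial derivatives. -/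
theorem hasDerivAt_of_hasDerivAt_comm {f f₁ : ℝ → ℝ → ℂ} {f₂ : ℝ → ℂ} {f₁₂ : ℝ → ℝ → ℂ} {x : ℝ}
    (h1 : ∀ᶠ p : ℝ × ℝ in 𝓝 (x, 0), HasDerivAt (fun t => f t p.2) (f₁ p.1 p.2) p.1)
    (h2 : ∀ᶠ t in 𝓝 x, HasDerivAt (f t) (f₂ t) 0)
    (h3 : ∀ᶠ p : ℝ × ℝ in 𝓝 (x, 0), HasDerivAt (f₁ p.1) (f₁₂ p.1 p.2) p.2)
    (hc : ContinuousAt (fun p : ℝ × ℝ => f₁₂ p.1 p.2) (x, 0)) :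
    HasDerivAt f₂ (f₁₂ x 0) x := by
  have hball : ∀ {P : ℝ × ℝ → Prop}, (∀ᶠ p in 𝓝 (x, (0 : ℝ)), P p) →
      ∃ r > 0, ∀ t τ, |t - x| < r → |τ| < r → P (t, τ) := by
    intro P hP
    obtain ⟨r, hr, h⟩ := Metric.eventually_nhds_iff.1 hP
    refine ⟨r, hr, fun t τ ht hτ => h ?_⟩
    rw [Prod.dist_eq]
    simp [Real.dist_eq, ht, hτ]
  have hev : ∀ r > 0, ∀ᶠ p : ℝ × ℝ in 𝓝[≠] 0 ×ˢ 𝓝 x, p.1 ≠ 0 ∧ |p.1| < r ∧ |p.2 - x| < r := by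
    intro r hr
    have e1 : ∀ᶠ τ : ℝ in 𝓝[≠] 0, τ ≠ 0 ∧ |τ| < r := by
      filter_upwards [self_mem_nhdsWithin,
        mem_nhdsWithin_of_mem_nhds (Metric.ball_mem_nhds (0 : ℝ) hr)] with τ h0 hτ
      exact ⟨h0, by simpa [Real.dist_eq] using hτ⟩
    have e2 : ∀ᶠ t : ℝ in 𝓝 x, |t - x| < r := by
      filter_upwards [Metric.ball_mem_nhds x hr] with t ht
      simpa [Real.dist_eq] using ht
    filter_upwards [e1.prod_mk e2] with p hp
    exact ⟨hp.1.1, hp.1.2, hp.2⟩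
  -- f₂ is the limit of difference quotients in the second variable. Their derivatives in the first
  -- variable are difference quotients of f₁, which converge uniformly near x because f₁₂ is
  -- continuous at (x, 0).
  refine hasDerivAt_of_tendstoUniformlyOnFilter (l := 𝓝[≠] (0 : ℝ))
    (f := fun τ t => τ⁻¹ • (f t τ - f t 0)) (f' := fun τ t => τ⁻¹ • (f₁ t τ - f₁ t 0))
    (g' := fun t => f₁₂ t 0) ?_ ?_ ?_
  · rw [Metric.tendstoUniformlyOnFilter_iff]
    intro ε hε
    obtain ⟨r₁, hr₁, c₁⟩ := hball h3
    obtain ⟨r₂, hr₂, c₂⟩ := hball (Metric.continuousAt_iff'.1 hc (ε / 4) (by positivity))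
    filter_upwards [hev (min r₁ r₂) (lt_min hr₁ hr₂)] with p ⟨hp0, hp1, hp2⟩
    have hmv : ‖f₁ p.2 p.1 - f₁ p.2 0 - p.1 • f₁₂ x 0‖ ≤ ε / 4 * |p.1| := by
      have hsm : ∀ τ ∈ Set.Icc (0 : ℝ) 1, |τ * p.1| < min r₁ r₂ := by
        intro τ hτ
        rw [abs_mul, abs_of_nonneg hτ.1]
        have := abs_nonneg p.1
        nlinarith [hτ.2]
      have hder : ∀ τ ∈ Set.Icc (0 : ℝ) 1, HasDerivWithinAt
          (fun τ : ℝ => f₁ p.2 (τ * p.1) - τ • (p.1 • f₁₂ x 0))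
          (p.1 • f₁₂ p.2 (τ * p.1) - p.1 • f₁₂ x 0) (Set.Icc 0 1) τ := by
        intro τ hτ
        have e1 := c₁ p.2 (τ * p.1) (hp2.trans_le (min_le_left _ _))
          ((hsm τ hτ).trans_le (min_le_left _ _))
        have e2 : HasDerivAt (fun τ : ℝ => τ * p.1) p.1 τ := by
          simpa using (hasDerivAt_id τ).mul_const p.1
        have e3 := HasDerivAt.scomp τ e1 e2
        have e4 : HasDerivAt (fun t : ℝ => t • (p.1 • f₁₂ x 0)) ((1 : ℝ) • (p.1 • f₁₂ x 0)) τ :=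
            (hasDerivAt_id τ).smul_const _
        rw [one_smul] at e4
        exact (e3.sub e4).hasDerivWithinAt
      have h4 := norm_image_sub_le_of_norm_deriv_le_segment_01' hder (C := ε / 4 * |p.1|) (by
        intro τ hτ
        rw [← smul_sub, norm_smul, Real.norm_eq_abs, mul_comm]
        have := c₂ p.2 (τ * p.1) (hp2.trans_le (min_le_right _ _))
          ((hsm τ (Set.Ico_subset_Icc_self hτ)).trans_le (min_le_right _ _))
        rw [dist_eq_norm] at this
        gcongr)
      simp only [one_mul, zero_mul, one_smul, zero_smul, sub_zero] at h4
      rw [sub_right_comm]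
      exact h4
    have h5 : ‖f₁₂ p.2 0 - f₁₂ x 0‖ < ε / 4 := by
      have := c₂ p.2 0 (hp2.trans_le (min_le_right _ _)) (by simpa using hr₂)
      rwa [dist_eq_norm] at this
    rw [dist_eq_norm]
    have e : f₁₂ p.2 0 - p.1⁻¹ • (f₁ p.2 p.1 - f₁ p.2 0) =
        (f₁₂ p.2 0 - f₁₂ x 0) - p.1⁻¹ • (f₁ p.2 p.1 - f₁ p.2 0 - p.1 • f₁₂ x 0) := by
      rw [smul_sub p.1⁻¹ _ (p.1 • _), smul_smul, inv_mul_cancel₀ hp0, one_smul]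
      abel
    rw [e]
    have hp : 0 < |p.1| := abs_pos.2 hp0
    have h6 : ‖p.1⁻¹ • (f₁ p.2 p.1 - f₁ p.2 0 - p.1 • f₁₂ x 0)‖ ≤ ε / 4 := by
      rw [norm_smul, norm_inv, Real.norm_eq_abs, inv_mul_le_iff₀ hp]
      linarith
    have := norm_sub_le (f₁₂ p.2 0 - f₁₂ x 0) (p.1⁻¹ • (f₁ p.2 p.1 - f₁ p.2 0 - p.1 • f₁₂ x 0))
    linarith
  · obtain ⟨r₁, hr₁, c₁⟩ := hball h1
    filter_upwards [hev r₁ hr₁] with p ⟨hp0, hp1, hp2⟩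
    convert! ((c₁ p.2 p.1 hp2 hp1).sub (c₁ p.2 0 hp2 (by simpa using hr₁))).const_smul p.1⁻¹ using 1
  · filter_upwards [h2] with t ht
    have := hasDerivAt_iff_tendsto_slope.1 ht
    refine this.congr fun τ => ?_
    simp [slope]

/-- Taylor's formula of order four on `[0, 1]` with a crude remainder. -/
theorem norm_sub_taylor_four_le {f : ℕ → ℝ → ℂ} {C : ℝ}
    (hf : ∀ k < 4, ∀ t ∈ Set.Icc (0 : ℝ) 1, HasDerivAt (f k) (f (k + 1) t) t)
    (hC : ∀ t ∈ Set.Icc (0 : ℝ) 1, ‖f 4 t‖ ≤ C) :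
    ‖f 0 1 - (f 0 0 + f 1 0 + f 2 0 / 2 + f 3 0 / 6)‖ ≤ C := by
  have hC0 : 0 ≤ C := (norm_nonneg _).trans (hC 0 (by simp))
  -- Integrating a bound C over part of [0, 1] keeps it below C; four integrations then give C,
  -- without the factor 1/24.
  have step : ∀ g g' : ℝ → ℂ, (∀ t ∈ Set.Icc (0 : ℝ) 1, HasDerivAt g (g' t) t) → g 0 = 0 →
      (∀ t ∈ Set.Icc (0 : ℝ) 1, ‖g' t‖ ≤ C) → ∀ t ∈ Set.Icc (0 : ℝ) 1, ‖g t‖ ≤ C := by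
    intro g g' hg h0 hb t ht
    have := norm_image_sub_le_of_norm_deriv_le_segment' (fun x hx => (hg x hx).hasDerivWithinAt)
      (fun x hx => hb x (Set.Ico_subset_Icc_self hx)) t ht
    rw [h0, sub_zero, sub_zero] at this
    exact this.trans (by nlinarith [ht.2])
  have hid : ∀ t : ℝ, HasDerivAt (fun t : ℝ => (t : ℂ)) 1 t := fun t =>
    Complex.ofRealCLM.hasDerivAt
  have h3 := step (fun t => f 3 t - f 3 0) (f 4)
    (fun t ht => (hf 3 (by norm_num) t ht).sub_const _) (by simp) hC
  have h2 := step (fun t => f 2 t - f 2 0 - t * f 3 0) (fun t => f 3 t - f 3 0)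
    (fun t ht => by
      simpa using! ((hf 2 (by norm_num) t ht).sub_const (f 2 0)).sub ((hid t).mul_const (f 3 0)))
    (by simp) h3
  have h1 := step (fun t => f 1 t - f 1 0 - t * f 2 0 - (t : ℂ) ^ 2 / 2 * f 3 0)
    (fun t => f 2 t - f 2 0 - t * f 3 0)
    (fun t ht => by
      have e := (((hf 1 (by norm_num) t ht).sub_const (f 1 0)).sub
        ((hid t).mul_const (f 2 0))).sub ((((hid t).pow 2).div_const 2).mul_const (f 3 0))
      convert! e using 1
      push_cast
      ring)
    (by simp) h2
  have h0 := step (fun t => f 0 t - f 0 0 - t * f 1 0 - (t : ℂ) ^ 2 / 2 * f 2 0 -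
      (t : ℂ) ^ 3 / 6 * f 3 0)
    (fun t => f 1 t - f 1 0 - t * f 2 0 - (t : ℂ) ^ 2 / 2 * f 3 0)
    (fun t ht => by
      have e := ((((hf 0 (by norm_num) t ht).sub_const (f 0 0)).sub
        ((hid t).mul_const (f 1 0))).sub ((((hid t).pow 2).div_const 2).mul_const (f 2 0))).sub
        ((((hid t).pow 3).div_const 6).mul_const (f 3 0))
      convert! e using 1
      push_cast
      ring)
    (by simp) h1 1 (by simp)
  refine le_trans (le_of_eq ?_) h0
  congr 1
  push_cast
  ring

end Calculus

/-! ### Exponential moments -/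

section ExponentialMoments

variable {m : ℕ}

/-- The set of `s` with `∫ exp (s x) < ∞`. -/
def expSet (ρ : Measure (Vec m)) : Set (Vec m) :=
  {s | Integrable (fun x => Real.exp (inner ℝ s x)) ρ}

/-- The monomial `∏_{j ∈ J} x_j`. -/
def monomial (J : List (Fin m)) (x : Vec m) : ℝ := (J.map fun j => x j).prod

/-- `∫ x^J exp ((s + iφ) x)`. -/
def expMoment (ρ : Measure (Vec m)) (J : List (Fin m)) (s φ : Vec m) : ℂ :=
  ∫ x, ((monomial J x * Real.exp (inner ℝ s x) : ℝ) : ℂ) *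
    Complex.exp ((inner ℝ x φ : ℝ) * Complex.I) ∂ρ

theorem monomial_cons (j : Fin m) (J : List (Fin m)) (x : Vec m) :
    monomial (j :: J) x = x j * monomial J x := by simp [monomial]

theorem continuous_monomial (J : List (Fin m)) : Continuous (monomial J : Vec m → ℝ) := by
  unfold monomial
  exact continuous_list_prod _ fun j _ => by fun_prop

theorem abs_monomial_le (J : List (Fin m)) (x : Vec m) :
    |monomial J x| ≤ (1 + ‖x‖) ^ J.length := by
  induction J with
  | nil => simp [monomial]
  | cons j J ih =>
    rw [monomial_cons, abs_mul, List.length_cons, pow_succ, mul_comm]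
    have h1 : |x j| ≤ 1 + ‖x‖ := by
      have := PiLp.norm_apply_le x j
      rw [Real.norm_eq_abs] at this
      linarith
    gcongr

variable {ρ : Measure (Vec m)}

/-- `e^{c‖x‖}` is dominated by the exponentials along the coordinate axes. -/
theorem exp_mul_norm_le {c : ℝ} (hc : 0 ≤ c) (x : Vec m) :
    Real.exp (c * ‖x‖) ≤ 1 + ∑ j, (Real.exp (inner ℝ ((c * m) • basisVec j) x) +
      Real.exp (inner ℝ (-((c * m) • basisVec j)) x)) := by
  have hin : ∀ j, inner ℝ ((c * m) • basisVec j) x = c * m * x j := fun j => by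
    simp [inner_smul_left, EuclideanSpace.inner_single_left]
  have hsum : ‖x‖ ≤ ∑ j, |x j| := by
    have e : x = ∑ j, x j • basisVec j := by
      ext i
      simp [Finset.sum_apply, Pi.single_apply]
    calc ‖x‖ = ‖∑ j, x j • basisVec j‖ := by rw [← e]
      _ ≤ _ := norm_sum_le_of_le _ fun j _ => by simp [norm_smul]
  have hnn : ∀ j, 0 ≤ Real.exp (inner ℝ ((c * m) • basisVec j) x) +
      Real.exp (inner ℝ (-((c * m) • basisVec j)) x) := fun j => by positivity
  rcases Nat.eq_zero_or_pos m with hm | hm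
  · subst hm
    have : ‖x‖ = 0 := by rw [Subsingleton.elim x 0, norm_zero]
    simp [this]
  · have : Nonempty (Fin m) := ⟨⟨0, hm⟩⟩
    obtain ⟨k, hk⟩ := Finite.exists_max fun j => |x j|
    -- The largest coordinate controls the norm up to the factor m, hence exponents c·m along the
    -- axes.
    have h1 : ‖x‖ ≤ m * |x k| := by
      refine hsum.trans ((Finset.sum_le_sum fun j _ => hk j).trans ?_)
      simp
    have h2 : Real.exp (c * ‖x‖) ≤ Real.exp (inner ℝ ((c * m) • basisVec k) x) +
        Real.exp (inner ℝ (-((c * m) • basisVec k)) x) := by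
      rw [inner_neg_left, hin]
      have h3 : c * ‖x‖ ≤ |c * m * x k| := by
        rw [abs_mul, abs_of_nonneg (by positivity), mul_assoc]
        gcongr
      refine (Real.exp_le_exp.2 h3).trans ?_
      have e1 := (Real.exp_pos (c * m * x k)).le
      have e2 := (Real.exp_pos (-(c * m * x k))).le
      rcases abs_choice (c * m * x k) with h | h <;> rw [h] <;> linarith
    have h4 := Finset.single_le_sum (fun j _ => hnn j) (Finset.mem_univ k)
    linarith

/-- The constant in `(1 + t)^k ≤ C e^{ct}`. -/
theorem exists_one_add_pow_le_exp (k : ℕ) {c : ℝ} (hc : 0 < c) :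
    ∃ C, 0 ≤ C ∧ ∀ t : ℝ, 0 ≤ t → (1 + t) ^ k ≤ C * Real.exp (c * t) := by
  -- One term of the exponential series of c(1 + t).
  refine ⟨(k.factorial : ℝ) / c ^ k * Real.exp c, by positivity, fun t ht => ?_⟩
  have h := Real.pow_div_factorial_le_exp (c * (1 + t)) (by positivity) k
  rw [mul_pow, div_le_iff₀ (by positivity)] at h
  rw [mul_assoc, ← Real.exp_add, div_mul_eq_mul_div, le_div_iff₀ (by positivity)]
  calc _ = c ^ k * (1 + t) ^ k := by ring
    _ ≤ _ := h
    _ = _ := by rw [mul_comm]; congr 2; ring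

theorem exp_inner_add_le {c : ℝ} (hc : 0 ≤ c) (s x : Vec m) :
    Real.exp (inner ℝ s x + c * ‖x‖) ≤ Real.exp (inner ℝ s x) +
      ∑ j, (Real.exp (inner ℝ (s + (c * m) • basisVec j) x) +
      Real.exp (inner ℝ (s + -((c * m) • basisVec j)) x)) := by
  rw [Real.exp_add]
  refine (mul_le_mul_of_nonneg_left (exp_mul_norm_le hc x) (Real.exp_pos _).le).trans
    (le_of_eq ?_)
  simp only [inner_add_left, Real.exp_add, mul_add, mul_one, Finset.mul_sum]

/-- From an interior point one can move a little in both directions along every axis without losing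
integrability, and the exponentials at these finitely many points dominate e^{c|x|}. -/
theorem exists_integrable_exp_add {s : Vec m} (hs : s ∈ interior (expSet ρ)) :
    ∃ c > 0, Integrable (fun x => Real.exp (inner ℝ s x + c * ‖x‖)) ρ := by
  obtain ⟨r, hr, hball⟩ := Metric.isOpen_iff.1 isOpen_interior s hs
  -- The axis shifts then have length (r/2)·m/(m + 1) < r; the denominator m + 1 also covers m = 0.
  refine ⟨r / 2 / (m + 1), by positivity, ?_⟩
  have hmem : ∀ j, s + (r / 2 / (m + 1) * m : ℝ) • basisVec j ∈ expSet ρ ∧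
      s + -((r / 2 / (m + 1) * m : ℝ) • basisVec j) ∈ expSet ρ := by
    intro j
    have h1 : ‖(r / 2 / (m + 1) * m : ℝ) • (basisVec j : Vec m)‖ < r := by
      rw [norm_smul, PiLp.norm_single, norm_one, mul_one,
        Real.norm_of_nonneg (by positivity)]
      have : (m : ℝ) / (m + 1) ≤ 1 := by
        rw [div_le_one (by positivity)]; linarith
      calc r / 2 / (m + 1) * m = r / 2 * ((m : ℝ) / (m + 1)) := by ring
        _ ≤ r / 2 * 1 := by gcongr
        _ < r := by linarith
    constructor
    · exact interior_subset (hball (by simpa [dist_eq_norm] using h1))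
    · exact interior_subset (hball (by simpa [dist_eq_norm] using h1))
  have hI : Integrable (fun x => Real.exp (inner ℝ s x) +
      ∑ j, (Real.exp (inner ℝ (s + (r / 2 / (m + 1) * m : ℝ) • basisVec j) x) +
      Real.exp (inner ℝ (s + -((r / 2 / (m + 1) * m : ℝ) • basisVec j)) x))) ρ := by
    refine Integrable.add (show s ∈ expSet ρ from interior_subset hs) (integrable_finsetSum _ fun j _ => ?_)
    exact Integrable.add (hmem j).1 (hmem j).2
  refine hI.mono' (Continuous.aestronglyMeasurable (by fun_prop))
    (Eventually.of_forall fun x => ?_)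
  rw [Real.norm_of_nonneg (Real.exp_pos _).le]
  exact exp_inner_add_le (by positivity) s x

/-- Half of the exponential margin absorbs any polynomial. The other half is kept, to dominate
integrands uniformly while s moves in a small ball. -/
theorem exists_integrable_pow_mul_exp {s : Vec m} (hs : s ∈ interior (expSet ρ)) :
    ∃ c > 0, ∀ k : ℕ, Integrable
      (fun x => (1 + ‖x‖) ^ k * Real.exp (inner ℝ s x + c * ‖x‖)) ρ := by
  obtain ⟨c, hc, hI⟩ := exists_integrable_exp_add hs
  refine ⟨c / 2, by positivity, fun k => ?_⟩
  obtain ⟨C, hC, h⟩ := exists_one_add_pow_le_exp k (c := c / 2) (by positivity)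
  refine (hI.const_mul C).mono' (Continuous.aestronglyMeasurable (by fun_prop))
    (Eventually.of_forall fun x => ?_)
  rw [Real.norm_of_nonneg (by positivity)]
  calc _ ≤ (C * Real.exp (c / 2 * ‖x‖)) * Real.exp (inner ℝ s x + c / 2 * ‖x‖) := by
        gcongr
        exact h _ (norm_nonneg _)
    _ = _ := by
        rw [mul_assoc, ← Real.exp_add]
        congr 2
        ring

theorem integrable_pow_mul_exp {s : Vec m} (hs : s ∈ interior (expSet ρ)) (k : ℕ) :
    Integrable (fun x => (1 + ‖x‖) ^ k * Real.exp (inner ℝ s x)) ρ := by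
  obtain ⟨c, hc, h⟩ := exists_integrable_pow_mul_exp hs
  refine (h k).mono' (Continuous.aestronglyMeasurable (by fun_prop))
    (Eventually.of_forall fun x => ?_)
  rw [Real.norm_of_nonneg (by positivity)]
  gcongr
  have := norm_nonneg x
  nlinarith

theorem integrable_monomial_mul_exp {s : Vec m} (hs : s ∈ interior (expSet ρ))
    (J : List (Fin m)) : Integrable (fun x => monomial J x * Real.exp (inner ℝ s x)) ρ := by
  have := continuous_monomial J
  refine (integrable_pow_mul_exp hs J.length).mono'
    (Continuous.aestronglyMeasurable (by fun_prop)) (Eventually.of_forall fun x => ?_)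
  rw [norm_mul, Real.norm_eq_abs, Real.norm_of_nonneg (Real.exp_pos _).le]
  gcongr
  exact abs_monomial_le J x

theorem integrable_expMoment {s : Vec m} (hs : s ∈ interior (expSet ρ))
    (J : List (Fin m)) (φ : Vec m) :
    Integrable (fun x => ((monomial J x * Real.exp (inner ℝ s x) : ℝ) : ℂ) *
      Complex.exp ((inner ℝ x φ : ℝ) * Complex.I)) ρ := by
  have := continuous_monomial J
  refine (integrable_monomial_mul_exp hs J).norm.mono'
    (Continuous.aestronglyMeasurable (by fun_prop)) (Eventually.of_forall fun x => ?_)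
  rw [norm_mul, Complex.norm_exp_ofReal_mul_I, Complex.norm_real, mul_one]

theorem expMoment_zero (J : List (Fin m)) (s : Vec m) :
    expMoment ρ J s 0 = ((∫ x, monomial J x * Real.exp (inner ℝ s x) ∂ρ : ℝ) : ℂ) := by
  unfold expMoment
  rw [← integral_complex_ofReal]
  simp

/-- Differentiation in the real variable. -/
theorem hasLineDerivAt_expMoment {s : Vec m} (hs : s ∈ interior (expSet ρ))
    (J : List (Fin m)) (j : Fin m) (φ : Vec m) :
    HasLineDerivAt ℝ (fun s' => expMoment ρ J s' φ) (expMoment ρ (j :: J) s φ) s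
      (basisVec j) := by
  obtain ⟨c, hc, hI⟩ := exists_integrable_pow_mul_exp hs
  have hmc := continuous_monomial J
  have hmc' := continuous_monomial (j :: J)
  have key := hasDerivAt_integral_of_dominated_loc_of_deriv_le (μ := ρ) (𝕜 := ℝ) (x₀ := (0 : ℝ))
    -- Within this radius the change of s costs at most the exponential margin c|x|.
    (s := Metric.ball 0 c)
    (bound := fun x => (1 + ‖x‖) ^ (J.length + 1) * Real.exp (inner ℝ s x + c * ‖x‖))
    (F := fun t x => ((monomial J x * Real.exp (inner ℝ (s + t • basisVec j) x) : ℝ) : ℂ) *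
      Complex.exp ((inner ℝ x φ : ℝ) * Complex.I))
    (F' := fun t x => ((monomial (j :: J) x * Real.exp (inner ℝ (s + t • basisVec j) x) : ℝ) : ℂ) *
      Complex.exp ((inner ℝ x φ : ℝ) * Complex.I))
    (Metric.ball_mem_nhds _ hc)
    (Eventually.of_forall fun t => Continuous.aestronglyMeasurable (by fun_prop))
    (by simpa using integrable_expMoment hs J φ)
    (Continuous.aestronglyMeasurable (by fun_prop))
    (Eventually.of_forall fun x t ht => by
      rw [norm_mul, Complex.norm_exp_ofReal_mul_I, Complex.norm_real, mul_one, norm_mul,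
        Real.norm_eq_abs, Real.norm_of_nonneg (Real.exp_pos _).le]
      gcongr
      · exact abs_monomial_le (j :: J) x
      · rw [inner_add_left]
        gcongr
        refine (real_inner_le_norm _ _).trans ?_
        gcongr
        rw [norm_smul, PiLp.norm_single, norm_one, mul_one]
        exact (mem_ball_zero_iff.1 ht).le)
    (hI _)
    (Eventually.of_forall fun x t _ => by
      have h1 : HasDerivAt (fun t : ℝ => inner ℝ (s + t • basisVec j) x) (x j) t := by
        have e : (fun t : ℝ => inner ℝ (s + t • basisVec j) x) = fun t => inner ℝ s x + t * x j := by
          funext t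
          simp [inner_add_left, inner_smul_left, EuclideanSpace.inner_single_left]
        rw [e]
        simpa using! ((hasDerivAt_id t).mul_const (x j)).const_add (inner ℝ s x)
      have h2 := ((h1.exp.const_mul (monomial J x)).ofReal_comp).mul_const
        (Complex.exp ((inner ℝ x φ : ℝ) * Complex.I))
      convert! h2 using 1
      rw [monomial_cons]
      congr 2
      ring)
  have h := key.2
  simp only [zero_smul, add_zero] at h
  exact h

/-- Differentiation in the imaginary variable, along a ray. -/
theorem hasDerivAt_expMoment_smul {s : Vec m} (hs : s ∈ interior (expSet ρ))
    (J : List (Fin m)) (φ : Vec m) (t : ℝ) :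
    HasDerivAt (fun t : ℝ => expMoment ρ J s (t • φ))
      (∑ j, (Complex.I * φ j) * expMoment ρ (j :: J) s (t • φ)) t := by
  have hmc := continuous_monomial J
  have hsum : ∀ x : Vec m, inner ℝ x φ = ∑ j, φ j * x j := fun x => by
    simp [PiLp.inner_apply]
  have key := hasDerivAt_integral_of_dominated_loc_of_deriv_le (μ := ρ) (𝕜 := ℝ) (x₀ := t)
    (s := Set.univ)
    (bound := fun x => ‖φ‖ * ((1 + ‖x‖) ^ (J.length + 1) * Real.exp (inner ℝ s x)))
    (F := fun t x => ((monomial J x * Real.exp (inner ℝ s x) : ℝ) : ℂ) *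
      Complex.exp ((inner ℝ x (t • φ) : ℝ) * Complex.I))
    (F' := fun t x => ((monomial J x * Real.exp (inner ℝ s x) : ℝ) : ℂ) *
      (Complex.exp ((inner ℝ x (t • φ) : ℝ) * Complex.I) * ((inner ℝ x φ : ℝ) * Complex.I)))
    Filter.univ_mem
    (Eventually.of_forall fun t => Continuous.aestronglyMeasurable (by fun_prop))
    (integrable_expMoment hs J _)
    (Continuous.aestronglyMeasurable (by fun_prop))
    (Eventually.of_forall fun x t _ => by
      rw [norm_mul, norm_mul, Complex.norm_exp_ofReal_mul_I, Complex.norm_real, one_mul, norm_mul,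
        norm_mul, Complex.norm_I, mul_one, Complex.norm_real, Real.norm_eq_abs,
        Real.norm_of_nonneg (Real.exp_pos _).le, Real.norm_eq_abs]
      calc _ ≤ (1 + ‖x‖) ^ J.length * Real.exp (inner ℝ s x) * ((1 + ‖x‖) * ‖φ‖) := by
            gcongr
            · exact abs_monomial_le J x
            · refine (abs_real_inner_le_norm _ _).trans ?_
              gcongr
              linarith
        _ = _ := by ring)
    ((integrable_pow_mul_exp hs _).const_mul _)
    (Eventually.of_forall fun x t _ => by
      have h1 : HasDerivAt (fun t : ℝ => ((inner ℝ x (t • φ) : ℝ) : ℂ) * Complex.I)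
          (((inner ℝ x φ : ℝ) : ℂ) * Complex.I) t := by
        simp only [inner_smul_right]
        have : HasDerivAt (fun t : ℝ => t * inner ℝ x φ) (inner ℝ x φ) t := by
          simpa using (hasDerivAt_id t).mul_const (inner ℝ x φ)
        exact this.ofReal_comp.mul_const _
      exact h1.cexp.const_mul _)
  have h2 := key.2
  convert! h2 using 1
  unfold expMoment
  simp only [← integral_const_mul]
  rw [← integral_finsetSum _ fun j _ => (integrable_expMoment hs (j :: J) (t • φ)).const_mul _]
  refine integral_congr_ae (Eventually.of_forall fun x => ?_)
  simp only [hsum x, monomial_cons]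
  push_cast
  simp only [Finset.sum_mul, Finset.mul_sum]
  refine Finset.sum_congr rfl fun j _ => ?_
  ring

end ExponentialMoments

/-! ### Regularity of the moment generating function -/

section IterSum

variable {m : ℕ}

/-- The form `∑_{j_1, …, j_k} c_{j_1} ⋯ c_{j_k} a (j_k, …, j_1, J)`. -/
def iterSum {R : Type*} [CommRing R] (c : Fin m → R) (a : List (Fin m) → R) :
    ℕ → List (Fin m) → R
  | 0, J => a J
  | k + 1, J => ∑ j, c j * iterSum c a k (j :: J)

theorem iterSum_I_mul (c : Fin m → ℝ) (a : List (Fin m) → ℝ) (k : ℕ) (J : List (Fin m)) :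
    iterSum (fun j => Complex.I * (c j : ℂ)) (fun J => (a J : ℂ)) k J =
      Complex.I ^ k * (iterSum c a k J : ℝ) := by
  induction k generalizing J with
  | zero => simp [iterSum]
  | succ k ih =>
    simp only [iterSum, ih]
    push_cast
    rw [Finset.mul_sum]
    refine Finset.sum_congr rfl fun j _ => ?_
    rw [pow_succ]
    ring

theorem iterSum_neg (c : Fin m → ℝ) (a : List (Fin m) → ℝ) (k : ℕ) (J : List (Fin m)) :
    iterSum (fun j => -c j) a k J = (-1) ^ k * iterSum c a k J := by
  induction k generalizing J with
  | zero => simp [iterSum]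
  | succ k ih =>
    simp only [iterSum, ih, Finset.mul_sum]
    refine Finset.sum_congr rfl fun j _ => ?_
    rw [pow_succ]
    ring

theorem norm_iterSum_le {R : Type*} [NormedCommRing R] {c : Fin m → R} {a : List (Fin m) → R}
    {r A : ℝ} (hr : ∀ j, ‖c j‖ ≤ r) (hr0 : 0 ≤ r) (k : ℕ) (J : List (Fin m))
    (hA : ∀ J', J'.length = J.length + k → ‖a J'‖ ≤ A) :
    ‖iterSum c a k J‖ ≤ (m * r) ^ k * A := by
  induction k generalizing J with
  | zero => simpa [iterSum] using hA J (by simp)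
  | succ k ih =>
    simp only [iterSum]
    have h1 : ∀ j ∈ Finset.univ, ‖c j * iterSum c a k (j :: J)‖ ≤ r * ((m * r) ^ k * A) := by
      intro j _
      refine (norm_mul_le _ _).trans ?_
      refine mul_le_mul (hr j) (ih (j :: J) fun J' hJ' => hA J' ?_) (norm_nonneg _) hr0
      rw [hJ', List.length_cons]; ring
    refine (norm_sum_le_of_le _ h1).trans (le_of_eq ?_)
    simp
    ring

theorem continuous_iterSum (a : List (Fin m) → ℝ) (k : ℕ) (J : List (Fin m)) :
    Continuous fun φ : Vec m => iterSum (fun j => φ j) a k J := by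
  induction k generalizing J with
  | zero => exact continuous_const
  | succ k ih =>
    simp only [iterSum]
    exact continuous_finsetSum _ fun j _ => by
      have := ih (j :: J)
      fun_prop

end IterSum

/-! ### Moments and their parameter derivatives as functions of (s, φ, θ) -/

section Regularity

variable {m p : ℕ} {Θ : Set (Vec p)} {ν : Vec p → Measure (Vec m)}

/-- `∫ x^J exp (s x)`. -/
def realMoment (ρ : Measure (Vec m)) (J : List (Fin m)) (s : Vec m) : ℝ :=
  ∫ x, monomial J x * Real.exp (inner ℝ s x) ∂ρ

/-- `∂_{θ_i} ∫ x^J exp (s x)`. -/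
def thetaMoment (ν : Vec p → Measure (Vec m)) (i : Fin p) (J : List (Fin m)) (s : Vec m)
    (θ : Vec p) : ℝ := (mgfPartial ν [i] J s 0 θ).re

theorem cexp_sum_eq (s φ x : Vec m) :
    Complex.exp (∑ j, ((s j : ℂ) + Complex.I * (φ j : ℂ)) * (x j : ℂ)) =
      (Real.exp (inner ℝ s x) : ℂ) * Complex.exp ((inner ℝ x φ : ℝ) * Complex.I) := by
  rw [Complex.ofReal_exp, ← Complex.exp_add]
  congr 1
  simp only [PiLp.inner_apply, RCLike.inner_apply, conj_trivial]
  push_cast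
  rw [Finset.sum_mul, ← Finset.sum_add_distrib]
  refine Finset.sum_congr rfl fun j _ => ?_
  ring

theorem mgfC_eq_expMoment (s φ : Vec m) (θ : Vec p) :
    mgfC ν s φ θ = expMoment (ν θ) [] s φ := by
  unfold mgfC expMoment
  simp only [cexp_sum_eq]
  simp [monomial]

theorem mgf_eq_realMoment (s : Vec m) (θ : Vec p) : mgf ν s θ = realMoment (ν θ) [] s := by
  simp [mgf, realMoment, monomial]

theorem expMoment_zero_eq_realMoment {ρ : Measure (Vec m)} (J : List (Fin m)) (s : Vec m) :
    expMoment ρ J s 0 = (realMoment ρ J s : ℂ) := expMoment_zero J s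

theorem mem_interior_expSet {s : Vec m} {θ : Vec p} (h : (s, θ) ∈ interior (mgfDomain Θ ν)) :
    s ∈ interior (expSet (ν θ)) := by
  have h1 : (fun s' : Vec m => (s', θ)) ⁻¹' interior (mgfDomain Θ ν) ⊆ expSet (ν θ) :=
    fun s' hs' => (interior_subset hs').2
  exact interior_maximal h1 (isOpen_interior.preimage (by fun_prop)) h

theorem mem_of_mem_interior {s : Vec m} {θ : Vec p} (h : (s, θ) ∈ interior (mgfDomain Θ ν)) :
    θ ∈ Θ := (interior_subset h).1

/-- Each line derivative only sees values near s, and the interior is open, so differentiation under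
the integral can be iterated by induction on the list. -/
theorem mgfPartial_nil_eq {θ : Vec p} (J : List (Fin m)) {s : Vec m}
    (hs : s ∈ interior (expSet (ν θ))) (φ : Vec m) :
    mgfPartial ν [] J s φ θ = expMoment (ν θ) J s φ := by
  induction J generalizing s with
  | nil => exact mgfC_eq_expMoment s φ θ
  | cons j J ih =>
    have h1 : (fun s' => mgfPartial ν [] J s' φ θ) =ᶠ[𝓝 s] fun s' => expMoment (ν θ) J s' φ := by
      filter_upwards [isOpen_interior.mem_nhds hs] with s' hs'
      exact ih hs'
    change lineDeriv ℝ (fun s' => mgfPartial ν [] J s' φ θ) s (basisVec j) = _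
    have h2 := (hasLineDerivAt_expMoment hs J j φ).congr_of_eventuallyEq h1
    exact h2.lineDeriv

/-- Lists of length at most 5 leave room for one parameter derivative within the controlled total
order 6. -/
theorem hasLineDerivAt_theta (hg : GrowthBound Θ ν) {s : Vec m} {θ : Vec p}
    (h : (s, θ) ∈ interior (mgfDomain Θ ν)) (i : Fin p) (J : List (Fin m)) (hJ : J.length ≤ 5)
    (φ : Vec m) :
    HasLineDerivAt ℝ (fun θ' => mgfPartial ν [] J s φ θ') (mgfPartial ν [i] J s φ θ) θ
      (basisVec i) := by
  obtain ⟨γ, -, -, hγ⟩ := hg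
  have hctl : ControlledOrder [i].length J.length := by
    left; simp only [List.length_cons, List.length_nil]; omega
  exact (((hγ [i] J hctl).1 s θ h φ).1 : LineDifferentiableAt ℝ _ _ _).hasLineDerivAt

theorem continuousOn_mgfPartial_theta (hg : GrowthBound Θ ν) (i : Fin p) (J : List (Fin m))
    (hJ : J.length ≤ 5) :
    ContinuousOn (fun r : Vec m × Vec m × Vec p => mgfPartial ν [i] J r.1 r.2.1 r.2.2)
        {r | (r.1, r.2.2) ∈ interior (mgfDomain Θ ν)} := by
  obtain ⟨γ, -, -, hγ⟩ := hg
  have hctl : ControlledOrder [i].length J.length := by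
    left; simp only [List.length_cons, List.length_nil]; omega
  exact (hγ [i] J hctl).2

theorem continuousOn_mgfPartial_nil (hg : GrowthBound Θ ν) (J : List (Fin m))
    (hJ1 : 1 ≤ J.length) (hJ : J.length ≤ 6) :
    ContinuousOn (fun r : Vec m × Vec m × Vec p => mgfPartial ν [] J r.1 r.2.1 r.2.2)
        {r | (r.1, r.2.2) ∈ interior (mgfDomain Θ ν)} := by
  obtain ⟨γ, -, -, hγ⟩ := hg
  have hctl : ControlledOrder ([] : List (Fin p)).length J.length := by
    left; simp only [List.length_nil]; omega
  exact (hγ [] J hctl).2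

theorem isOpen_tripleDomain :
    IsOpen {r : Vec m × Vec m × Vec p | (r.1, r.2.2) ∈ interior (mgfDomain Θ ν)} :=
  isOpen_interior.preimage (by fun_prop : Continuous fun r : Vec m × Vec m × Vec p => (r.1, r.2.2))

theorem continuousAt_theta (hg : GrowthBound Θ ν) {s : Vec m} {θ : Vec p}
    (h : (s, θ) ∈ interior (mgfDomain Θ ν)) (i : Fin p) (J : List (Fin m)) (hJ : J.length ≤ 5)
    (φ : Vec m) :
    ContinuousAt (fun r : Vec m × Vec m × Vec p => mgfPartial ν [i] J r.1 r.2.1 r.2.2)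
      (s, φ, θ) :=
  (continuousOn_mgfPartial_theta hg i J hJ).continuousAt (isOpen_tripleDomain.mem_nhds h)

/-- The derivative of a real quantity is real. -/
theorem ofReal_thetaMoment (hg : GrowthBound Θ ν) {s : Vec m} {θ : Vec p}
    (h : (s, θ) ∈ interior (mgfDomain Θ ν)) (i : Fin p) (J : List (Fin m)) (hJ : J.length ≤ 5) :
    mgfPartial ν [i] J s 0 θ = (thetaMoment ν i J s θ : ℂ) ∧
      HasLineDerivAt ℝ (fun θ' => realMoment (ν θ') J s) (thetaMoment ν i J s θ) θ
        (basisVec i) := by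
  have h1 := hasLineDerivAt_theta hg h i J hJ 0
  have hev : ∀ᶠ t : ℝ in 𝓝 0, (s, θ + t • (basisVec i : Vec p)) ∈ interior (mgfDomain Θ ν) := by
    have hc : ContinuousAt (fun t : ℝ => (s, θ + t • (basisVec i : Vec p))) 0 :=
      Continuous.continuousAt (by fun_prop)
    exact hc.eventually_mem (isOpen_interior.mem_nhds (by simpa using h))
  have h2 : ∀ᶠ t : ℝ in 𝓝 0, mgfPartial ν [] J s 0 (θ + t • basisVec i) =
      (realMoment (ν (θ + t • basisVec i)) J s : ℂ) := by
    filter_upwards [hev] with t ht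
    rw [mgfPartial_nil_eq J (mem_interior_expSet ht), expMoment_zero_eq_realMoment]
  unfold HasLineDerivAt at h1
  have h3 : HasDerivAt (fun t : ℝ => (realMoment (ν (θ + t • basisVec i)) J s : ℂ))
      (mgfPartial ν [i] J s 0 θ) 0 :=
    h1.congr_of_eventuallyEq (h2.mono fun t ht => ht.symm)
  -- The imaginary part vanishes identically along the parameter line near θ, so its derivative is
  -- zero.
  have him : (mgfPartial ν [i] J s 0 θ).im = 0 := by
    have e : HasDerivAt (fun t : ℝ => (realMoment (ν (θ + t • basisVec i)) J s : ℂ).im)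
        (mgfPartial ν [i] J s 0 θ).im 0 :=
      Complex.imCLM.hasFDerivAt.comp_hasDerivAt (0 : ℝ) h3
    simp only [Complex.ofReal_im] at e
    exact e.unique (hasDerivAt_const _ _)
  refine ⟨Complex.ext (by simp [thetaMoment]) (by simpa using him), ?_⟩
  have e : HasDerivAt (fun t : ℝ => (realMoment (ν (θ + t • basisVec i)) J s : ℂ).re)
        (mgfPartial ν [i] J s 0 θ).re 0 :=
      Complex.reCLM.hasFDerivAt.comp_hasDerivAt (0 : ℝ) h3
  exact e

theorem hasLineDerivAt_realMoment {ρ : Measure (Vec m)} {s : Vec m}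
    (hs : s ∈ interior (expSet ρ)) (J : List (Fin m)) (j : Fin m) :
    HasLineDerivAt ℝ (realMoment ρ J) (realMoment ρ (j :: J) s) s (basisVec j) := by
  have h := hasLineDerivAt_expMoment hs J j 0
  simp only [expMoment_zero_eq_realMoment] at h
  have e : HasDerivAt (fun t : ℝ => (realMoment ρ J (s + t • basisVec j) : ℂ).re)
        (realMoment ρ (j :: J) s : ℂ).re 0 :=
      Complex.reCLM.hasFDerivAt.comp_hasDerivAt (0 : ℝ) h
  exact e

/-- The moments are jointly strictly differentiable in `(s, θ)`. -/
theorem exists_hasStrictFDerivAt_realMoment (hg : GrowthBound Θ ν) {s : Vec m} {θ : Vec p}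
    (h : (s, θ) ∈ interior (mgfDomain Θ ν)) (J : List (Fin m)) (hJ : J.length ≤ 5) :
    ∃ L : Vec m × Vec p →L[ℝ] ℝ,
      HasStrictFDerivAt (fun q : Vec m × Vec p => realMoment (ν q.2) J q.1) L (s, θ) ∧
      (∀ j, L (basisVec j, 0) = realMoment (ν θ) (j :: J) s) ∧
      ∀ i, L (0, basisVec i) = thetaMoment ν i J s θ := by
  have hnhds := isOpen_interior.mem_nhds h
  obtain ⟨L, hL, hLb⟩ := exists_hasStrictFDerivAt_of_hasLineDerivAt
    ((EuclideanSpace.basisFun (Fin m) ℝ).toBasis.prod (EuclideanSpace.basisFun (Fin p) ℝ).toBasis)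
    (f := fun q : Vec m × Vec p => realMoment (ν q.2) J q.1) (x₀ := (s, θ))
    (g := Sum.elim (fun j q => realMoment (ν q.2) (j :: J) q.1)
      (fun i q => thetaMoment ν i J q.1 q.2)) (by
      rintro (j | i)
      · filter_upwards [hnhds] with q hq
        have := hasLineDerivAt_realMoment (mem_interior_expSet hq) J j
        unfold HasLineDerivAt at this ⊢
        simpa using! this
      · filter_upwards [hnhds] with q hq
        have := (ofReal_thetaMoment hg (s := q.1) (θ := q.2) hq i J hJ).2
        unfold HasLineDerivAt at this ⊢
        simpa using! this) (by
      have hemb : ContinuousAt (fun q : Vec m × Vec p => ((q.1, 0, q.2) : Vec m × Vec m × Vec p))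
        (s, θ) := Continuous.continuousAt (by fun_prop)
      rintro (j | i)
      -- Differentiating in s lengthens the list by one, to a length between 1 and 6, where the
      -- growth hypothesis gives joint continuity. Order 0 is not controlled, so continuity of the
      -- moment generating function itself is deduced from its differentiability.
      · have h1 : ContinuousAt (fun r : Vec m × Vec m × Vec p =>
            mgfPartial ν [] (j :: J) r.1 r.2.1 r.2.2) (s, 0, θ) :=
          (continuousOn_mgfPartial_nil hg (j :: J) (by simp) (by simp; omega)).continuousAt
            (isOpen_tripleDomain.mem_nhds h)
        have h2 : ContinuousAt (fun q : Vec m × Vec p =>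
            (mgfPartial ν [] (j :: J) q.1 0 q.2).re) (s, θ) :=
          Complex.continuous_re.continuousAt.comp
            (ContinuousAt.comp (x := (s, θ)) (f := fun q : Vec m × Vec p =>
              ((q.1, 0, q.2) : Vec m × Vec m × Vec p)) h1 hemb)
        refine h2.congr ?_
        filter_upwards [hnhds] with q hq
        rw [mgfPartial_nil_eq _ (mem_interior_expSet hq), expMoment_zero_eq_realMoment]
        simp
      · exact Complex.continuous_re.continuousAt.comp
            (ContinuousAt.comp (x := (s, θ)) (f := fun q : Vec m × Vec p =>
              ((q.1, 0, q.2) : Vec m × Vec m × Vec p)) (continuousAt_theta hg h i J hJ 0) hemb))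
  refine ⟨L, hL, fun j => ?_, fun i => ?_⟩
  · simpa using hLb (Sum.inl j)
  · simpa using hLb (Sum.inr i)

theorem continuousAt_realMoment (hg : GrowthBound Θ ν) {s : Vec m} {θ : Vec p}
    (h : (s, θ) ∈ interior (mgfDomain Θ ν)) (J : List (Fin m)) (hJ : J.length ≤ 5) :
    ContinuousAt (fun q : Vec m × Vec p => realMoment (ν q.2) J q.1) (s, θ) := by
  obtain ⟨L, hL, -⟩ := exists_hasStrictFDerivAt_realMoment hg h J hJ
  exact hL.continuousAt

/-- Differentiation of `∂_{θ_i} M` in the imaginary variable, along a ray. -/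
theorem hasDerivAt_theta_smul (hg : GrowthBound Θ ν) {s : Vec m} {θ : Vec p}
    (h : (s, θ) ∈ interior (mgfDomain Θ ν)) (i : Fin p) (J : List (Fin m)) (hJ : J.length ≤ 4)
    (φ : Vec m) (t : ℝ) :
    HasDerivAt (fun t : ℝ => mgfPartial ν [i] J s (t • φ) θ)
      (∑ j, (Complex.I * φ j) * mgfPartial ν [i] (j :: J) s (t • φ) θ) t := by
  have hev : ∀ᶠ q : ℝ × ℝ in 𝓝 (t, 0),
      (s, θ + q.2 • (basisVec i : Vec p)) ∈ interior (mgfDomain Θ ν) := by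
    have hc : ContinuousAt (fun q : ℝ × ℝ => (s, θ + q.2 • (basisVec i : Vec p))) (t, 0) :=
      Continuous.continuousAt (by fun_prop)
    exact hc.eventually_mem (isOpen_interior.mem_nhds (by simpa using h))
  have hJ' : ∀ j : Fin m, (j :: J).length ≤ 5 := fun j => by simp; omega
  -- The growth hypothesis concerns derivatives in s and θ only. The derivative in φ is computed for
  -- the moments at each nearby parameter, and then exchanged with ∂_{θ_i} by continuity of the
  -- mixed derivative.
  have key := hasDerivAt_of_hasDerivAt_comm (x := t)
    (f := fun t τ => mgfPartial ν [] J s (t • φ) (θ + τ • basisVec i))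
    (f₁ := fun t τ => ∑ j, (Complex.I * φ j) *
      mgfPartial ν [] (j :: J) s (t • φ) (θ + τ • basisVec i))
    (f₂ := fun t => mgfPartial ν [i] J s (t • φ) θ)
    (f₁₂ := fun t τ => ∑ j, (Complex.I * φ j) *
      mgfPartial ν [i] (j :: J) s (t • φ) (θ + τ • basisVec i))
    (by
      filter_upwards [hev] with q hq
      have hs := mem_interior_expSet hq
      simp only [mgfPartial_nil_eq _ hs]
      exact hasDerivAt_expMoment_smul hs J φ q.1)
    (Eventually.of_forall fun t => hasLineDerivAt_theta hg h i J (by omega) (t • φ))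
    (by
      filter_upwards [hev] with q hq
      refine HasDerivAt.fun_sum fun j _ => HasDerivAt.const_mul _ ?_
      exact (hasLineDerivAt_theta hg hq i (j :: J) (hJ' j) _).hasDerivAt_add_smul)
    (by
      refine tendsto_finsetSum _ fun j _ => Tendsto.const_mul _ ?_
      have h1 : ContinuousAt (fun r : Vec m × Vec m × Vec p =>
          mgfPartial ν [i] (j :: J) r.1 r.2.1 r.2.2) (s, t • φ, θ + (0 : ℝ) • basisVec i) :=
        continuousAt_theta hg (by simpa using h) i (j :: J) (hJ' j) _
      exact ContinuousAt.comp (x := (t, (0 : ℝ))) (f := fun q : ℝ × ℝ =>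
        ((s, q.1 • φ, θ + q.2 • basisVec i) : Vec m × Vec m × Vec p)) h1
        (Continuous.continuousAt (by fun_prop)))
  simpa using key

/-- Fourth-order Taylor expansion of `∂_{θ_i} M` in the imaginary variable. -/
theorem norm_theta_sub_taylor_le (hg : GrowthBound Θ ν) {s : Vec m} {θ : Vec p}
    (h : (s, θ) ∈ interior (mgfDomain Θ ν)) (i : Fin p) {A : ℝ} {G : ℕ}
    (hA : ∀ J : List (Fin m), J.length = 4 → ∀ φ, ‖mgfPartial ν [i] J s φ θ‖ ≤
      A * (1 + ‖φ‖) ^ G) (hA0 : 0 ≤ A) (φ : Vec m) :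
    ‖mgfPartial ν [i] [] s φ θ - (thetaMoment ν i [] s θ +
      Complex.I * (iterSum (fun j => φ j) (fun J => thetaMoment ν i J s θ) 1 [] : ℝ) -
      ((iterSum (fun j => φ j) (fun J => thetaMoment ν i J s θ) 2 [] : ℝ) : ℂ) / 2 -
      Complex.I * ((iterSum (fun j => φ j) (fun J => thetaMoment ν i J s θ) 3 [] / 6 : ℝ) : ℂ))‖
      ≤ m ^ 4 * A * ‖φ‖ ^ 4 * (1 + ‖φ‖) ^ G := by
  -- The k-th derivative along the ray t ↦ tφ: each differentiation appends one index and one factor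
  -- iφ_j.
  set f : ℕ → ℝ → ℂ := fun k t => iterSum (fun j => Complex.I * (φ j : ℂ))
    (fun J => mgfPartial ν [i] J s (t • φ) θ) k [] with hf
  have hder : ∀ k (J : List (Fin m)), J.length + k ≤ 4 → ∀ t,
      HasDerivAt (fun t : ℝ => iterSum (fun j => Complex.I * (φ j : ℂ))
        (fun J => mgfPartial ν [i] J s (t • φ) θ) k J)
        (iterSum (fun j => Complex.I * (φ j : ℂ))
        (fun J => mgfPartial ν [i] J s (t • φ) θ) (k + 1) J) t := by
    intro k
    induction k with
    | zero => exact fun J hJ t => hasDerivAt_theta_smul hg h i J (by omega) φ t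
    | succ k ih =>
      intro J hJ t
      exact HasDerivAt.fun_sum fun j _ => (ih (j :: J) (by simp; omega) t).const_mul _
  have hφj : ∀ j, ‖Complex.I * (φ j : ℂ)‖ ≤ ‖φ‖ := fun j => by
    rw [norm_mul, Complex.norm_I, one_mul, Complex.norm_real]
    exact PiLp.norm_apply_le φ j
  have hT := norm_sub_taylor_four_le (f := f) (C := m ^ 4 * A * ‖φ‖ ^ 4 * (1 + ‖φ‖) ^ G)
    (fun k hk t _ => hder k [] (by simp; omega) t)
    (fun t ht => by
      have := norm_iterSum_le (R := ℂ) (c := fun j => Complex.I * (φ j : ℂ))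
        (a := fun J => mgfPartial ν [i] J s (t • φ) θ) (A := A * (1 + ‖φ‖) ^ G) hφj
        (norm_nonneg _) 4 [] (fun J hJ => (hA J (by simpa using hJ) _).trans (by
          gcongr
          rw [norm_smul, Real.norm_of_nonneg ht.1]
          have := norm_nonneg φ
          nlinarith [ht.2]))
      refine this.trans (le_of_eq ?_)
      ring)
  have h0 : ∀ k ≤ 3, f k 0 = Complex.I ^ k *
      (iterSum (fun j => φ j) (fun J => thetaMoment ν i J s θ) k [] : ℝ) := by
    intro k hk
    rw [← iterSum_I_mul]
    have aux : ∀ k (J : List (Fin m)), J.length + k ≤ 3 →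
        iterSum (fun j => Complex.I * (φ j : ℂ))
          (fun J => mgfPartial ν [i] J s ((0 : ℝ) • φ) θ) k J =
        iterSum (fun j => Complex.I * (φ j : ℂ)) (fun J => (thetaMoment ν i J s θ : ℂ)) k J := by
      intro k
      induction k with
      | zero =>
        intro J hJ
        simp only [iterSum, zero_smul]
        exact (ofReal_thetaMoment hg h i J (by omega)).1
      | succ k ih =>
        intro J hJ
        simp only [iterSum]
        exact Finset.sum_congr rfl fun j _ => by rw [ih (j :: J) (by simp; omega)]
    exact aux k [] (by simpa using hk)
  rw [h0 0 (by norm_num), h0 1 (by norm_num), h0 2 (by norm_num), h0 3 (by norm_num)] at hT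
  have e1 : f 0 1 = mgfPartial ν [i] [] s φ θ := by simp [hf, iterSum]
  have hI3 : Complex.I ^ 3 = -Complex.I := by rw [pow_succ, Complex.I_sq]; ring
  rw [e1, hI3, Complex.I_sq] at hT
  refine le_trans (le_of_eq ?_) hT
  congr 1
  simp only [iterSum]
  push_cast
  ring

end Regularity

/-! ### Fourier inversion for finite measures -/

section Inversion

open FourierTransform SchwartzMap

variable {V : Type*} [NormedAddCommGroup V] [InnerProductSpace ℝ V] [FiniteDimensional ℝ V]
  [MeasurableSpace V] [BorelSpace V] {τ : Measure V}

/-- Fubini for the Fourier kernel, with Lebesgue measure on one side and τ on the other. The sign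
and the 2π translate between the conventions for `𝓕` and for `charFun`. -/
theorem integral_fourier_measure [IsFiniteMeasure τ] {h : V → ℂ} (hh : Integrable h) :
    ∫ x, 𝓕 h x ∂τ = ∫ ξ, h ξ * charFun τ (-((2 * Real.pi) • ξ)) := by
  have key := VectorFourier.integral_fourierIntegral_smul_eq_flip (μ := (volume : Measure V))
    (ν := τ) (L := innerₗ V) (f := h) (g := fun _ => (1 : ℂ)) Real.continuous_fourierChar
    (by simpa using continuous_inner) hh (integrable_const _)
  simp only [smul_eq_mul, mul_one] at key
  rw [show (fun x => 𝓕 h x) = VectorFourier.fourierIntegral Real.fourierChar volume (innerₗ V) h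
    from rfl, key]
  refine integral_congr_ae (Eventually.of_forall fun ξ => ?_)
  simp only [VectorFourier.fourierIntegral, charFun_apply]
  congr 1
  refine integral_congr_ae (Eventually.of_forall fun x => ?_)
  simp only [Circle.smul_def, smul_eq_mul, mul_one, Real.fourierChar_apply]
  congr 1
  rw [LinearMap.flip_apply, innerₗ_apply_apply, inner_neg_right, inner_smul_right,
    real_inner_comm]
  push_cast
  ring

/-- Write g as the transform of its inverse transform and move the transform across twice, first
onto τ and then onto Lebesgue measure. -/
theorem integral_schwartz_eq [IsFiniteMeasure τ]
    (hκ : Integrable fun ξ : V => charFun τ ((2 * Real.pi) • ξ)) (g : 𝓢(V, ℂ)) :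
    ∫ x, g x ∂τ = ∫ x, g x * 𝓕 (fun ξ : V => charFun τ ((2 * Real.pi) • ξ)) x := by
  have h1 : ∫ x, g x ∂τ = ∫ x, 𝓕 (⇑(𝓕⁻ g : 𝓢(V, ℂ))) x ∂τ := by
    rw [← SchwartzMap.fourier_coe, FourierTransform.fourier_fourierInv_eq]
  rw [h1, integral_fourier_measure (SchwartzMap.integrable _),
    ← integral_neg_eq_self (fun ξ => (𝓕⁻ g : 𝓢(V, ℂ)) ξ * charFun τ (-((2 * Real.pi) • ξ)))]
  have h2 : ∀ ξ : V, (𝓕⁻ g : 𝓢(V, ℂ)) (-ξ) = 𝓕 (⇑g) ξ := fun ξ => by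
    rw [SchwartzMap.fourierInv_coe, Real.fourierInv_eq_fourier_neg, neg_neg]
  simp only [h2, smul_neg, neg_neg]
  have key := VectorFourier.integral_fourierIntegral_smul_eq_flip (μ := (volume : Measure V))
    (ν := (volume : Measure V)) (L := innerₗ V) (f := g)
    (g := fun ξ : V => charFun τ ((2 * Real.pi) • ξ)) Real.continuous_fourierChar
    (by simpa using continuous_inner) g.integrable hκ
  rw [flip_innerₗ] at key
  exact key

/-- A finite measure with integrable characteristic function has a continuous density, given by
Fourier inversion. -/
theorem exists_density_of_integrable_charFun [IsFiniteMeasure τ]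
    (hκ : Integrable fun ξ : V => charFun τ ((2 * Real.pi) • ξ)) :
    Continuous (fun x => (𝓕 (fun ξ : V => charFun τ ((2 * Real.pi) • ξ)) x).re) ∧
    (∀ x, 0 ≤ (𝓕 (fun ξ : V => charFun τ ((2 * Real.pi) • ξ)) x).re) ∧
    τ = volume.withDensity (fun x =>
      ENNReal.ofReal (𝓕 (fun ξ : V => charFun τ ((2 * Real.pi) • ξ)) x).re) := by
  set κ := fun ξ : V => charFun τ ((2 * Real.pi) • ξ) with hκdef
  have hFc : Continuous (𝓕 κ) := VectorFourier.fourierIntegral_continuous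
    Real.continuous_fourierChar (by simpa using continuous_inner) hκ
  have hfc : Continuous fun x => (𝓕 κ x).re := Complex.continuous_re.comp hFc
  -- Against smooth compactly supported functions the inverse transform already acts as a density of
  -- τ.
  have htest : ∀ g : V → ℝ, ContDiff ℝ ((⊤ : ℕ∞) : WithTop ℕ∞) g → HasCompactSupport g →
      ∫ x, g x ∂τ = ∫ x, g x * (𝓕 κ x).re := by
    intro g hg hgs
    have hgs' : HasCompactSupport fun x => (g x : ℂ) := hgs.comp_left (g := Complex.ofReal) Complex.ofReal_zero
    have hg' : ContDiff ℝ ((⊤ : ℕ∞) : WithTop ℕ∞) fun x => (g x : ℂ) :=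
      Complex.ofRealCLM.contDiff.comp hg
    have h1 : ∫ x, (g x : ℂ) ∂τ = ∫ x, (g x : ℂ) * 𝓕 κ x :=
      integral_schwartz_eq hκ (hgs'.toSchwartzMap hg')
    have h2 := congrArg Complex.re h1
    rw [integral_complex_ofReal, Complex.ofReal_re] at h2
    rw [h2]
    have hint : Integrable fun x => (g x : ℂ) * 𝓕 κ x :=
      (hg'.continuous.mul hFc).integrable_of_hasCompactSupport hgs'.mul_right
    have h3 := integral_re hint
    simp only [RCLike.re_to_complex, Complex.re_ofReal_mul] at h3
    exact h3.symm
  have hreal : ∀ x, (𝓕 κ x).im = 0 := by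
    intro x
    rw [← Complex.conj_eq_iff_im, Real.fourier_eq', ← integral_conj, ← integral_neg_eq_self]
    refine integral_congr_ae (Eventually.of_forall fun ξ => ?_)
    simp only [hκdef, smul_neg, charFun_neg, smul_eq_mul, map_mul, Complex.conj_conj,
      inner_neg_left, ← Complex.exp_conj, Complex.conj_ofReal, Complex.conj_I]
    congr 2
    push_cast
    ring
  -- Where the candidate density were negative, a bump function supported there would have a
  -- negative integral against τ.
  have hnn : ∀ x, 0 ≤ (𝓕 κ x).re := by
    intro x
    by_contra! hx
    obtain ⟨g, hgsub, hgs, hg, hgr, hgx⟩ := exists_contDiff_tsupport_subset (n := ⊤)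
      ((isOpen_lt hfc continuous_const).mem_nhds hx)
    have hg0 : ∀ y, 0 ≤ g y := fun y => (hgr ⟨y, rfl⟩).1
    have h1 : 0 ≤ ∫ y, g y ∂τ := integral_nonneg hg0
    rw [htest g hg hgs] at h1
    have h2 : 0 < ∫ y, -(g y * (𝓕 κ y).re) := by
      have hc : Continuous fun y => -(g y * (𝓕 κ y).re) := (hg.continuous.mul hfc).neg
      refine Continuous.integral_pos_of_hasCompactSupport_nonneg_nonzero hc ?_ ?_ (x := x) ?_
      · exact (hgs.mul_right (f' := fun y => (𝓕 κ y).re)).neg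
      · intro y
        by_cases hy : y ∈ tsupport g
        · have := hgsub hy
          have h3 : (𝓕 κ y).re < 0 := this
          simp only [Pi.zero_apply]
          nlinarith [hg0 y]
        · simp [image_eq_zero_of_notMem_tsupport hy]
      · rw [hgx]; simpa using hx.ne
    rw [integral_neg] at h2
    linarith
  -- Bump functions equal to 1 on growing balls bound the integrals of the nonnegative density by
  -- the total mass of τ.
  have hfi : Integrable fun x => (𝓕 κ x).re := by
    refine (aecover_closedBall (μ := volume) (x := (0 : V)) tendsto_natCast_atTop_atTop
      ).integrable_of_integral_bounded_of_nonneg_ae (τ.real Set.univ)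
      (fun n => hfc.locallyIntegrable.integrableOn_isCompact (isCompact_closedBall _ _))
      (Eventually.of_forall hnn) (Eventually.of_forall fun n => ?_)
    let b : ContDiffBump (0 : V) := ⟨n + 1, n + 2, by positivity, by linarith⟩
    have hint : Integrable fun x => b x * (𝓕 κ x).re :=
      (b.continuous.mul hfc).integrable_of_hasCompactSupport b.hasCompactSupport.mul_right
    calc ∫ x in Metric.closedBall 0 (n : ℝ), (𝓕 κ x).re
        = ∫ x in Metric.closedBall 0 (n : ℝ), b x * (𝓕 κ x).re := by
          refine setIntegral_congr_fun measurableSet_closedBall fun x hx => ?_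
          have : b x = 1 := b.one_of_mem_closedBall
            (Metric.closedBall_subset_closedBall (by simp [b]) hx)
          simp [this]
      _ ≤ ∫ x, b x * (𝓕 κ x).re := setIntegral_le_integral hint
          (Eventually.of_forall fun x => mul_nonneg b.nonneg (hnn x))
      _ = ∫ x, b x ∂τ := (htest _ b.contDiff b.hasCompactSupport).symm
      _ ≤ ∫ x, 1 ∂τ := by
          refine integral_mono (b.continuous.integrable_of_hasCompactSupport b.hasCompactSupport)
            (integrable_const _) fun x => b.le_one
      _ = τ.real Set.univ := by simp
  refine ⟨hfc, hnn, ?_⟩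
  set σ := volume.withDensity (fun x => ENNReal.ofReal (𝓕 κ x).re) with hσ
  have hσf : IsFiniteMeasure σ := isFiniteMeasure_withDensity_ofReal hfi.2
  have hint : ∀ G : V → ℂ, ∫ x, G x ∂σ = ∫ x, G x * 𝓕 κ x := by
    intro G
    rw [hσ, integral_withDensity_eq_integral_toReal_smul hfc.measurable.ennreal_ofReal (by simp)]
    refine integral_congr_ae (Eventually.of_forall fun x => ?_)
    simp only
    rw [ENNReal.toReal_ofReal (hnn x), Complex.real_smul, mul_comm]
    congr 1
    exact Complex.ext (by simp) (by simp [hreal x])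
  -- The two characteristic functions agree when tested against smooth compactly supported
  -- functions, hence almost everywhere, hence everywhere by continuity; the measures then coincide.
  have hae : (fun ξ : V => charFun τ (-((2 * Real.pi) • ξ))) =ᵐ[volume]
      fun ξ => charFun σ (-((2 * Real.pi) • ξ)) := by
    refine ae_eq_of_integral_contDiff_smul_eq ?_ ?_ fun g hg hgs => ?_
    · exact (continuous_charFun.comp (by fun_prop)).locallyIntegrable
    · exact (continuous_charFun.comp (by fun_prop)).locallyIntegrable
    · have hgs' : HasCompactSupport fun x => (g x : ℂ) := hgs.comp_left (g := Complex.ofReal) Complex.ofReal_zero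
      have hg' : ContDiff ℝ ((⊤ : ℕ∞) : WithTop ℕ∞) fun x => (g x : ℂ) :=
        Complex.ofRealCLM.contDiff.comp hg
      have hgi : Integrable fun x => (g x : ℂ) :=
        hg'.continuous.integrable_of_hasCompactSupport hgs'
      simp only [Complex.real_smul]
      rw [← integral_fourier_measure hgi, ← integral_fourier_measure hgi, hint]
      have h1 := integral_schwartz_eq hκ (𝓕 (hgs'.toSchwartzMap hg'))
      rw [SchwartzMap.fourier_coe] at h1
      exact h1
  have heq := (Continuous.ae_eq_iff_eq volume (continuous_charFun.comp (by fun_prop))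
    (continuous_charFun.comp (by fun_prop))).1 hae
  refine Measure.ext_of_charFun (funext fun t => ?_)
  have := congrFun heq (-((2 * Real.pi)⁻¹ • t))
  have e : -((2 * Real.pi) • -((2 * Real.pi)⁻¹ • t)) = t := by
    rw [smul_neg, neg_neg, smul_smul, mul_inv_cancel₀ (by positivity), one_smul]
  simpa only [Function.comp_apply, e] using this

end Inversion

/-! ### Inversion of the moment generating function along a vertical plane -/

section Density

variable {m : ℕ} {μ : Measure (Vec m)}

theorem fourier_smul_two_pi (F : Vec m → ℂ) (x : Vec m) :
    FourierTransform.fourier (fun ξ : Vec m => F ((2 * Real.pi) • ξ)) x =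
      ((2 * Real.pi) ^ m)⁻¹ • ∫ φ, Complex.exp (-((inner ℝ φ x : ℝ) * Complex.I)) * F φ := by
  rw [Real.fourier_eq']
  have h := Measure.integral_comp_smul (volume : Measure (Vec m))
    (fun φ => Complex.exp (-((inner ℝ φ x : ℝ) * Complex.I)) * F φ) (2 * Real.pi)
  rw [finrank_euclideanSpace_fin, abs_of_nonneg (by positivity)] at h
  rw [← h]
  refine integral_congr_ae (Eventually.of_forall fun ξ => ?_)
  simp only [smul_eq_mul, inner_smul_left, conj_trivial]
  congr 2
  push_cast
  ring

/-- Inversion of the moment generating function along `s + iℝ^m`. -/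
theorem isContDensity_of_integrable_expMoment [IsFiniteMeasure μ] {s : Vec m}
    (hs : s ∈ expSet μ) (hint : Integrable fun φ => expMoment μ [] s φ) :
    IsContDensity μ (fun x => Real.exp (-inner ℝ s x) * (((2 * Real.pi) ^ m)⁻¹ *
      (∫ φ, Complex.exp (-((inner ℝ φ x : ℝ) * Complex.I)) * expMoment μ [] s φ).re)) := by
  -- Weight the law by e^{sx}: the result is finite because s lies in the domain, and its
  -- characteristic function is φ ↦ M(s + iφ). Invert this and remove the weight.
  set w : Vec m → ENNReal := fun x => ENNReal.ofReal (Real.exp (inner ℝ s x)) with hw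
  set τ := μ.withDensity w with hτ
  have hwm : Measurable w := by fun_prop
  have hτf : IsFiniteMeasure τ := isFiniteMeasure_withDensity_ofReal hs.2
  have hchar : ∀ φ, charFun τ φ = expMoment μ [] s φ := by
    intro φ
    rw [charFun_apply, hτ, integral_withDensity_eq_integral_toReal_smul hwm (by simp [hw])]
    refine integral_congr_ae (Eventually.of_forall fun x => ?_)
    simp only [hw]
    rw [ENNReal.toReal_ofReal (Real.exp_nonneg _), Complex.real_smul]
    simp [monomial]
  have hκ : Integrable fun ξ : Vec m => charFun τ ((2 * Real.pi) • ξ) := by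
    simp only [hchar]
    exact hint.comp_smul (by positivity)
  obtain ⟨h1, h2, h3⟩ := exists_density_of_integrable_charFun hκ
  have hF : ∀ x, (FourierTransform.fourier (fun ξ : Vec m => charFun τ ((2 * Real.pi) • ξ)) x).re =
      ((2 * Real.pi) ^ m)⁻¹ *
      (∫ φ, Complex.exp (-((inner ℝ φ x : ℝ) * Complex.I)) * expMoment μ [] s φ).re := by
    intro x
    rw [fourier_smul_two_pi, Complex.smul_re, smul_eq_mul]
    simp only [hchar]
  simp only [hF] at h1 h2 h3
  refine ⟨(by fun_prop : Continuous fun x : Vec m => Real.exp (-inner ℝ s x)).mul h1,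
    fun x => mul_nonneg (Real.exp_nonneg _) (h2 x), ?_⟩
  have h4 : μ = τ.withDensity fun x => ENNReal.ofReal (Real.exp (-inner ℝ s x)) := by
    rw [hτ, ← withDensity_mul _ hwm (by fun_prop)]
    have : (w * fun x => ENNReal.ofReal (Real.exp (-inner ℝ s x))) = 1 := by
      ext x
      simp only [hw, Pi.mul_apply, Pi.one_apply]
      rw [← ENNReal.ofReal_mul (Real.exp_nonneg _), ← Real.exp_add]
      simp
    rw [this, withDensity_one]
  conv_lhs => rw [h4, h3]
  rw [← withDensity_mul _ h1.measurable.ennreal_ofReal (by fun_prop)]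
  congr 1
  ext x
  rw [Pi.mul_apply, ← ENNReal.ofReal_mul (h2 x), mul_comm]

end Density

/-! ### Sums of independent copies -/

section Sum

variable {m p : ℕ} {ν : Vec p → Measure (Vec m)} {n : ℕ} {θ : Vec p}

theorem isProbabilityMeasure_sumLaw [IsProbabilityMeasure (ν θ)] :
    IsProbabilityMeasure (sumLaw ν n θ) :=
  Measure.isProbabilityMeasure_map (by fun_prop)

theorem exp_inner_sum (s : Vec m) (y : Fin n → Vec m) :
    Real.exp (inner ℝ s (∑ i, y i)) = ∏ i, Real.exp (inner ℝ s (y i)) := by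
  rw [inner_sum, Real.exp_sum]

theorem mgf_sumLaw [IsProbabilityMeasure (ν θ)] (s : Vec m) :
    mgf (sumLaw ν n) s θ = mgf ν s θ ^ n := by
  unfold mgf sumLaw
  rw [integral_map (by fun_prop) (by fun_prop)]
  simp only [exp_inner_sum]
  rw [integral_fintype_prod_eq_pow (fun x => Real.exp (inner ℝ s x)), Fintype.card_fin]

theorem expMoment_sumLaw [IsProbabilityMeasure (ν θ)] (s φ : Vec m) :
    expMoment (sumLaw ν n θ) [] s φ = expMoment (ν θ) [] s φ ^ n := by
  unfold expMoment sumLaw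
  rw [integral_map (by fun_prop) (by unfold monomial; fun_prop)]
  simp only [exp_inner_sum, monomial, List.map_nil, List.prod_nil, one_mul, sum_inner,
    Complex.ofReal_prod, Complex.ofReal_sum, Finset.sum_mul, Complex.exp_sum,
    ← Finset.prod_mul_distrib]
  rw [integral_fintype_prod_eq_pow (fun x => ((Real.exp (inner ℝ s x) : ℝ) : ℂ) *
    Complex.exp (((inner ℝ x φ : ℝ) : ℂ) * Complex.I)), Fintype.card_fin]

theorem mgfDomainAt_sumLaw [IsProbabilityMeasure (ν θ)] (hn : 1 ≤ n) :
    mgfDomainAt (sumLaw ν n) θ = mgfDomainAt ν θ := by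
  have hiff : ∀ s : Vec m, Integrable (fun x => Real.exp (inner ℝ s x)) (sumLaw ν n θ) ↔
      Integrable (fun y : Fin n → Vec m => ∏ i, Real.exp (inner ℝ s (y i)))
        (Measure.pi fun _ => ν θ) := by
    intro s
    unfold sumLaw
    rw [integrable_map_measure (by fun_prop) (by fun_prop)]
    simp only [Function.comp_def, exp_inner_sum]
  ext s
  simp only [mgfDomainAt, Set.mem_ofPred_eq, hiff]
  constructor
  · intro h
    -- A non-integrable factor has Bochner integral 0 by convention, so the product integral would
    -- be 0ⁿ = 0 with n ≥ 1, whereas the integral of an integrable exponential is positive.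
    by_contra hcon
    have h1 : (0 : ℝ) < ∫ y : Fin n → Vec m, ∏ i, Real.exp (inner ℝ s (y i))
        ∂(Measure.pi fun _ => ν θ) := by
      have h2 : Integrable (fun y : Fin n → Vec m => Real.exp (∑ i, inner ℝ s (y i)))
          (Measure.pi fun _ => ν θ) := by
        simpa only [Real.exp_sum] using h
      simpa only [Real.exp_sum] using integral_exp_pos h2
    rw [integral_fintype_prod_eq_pow (fun x => Real.exp (inner ℝ s x)), integral_undef hcon,
      Fintype.card_fin, zero_pow (by omega)] at h1
    exact lt_irrefl _ h1
  · exact fun h => Integrable.fintype_prod (f := fun (_ : Fin n) x => Real.exp (inner ℝ s x))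
      fun _ => h

theorem cgf_sumLaw [IsProbabilityMeasure (ν θ)] (s : Vec m) :
    cgf (sumLaw ν n) s θ = n * cgf ν s θ := by
  rw [cgf, mgf_sumLaw, Real.log_pow, cgf]

theorem cgfHess_sumLaw [IsProbabilityMeasure (ν θ)] (s : Vec m) :
    cgfHess (sumLaw ν n) s θ = (n : ℝ) • cgfHess ν s θ := by
  ext i j
  simp only [cgfHess, Matrix.of_apply, Matrix.smul_apply, cgf_sumLaw, lineDeriv,
    deriv_const_mul_field, smul_eq_mul]

theorem isSaddlepoint_sumLaw [IsProbabilityMeasure (ν θ)] (hn : 1 ≤ n) (y s : Vec m) :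
    IsSaddlepoint (sumLaw ν n) θ ((n : ℝ) • y) s ↔ IsSaddlepoint ν θ y s := by
  unfold IsSaddlepoint
  rw [mgfDomainAt_sumLaw hn]
  refine and_congr_right fun _ => ?_
  simp only [cgf_sumLaw, hasGradientWithinAt_iff_hasFDerivWithinAt, map_smulₛₗ, conj_trivial]
  have hn0 : (n : ℝ) ≠ 0 := by positivity
  refine ⟨fun h => ?_, fun h => h.const_mul _⟩
  have := h.const_mul (n : ℝ)⁻¹
  simpa only [smul_smul, inv_mul_cancel₀ hn0, one_smul, inv_mul_cancel_left₀ hn0] using this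

/-- The saddlepoint equations for the sum and for one copy are equal as predicates, so the choice
operator selects the same point. -/
theorem saddlepoint_sumLaw [IsProbabilityMeasure (ν θ)] (hn : 1 ≤ n) (y : Vec m) :
    saddlepoint (sumLaw ν n) θ ((n : ℝ) • y) = saddlepoint ν θ y := by
  have h : (fun s => IsSaddlepoint (sumLaw ν n) θ ((n : ℝ) • y) s) = IsSaddlepoint ν θ y :=
    funext fun s => propext (isSaddlepoint_sumLaw hn y s)
  classical
  have key : ∀ P Q : Vec m → Prop, P = Q → (if h : ∃ s, P s then h.choose else 0) =
      if h : ∃ s, Q s then h.choose else 0 := by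
    rintro P Q rfl
    rfl
  unfold saddlepoint
  convert key _ _ h

theorem isSaddlepoint_saddlepoint {y : Vec m} (h : ∃ s, IsSaddlepoint ν θ y s) :
    IsSaddlepoint ν θ y (saddlepoint ν θ y) := by
  unfold saddlepoint
  rw [dif_pos h]
  exact h.choose_spec

theorem saddleLikelihood_sumLaw [IsProbabilityMeasure (ν θ)] (hn : 1 ≤ n) (y : Vec m) :
    saddleLikelihood (sumLaw ν n) θ ((n : ℝ) • y) =
      Real.exp (n * (cgf ν (saddlepoint ν θ y) θ - inner ℝ (saddlepoint ν θ y) y)) /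
        Real.sqrt ((2 * Real.pi * n) ^ m * (cgfHess ν (saddlepoint ν θ y) θ).det) := by
  unfold saddleLikelihood
  rw [saddlepoint_sumLaw hn, cgfHess_sumLaw, cgf_sumLaw, smul_smul, Matrix.det_smul,
    Fintype.card_fin, inner_smul_right]
  ring_nf

end Sum

/-! ### The cumulant generating function -/

section Cgf

variable {m p : ℕ} {Θ : Set (Vec p)} {ν : Vec p → Measure (Vec m)} {s : Vec m} {θ : Vec p}

theorem realMoment_nil_pos {ρ : Measure (Vec m)} [NeZero ρ] (hs : s ∈ interior (expSet ρ)) :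
    0 < realMoment ρ [] s := by
  have : realMoment ρ [] s = ∫ x, Real.exp (inner ℝ s x) ∂ρ := by simp [realMoment, monomial]
  rw [this]
  exact integral_exp_pos (f := fun x => inner ℝ s x) (interior_subset hs :)

/-- The vector `M'(s;θ) / M(s;θ) = K'(s;θ)`. -/
def meanVec (ν : Vec p → Measure (Vec m)) (s : Vec m) (θ : Vec p) : Vec m :=
  WithLp.toLp 2 fun j => realMoment (ν θ) [j] s / realMoment (ν θ) [] s

theorem inner_basisVec (v : Vec m) (j : Fin m) : inner ℝ v (basisVec j) = v j := by
  simp [EuclideanSpace.inner_single_right]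

theorem eq_inner_of_basisVec {L : Vec m →L[ℝ] ℝ} {v : Vec m} (h : ∀ j, L (basisVec j) = v j) :
    L = InnerProductSpace.toDual ℝ (Vec m) v := by
  have h1 : (L : Vec m →ₗ[ℝ] ℝ) = (InnerProductSpace.toDual ℝ (Vec m) v : Vec m →L[ℝ] ℝ) := by
    refine (EuclideanSpace.basisFun (Fin m) ℝ).toBasis.ext fun j => ?_
    simpa [← inner_basisVec] using h j
  exact ContinuousLinearMap.coe_injective h1

/-- In `s`, the moments are differentiable with gradient given by the moments of higher order. -/
theorem hasFDerivAt_realMoment (hg : GrowthBound Θ ν) (h : (s, θ) ∈ interior (mgfDomain Θ ν))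
    (J : List (Fin m)) (hJ : J.length ≤ 5) :
    HasFDerivAt (realMoment (ν θ) J)
      (InnerProductSpace.toDual ℝ (Vec m)
        (WithLp.toLp 2 fun j => realMoment (ν θ) (j :: J) s : Vec m)) s := by
  obtain ⟨L, hL, hLs, -⟩ := exists_hasStrictFDerivAt_realMoment hg h J hJ
  have h1 : HasFDerivAt (fun s' : Vec m => (s', θ)) (ContinuousLinearMap.inl ℝ (Vec m) (Vec p)) s :=
    hasFDerivAt_prodMk_left s θ
  have h2 := HasFDerivAt.comp s (g := fun q : Vec m × Vec p => realMoment (ν q.2) J q.1)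
    hL.hasFDerivAt h1
  rw [← eq_inner_of_basisVec (L := L.comp (ContinuousLinearMap.inl ℝ (Vec m) (Vec p)))]
  · exact h2
  · intro j
    simpa using hLs j

theorem cgf_eq : cgf ν s θ = Real.log (realMoment (ν θ) [] s) := by
  rw [cgf, mgf_eq_realMoment]

theorem hasGradientAt_cgf [IsProbabilityMeasure (ν θ)] (hg : GrowthBound Θ ν)
    (h : (s, θ) ∈ interior (mgfDomain Θ ν)) :
    HasGradientAt (fun s' => cgf ν s' θ) (meanVec ν s θ) s := by
  have hpos := realMoment_nil_pos (mem_interior_expSet h)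
  have h1 := (hasFDerivAt_realMoment hg h [] (by simp)).log hpos.ne'
  simp only [cgf_eq]
  rw [hasGradientAt_iff_hasFDerivAt]
  rw [show InnerProductSpace.toDual ℝ (Vec m) (meanVec ν s θ) = (realMoment (ν θ) [] s)⁻¹ •
    InnerProductSpace.toDual ℝ (Vec m)
        (WithLp.toLp 2 fun j => realMoment (ν θ) [j] s : Vec m) from ?_]
  · exact h1
  symm
  have := eq_inner_of_basisVec (m := m) (v := meanVec ν s θ) (L := (realMoment (ν θ) [] s)⁻¹ •
    InnerProductSpace.toDual ℝ (Vec m)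
        (WithLp.toLp 2 fun j => realMoment (ν θ) [j] s : Vec m)) (by
      intro j
      simp [meanVec, inner_basisVec, inv_mul_eq_div])
  exact this

/-- At an interior point the derivative within the domain is the ordinary one, so it is unique and
equals the tilted mean. -/
theorem isSaddlepoint_iff [IsProbabilityMeasure (ν θ)] (hg : GrowthBound Θ ν)
    (h : (s, θ) ∈ interior (mgfDomain Θ ν)) (y : Vec m) :
    IsSaddlepoint ν θ y s ↔ meanVec ν s θ = y := by
  have h0 : s ∈ mgfDomainAt ν θ := (interior_subset h).2
  have hn : mgfDomainAt ν θ ∈ 𝓝 s :=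
    mem_of_superset (isOpen_interior.mem_nhds (mem_interior_expSet h)) interior_subset
  have h1 := hasGradientAt_cgf hg h
  constructor
  · rintro ⟨-, h2⟩
    rw [hasGradientWithinAt_iff_hasFDerivWithinAt] at h2
    exact h1.unique (hasGradientAt_iff_hasFDerivAt.2 (h2.hasFDerivAt hn))
  · rintro rfl
    exact ⟨h0, (hasGradientAt_iff_hasFDerivAt.1 h1).hasFDerivWithinAt⟩

theorem cgfHess_apply [IsProbabilityMeasure (ν θ)] (hg : GrowthBound Θ ν)
    (h : (s, θ) ∈ interior (mgfDomain Θ ν)) (i j : Fin m) :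
    cgfHess ν s θ i j = realMoment (ν θ) [i, j] s / realMoment (ν θ) [] s -
      realMoment (ν θ) [i] s * realMoment (ν θ) [j] s / realMoment (ν θ) [] s ^ 2 := by
  have hpos := realMoment_nil_pos (mem_interior_expSet h)
  have hev : (fun s' => lineDeriv ℝ (fun s'' => cgf ν s'' θ) s' (basisVec j)) =ᶠ[𝓝 s]
      fun s' => realMoment (ν θ) [j] s' / realMoment (ν θ) [] s' := by
    have hc : ∀ᶠ s' in 𝓝 s, (s', θ) ∈ interior (mgfDomain Θ ν) :=
      (Continuous.continuousAt (by fun_prop : Continuous fun s' : Vec m => (s', θ))).eventually_mem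
        (isOpen_interior.mem_nhds h)
    filter_upwards [hc] with s' hs'
    have h1 := (hasGradientAt_iff_hasFDerivAt.1 (hasGradientAt_cgf hg hs')).hasLineDerivAt
      (basisVec j)
    rw [h1.lineDeriv]
    simp [meanVec, inner_basisVec]
  simp only [cgfHess, Matrix.of_apply]
  have hJ := hasLineDerivAt_realMoment (mem_interior_expSet h) [j] i
  have h0 := hasLineDerivAt_realMoment (mem_interior_expSet h) [] i
  unfold HasLineDerivAt at hJ h0
  have hq := hJ.fun_div h0 (by simpa using hpos.ne')
  have hq' : HasLineDerivAt ℝ (fun s' => realMoment (ν θ) [j] s' / realMoment (ν θ) [] s')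
    _ s (basisVec i) := hq
  rw [(hq'.congr_of_eventuallyEq hev).lineDeriv]
  simp only [zero_smul, add_zero]
  field_simp

end Cgf

/-! ### Exponential tilting -/

section Tilt

variable {m p : ℕ} {Θ : Set (Vec p)} {ν : Vec p → Measure (Vec m)} {s : Vec m} {θ : Vec p}

/-- The tilted law with density `exp (s x) / M(s;θ)`. -/
def tilt (ν : Vec p → Measure (Vec m)) (s : Vec m) (θ : Vec p) : Measure (Vec m) :=
  (ν θ).tilted fun x => inner ℝ s x

theorem isProbabilityMeasure_tilt [IsProbabilityMeasure (ν θ)]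
    (h : (s, θ) ∈ interior (mgfDomain Θ ν)) : IsProbabilityMeasure (tilt ν s θ) :=
  isProbabilityMeasure_tilted (interior_subset h).2

theorem integral_tilt {E : Type*} [NormedAddCommGroup E] [NormedSpace ℝ E] (g : Vec m → E) :
    ∫ x, g x ∂(tilt ν s θ) =
      (realMoment (ν θ) [] s)⁻¹ • ∫ x, Real.exp (inner ℝ s x) • g x ∂(ν θ) := by
  unfold tilt
  rw [integral_tilted, ← integral_smul]
  refine integral_congr_ae (Eventually.of_forall fun x => ?_)
  simp only [realMoment, monomial, List.map_nil, List.prod_nil, one_mul, smul_smul]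
  congr 1
  ring

theorem integral_monomial_tilt (J : List (Fin m)) :
    ∫ x, monomial J x ∂(tilt ν s θ) = realMoment (ν θ) J s / realMoment (ν θ) [] s := by
  rw [integral_tilt, smul_eq_mul, inv_mul_eq_div]
  simp only [realMoment, smul_eq_mul, mul_comm]

theorem integrable_monomial_tilt (h : (s, θ) ∈ interior (mgfDomain Θ ν)) (J : List (Fin m)) :
    Integrable (monomial J) (tilt ν s θ) := by
  unfold tilt
  rw [integrable_tilted_iff (interior_subset h).2]
  simpa only [smul_eq_mul, mul_comm] using integrable_monomial_mul_exp (mem_interior_expSet h) J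

theorem integral_cexp_tilt (φ : Vec m) :
    ∫ x, Complex.exp ((inner ℝ x φ : ℝ) * Complex.I) ∂(tilt ν s θ) =
      mgfC ν s φ θ / (mgf ν s θ : ℂ) := by
  rw [integral_tilt, mgfC_eq_expMoment, mgf_eq_realMoment, expMoment, Complex.real_smul,
    div_eq_inv_mul, Complex.ofReal_inv]
  simp [monomial]

theorem integrable_weight_tilt (h : (s, θ) ∈ interior (mgfDomain Θ ν)) (y : Vec m) (k : ℕ) :
    Integrable (fun x => (1 + ‖y‖ + ‖x‖) ^ k) (tilt ν s θ) := by
  unfold tilt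
  rw [integrable_tilted_iff (interior_subset h).2]
  refine ((integrable_pow_mul_exp (mem_interior_expSet h) k).const_mul ((1 + ‖y‖) ^ k)).mono'
    (Continuous.aestronglyMeasurable (by fun_prop)) (Eventually.of_forall fun x => ?_)
  rw [norm_smul, Real.norm_of_nonneg (Real.exp_nonneg _), Real.norm_of_nonneg (by positivity),
    ← mul_assoc, ← mul_pow, mul_comm]
  gcongr
  nlinarith [norm_nonneg x, norm_nonneg y, mul_nonneg (norm_nonneg x) (norm_nonneg y)]

theorem integrable_inner_tilt (h : (s, θ) ∈ interior (mgfDomain Θ ν)) (y w : Vec m)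
    [IsProbabilityMeasure (ν θ)] : Integrable (fun x => inner ℝ (x - y) w) (tilt ν s θ) :=
  have := isProbabilityMeasure_tilt h
  integrable_inner_sub (integrable_weight_tilt h y 5) w

/-- The tilted law has mean K'(s). At the saddlepoint this mean is y, which is the centring assumed
in the Fourier estimates. -/
theorem integral_inner_tilt [IsProbabilityMeasure (ν θ)]
    (h : (s, θ) ∈ interior (mgfDomain Θ ν)) (w : Vec m) :
    ∫ x, inner ℝ (x - meanVec ν s θ) w ∂(tilt ν s θ) = 0 := by
  have := isProbabilityMeasure_tilt h
  have h1 : ∀ x : Vec m, inner ℝ (x - meanVec ν s θ) w =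
      ∑ j, w j * (monomial [j] x - meanVec ν s θ j) := fun x => by
    simp [PiLp.inner_apply, monomial]
  simp only [h1]
  have h2 : ∀ j, Integrable (fun x => w j * (monomial [j] x - meanVec ν s θ j)) (tilt ν s θ) :=
    fun j => ((integrable_monomial_tilt h [j]).sub (integrable_const _)).const_mul _
  rw [integral_finsetSum _ fun j _ => h2 j]
  refine Finset.sum_eq_zero fun j _ => ?_
  rw [integral_const_mul, integral_sub (integrable_monomial_tilt h [j]) (integrable_const _),
    integral_monomial_tilt]
  simp [meanVec]

theorem norm_integral_cexp_tilt_le {δ : ℝ}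
    (hδ : ∀ φ : Vec m, ‖mgfC ν s φ θ / (mgf ν s θ : ℂ)‖ ≤ (1 + δ * ‖φ‖ ^ 2) ^ (-δ)) (φ : Vec m) :
    ‖∫ x, Complex.exp ((inner ℝ x φ : ℝ) * Complex.I) ∂(tilt ν s θ)‖ ≤ env δ φ := by
  rw [integral_cexp_tilt]
  exact hδ φ

/-- The saddlepoint equation has at most one solution in the interior of the domain. -/
theorem meanVec_injective [IsProbabilityMeasure (ν θ)] {s' : Vec m}
    (h : (s, θ) ∈ interior (mgfDomain Θ ν)) (h' : (s', θ) ∈ interior (mgfDomain Θ ν))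
    (hd : DecayBound Θ ν) (heq : meanVec ν s θ = meanVec ν s' θ) : s = s' := by
  obtain ⟨δ, -, hδ⟩ := hd
  obtain ⟨hδ0, hδd⟩ := hδ s θ h
  have := isProbabilityMeasure_tilt h
  set y := meanVec ν s θ with hy
  set d := s' - s with hddef
  have e1 : ∫ x, Real.exp (inner ℝ s x) * inner ℝ (x - y) d ∂(ν θ) = 0 := by
    have := integral_inner_tilt h d
    rw [integral_tilt, smul_eq_zero] at this
    exact this.resolve_left (inv_ne_zero (realMoment_nil_pos (mem_interior_expSet h)).ne')
  have e2 : ∫ x, Real.exp (inner ℝ s' x) * inner ℝ (x - y) d ∂(ν θ) = 0 := by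
    have := integral_inner_tilt h' d
    rw [integral_tilt, smul_eq_zero, ← heq] at this
    exact this.resolve_left (inv_ne_zero (realMoment_nil_pos (mem_interior_expSet h')).ne')
  have i1 : Integrable (fun x => Real.exp (inner ℝ s x) * inner ℝ (x - y) d) (ν θ) :=
    (integrable_tilted_iff (interior_subset h).2 _).1 (integrable_inner_tilt h y d)
  have i2 : Integrable (fun x => Real.exp (inner ℝ s' x) * inner ℝ (x - y) d) (ν θ) :=
    (integrable_tilted_iff (interior_subset h').2 _).1 (integrable_inner_tilt h' y d)
  set c := Real.exp (-inner ℝ y d) with hc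
  -- Subtract the two mean equations tested on d = s' - s, with the second rescaled by c. With u =
  -- (x - y)·d the integrand is e^{sx}(e^u - 1)u ≥ 0, so u = 0 almost surely; by nondegeneracy of
  -- the variance, d = 0.
  have e3 : ∫ x, (c * (Real.exp (inner ℝ s' x) * inner ℝ (x - y) d) -
      Real.exp (inner ℝ s x) * inner ℝ (x - y) d) ∂(ν θ) = 0 := by
    rw [integral_sub (i2.const_mul c) i1, integral_const_mul, e1, e2]; simp
  have e4 : ∀ x : Vec m, c * (Real.exp (inner ℝ s' x) * inner ℝ (x - y) d) -
      Real.exp (inner ℝ s x) * inner ℝ (x - y) d =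
      Real.exp (inner ℝ s x) * ((Real.exp (inner ℝ (x - y) d) - 1) * inner ℝ (x - y) d) := by
    intro x
    have : c * Real.exp (inner ℝ s' x) =
        Real.exp (inner ℝ s x) * Real.exp (inner ℝ (x - y) d) := by
      rw [hc, ← Real.exp_add, ← Real.exp_add]
      congr 1
      rw [inner_sub_left, hddef, inner_sub_right x, real_inner_comm x s', real_inner_comm x s]
      ring
    linear_combination inner ℝ (x - y) d * this
  simp only [e4] at e3
  have e5 : ∀ u : ℝ, 0 ≤ (Real.exp u - 1) * u := fun u => by
    rcases le_total 0 u with hu | hu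
    · exact mul_nonneg (by linarith [Real.add_one_le_exp u]) hu
    · exact mul_nonneg_of_nonpos_of_nonpos (by linarith [Real.exp_le_one_iff.2 hu]) hu
  have e6 := (integral_eq_zero_iff_of_nonneg
    (fun x => mul_nonneg (Real.exp_nonneg _) (e5 _)) (by
      have := (i2.const_mul c).sub i1
      simp only [← e4]
      exact this)).1 e3
  have e7 : ∀ᵐ x ∂(ν θ), inner ℝ (x - y) d = 0 := by
    filter_upwards [e6] with x hx
    simp only [Pi.zero_apply, mul_eq_zero, (Real.exp_pos _).ne', false_or, sub_eq_zero,
      Real.exp_eq_one_iff, or_self] at hx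
    exact hx
  have e8 : ∀ᵐ x ∂(tilt ν s θ), inner ℝ (x - y) d = 0 := tilted_absolutelyContinuous _ _ e7
  have hvar := le_variance hδ0 (integrable_weight_tilt h y 5) le_rfl (integral_inner_tilt h)
    (norm_integral_cexp_tilt_le hδd) d
  have e9 : ∫ x, inner ℝ (x - y) d ^ 2 ∂(tilt ν s θ) = 0 := by
    refine integral_eq_zero_of_ae ?_
    filter_upwards [e8] with x hx
    simp [hx]
  rw [e9] at hvar
  have : ‖d‖ = 0 := by
    by_contra hne
    have : 0 < ‖d‖ := lt_of_le_of_ne (norm_nonneg _) (Ne.symm hne)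
    have : 0 < 2 * δ (s, θ) ^ 2 * ‖d‖ ^ 2 := by positivity
    linarith
  exact (sub_eq_zero.1 (norm_eq_zero.1 this)).symm

end Tilt

/-! ### Dependence of the saddlepoint on the data and the parameter -/

section Implicit

variable {m p : ℕ} {Θ : Set (Vec p)} {ν : Vec p → Measure (Vec m)} {s : Vec m} {θ : Vec p}

/-- `∫ x^J` under the tilted law. -/
def tiltMoment (ν : Vec p → Measure (Vec m)) (J : List (Fin m)) (s : Vec m) (θ : Vec p) : ℝ :=
  realMoment (ν θ) J s / realMoment (ν θ) [] s

theorem integral_inner_mul_monomial_tilt [IsProbabilityMeasure (ν θ)]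
    (h : (s, θ) ∈ interior (mgfDomain Θ ν)) (y w : Vec m) (J : List (Fin m)) :
    ∫ x, inner ℝ (x - y) w * monomial J x ∂(tilt ν s θ) =
      ∑ k, w k * (tiltMoment ν (k :: J) s θ - y k * tiltMoment ν J s θ) := by
  have h1 : ∀ x : Vec m, inner ℝ (x - y) w * monomial J x =
      ∑ k, w k * (monomial (k :: J) x - y k * monomial J x) := fun x => by
    simp only [PiLp.inner_apply, monomial_cons, Finset.sum_mul, PiLp.sub_apply,
      RCLike.inner_apply, conj_trivial]
    exact Finset.sum_congr rfl fun k _ => by ring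
  have h2 : ∀ k, Integrable (fun x => w k * (monomial (k :: J) x - y k * monomial J x))
      (tilt ν s θ) :=
    fun k => ((integrable_monomial_tilt h _).sub
      ((integrable_monomial_tilt h _).const_mul _)).const_mul _
  simp only [h1]
  rw [integral_finsetSum _ fun k _ => h2 k]
  refine Finset.sum_congr rfl fun k _ => ?_
  rw [integral_const_mul, integral_sub (integrable_monomial_tilt h _)
    ((integrable_monomial_tilt h _).const_mul _), integral_const_mul, integral_monomial_tilt,
    integral_monomial_tilt, tiltMoment, tiltMoment]

theorem eq_sum_basisVec (w : Vec m) : w = ∑ k, w k • basisVec k := by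
  have h := (EuclideanSpace.basisFun (Fin m) ℝ).sum_repr w
  simpa using h.symm

/-- The moments of the tilted law are jointly strictly differentiable. -/
theorem exists_hasStrictFDerivAt_tiltMoment [IsProbabilityMeasure (ν θ)] (hg : GrowthBound Θ ν)
    (h : (s, θ) ∈ interior (mgfDomain Θ ν)) (J : List (Fin m)) (hJ : J.length ≤ 5) :
    ∃ Q : Vec m × Vec p →L[ℝ] ℝ,
      HasStrictFDerivAt (fun q : Vec m × Vec p => tiltMoment ν J q.1 q.2) Q (s, θ) ∧
      (∀ w, Q (w, 0) = ∫ x, inner ℝ (x - meanVec ν s θ) w * monomial J x ∂(tilt ν s θ)) ∧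
      ∀ i, Q (0, basisVec i) = thetaMoment ν i J s θ / realMoment (ν θ) [] s -
        thetaMoment ν i [] s θ / realMoment (ν θ) [] s * tiltMoment ν J s θ := by
  have hpos := (realMoment_nil_pos (mem_interior_expSet h)).ne'
  obtain ⟨R, hR, hRs, hRt⟩ := exists_hasStrictFDerivAt_realMoment hg h J hJ
  obtain ⟨R₀, hR₀, hRs₀, hRt₀⟩ := exists_hasStrictFDerivAt_realMoment hg h [] (by simp)
  have hQ := hR.mul ((hasStrictDerivAt_inv hpos).comp_hasStrictFDerivAt (s, θ)
    (f := fun q : Vec m × Vec p => realMoment (ν q.2) [] q.1) hR₀)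
  simp only [Function.comp_def] at hQ
  refine ⟨_, hQ, fun w => ?_, fun i => ?_⟩
  · rw [integral_inner_mul_monomial_tilt h]
    have e : ∀ L : Vec m × Vec p →L[ℝ] ℝ, L (w, 0) = ∑ k, w k * L (basisVec k, 0) := by
      intro L
      have e1 := congrArg (L.comp (ContinuousLinearMap.inl ℝ (Vec m) (Vec p))) (eq_sum_basisVec w)
      rw [map_sum] at e1
      simpa using e1
    simp only [_root_.smul_apply, _root_.add_apply, e R, e R₀, hRs, hRs₀,
      smul_eq_mul, Finset.mul_sum, ← Finset.sum_add_distrib]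
    refine Finset.sum_congr rfl fun k _ => ?_
    simp only [tiltMoment, meanVec]
    field_simp
    ring
  · simp only [_root_.smul_apply, _root_.add_apply, hRt, hRt₀, smul_eq_mul, tiltMoment]
    field_simp
    ring

theorem integral_inner_mul_inner_tilt [IsProbabilityMeasure (ν θ)]
    (h : (s, θ) ∈ interior (mgfDomain Θ ν)) (y w v : Vec m) :
    ∫ x, inner ℝ (x - y) w * inner ℝ x v ∂(tilt ν s θ) =
      ∑ j, v j * ∫ x, inner ℝ (x - y) w * monomial [j] x ∂(tilt ν s θ) := by
  have hi : ∀ j, Integrable (fun x => inner ℝ (x - y) w * monomial [j] x) (tilt ν s θ) := by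
    intro j
    have := isProbabilityMeasure_tilt h
    have h1 : ∀ x : Vec m, inner ℝ (x - y) w * monomial [j] x =
        ∑ k, w k * (monomial [k, j] x - y k * monomial [j] x) := fun x => by
      simp only [PiLp.inner_apply, monomial_cons, Finset.sum_mul, PiLp.sub_apply,
        RCLike.inner_apply, conj_trivial]
      exact Finset.sum_congr rfl fun k _ => by ring
    simp only [h1]
    exact integrable_finsetSum _ fun k _ => ((integrable_monomial_tilt h _).sub
      ((integrable_monomial_tilt h _).const_mul _)).const_mul _
  simp only [← integral_const_mul]
  rw [← integral_finsetSum _ fun j _ => (hi j).const_mul _]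
  refine integral_congr_ae (Eventually.of_forall fun x => ?_)
  simp only [PiLp.inner_apply x v, RCLike.inner_apply, conj_trivial, Finset.mul_sum, monomial,
    List.map_cons, List.map_nil, List.prod_cons, List.prod_nil, mul_one]
  exact Finset.sum_congr rfl fun j _ => by ring

/-- The variance of the tilted law is nondegenerate. -/
theorem le_variance_tilt [IsProbabilityMeasure (ν θ)]
    (h : (s, θ) ∈ interior (mgfDomain Θ ν)) {δ : ℝ} (hδ : 0 < δ)
    (hδd : ∀ φ : Vec m, ‖mgfC ν s φ θ / (mgf ν s θ : ℂ)‖ ≤ (1 + δ * ‖φ‖ ^ 2) ^ (-δ)) (w : Vec m) :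
    2 * δ ^ 2 * ‖w‖ ^ 2 ≤
      ∫ x, inner ℝ (x - meanVec ν s θ) w * inner ℝ x w ∂(tilt ν s θ) := by
  have := isProbabilityMeasure_tilt h
  have hw := integrable_weight_tilt h (meanVec ν s θ) 5
  refine (le_variance hδ hw le_rfl (integral_inner_tilt h)
    (norm_integral_cexp_tilt_le hδd) w).trans (le_of_eq ?_)
  -- Centring only one of the two factors suffices, since the difference is a multiple of the
  -- vanishing first moment.
  have h1 : ∀ x : Vec m, inner ℝ (x - meanVec ν s θ) w * inner ℝ x w =
      inner ℝ (x - meanVec ν s θ) w ^ 2 +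
        inner ℝ (meanVec ν s θ) w * inner ℝ (x - meanVec ν s θ) w := fun x => by
    simp only [inner_sub_left]; ring
  simp only [h1]
  have hsq : Integrable (fun x => inner ℝ (x - meanVec ν s θ) w ^ 2) (tilt ν s θ) := by
    refine ((integrable_weight_tilt h (meanVec ν s θ) 2).mul_const (‖w‖ ^ 2)).mono'
      (Continuous.aestronglyMeasurable (by fun_prop)) (Eventually.of_forall fun x => ?_)
    rw [Real.norm_of_nonneg (sq_nonneg _), ← sq_abs, ← mul_pow, mul_comm]
    exact pow_le_pow_left₀ (abs_nonneg _) (abs_inner_sub_le x w) 2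
  rw [integral_add hsq ((integrable_inner_tilt h _ w).const_mul _), integral_const_mul,
    integral_inner_tilt h]
  simp

theorem exists_hasStrictFDerivAt_meanVec [IsProbabilityMeasure (ν θ)] (hg : GrowthBound Θ ν)
    (h : (s, θ) ∈ interior (mgfDomain Θ ν)) :
    ∃ Q : Vec m × Vec p →L[ℝ] Vec m,
      HasStrictFDerivAt (fun q : Vec m × Vec p => meanVec ν q.1 q.2) Q (s, θ) ∧
      (∀ w j, Q (w, 0) j =
        ∫ x, inner ℝ (x - meanVec ν s θ) w * monomial [j] x ∂(tilt ν s θ)) ∧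
      ∀ i j, Q (0, basisVec i) j = thetaMoment ν i [j] s θ / realMoment (ν θ) [] s -
        thetaMoment ν i [] s θ / realMoment (ν θ) [] s * tiltMoment ν [j] s θ := by
  have hQ := fun j => exists_hasStrictFDerivAt_tiltMoment hg h [j] (by simp)
  choose Q hQ hQs hQt using hQ
  refine ⟨(EuclideanSpace.equiv (Fin m) ℝ).symm.toContinuousLinearMap.comp
    (ContinuousLinearMap.pi Q), hasStrictFDerivAt_euclidean.2 fun j => ?_, fun w j => hQs j w,
    fun i j => hQt j i⟩
  exact hQ j

/-- The saddlepoint is strictly differentiable in the data and the parameter; its derivative is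
obtained by differentiating the saddlepoint equation. -/
theorem exists_hasStrictFDerivAt_saddlepoint {y : Vec m} (hν : ∀ θ ∈ Θ, IsProbabilityMeasure (ν θ))
    (hd : DecayBound Θ ν) (hg : GrowthBound Θ ν) (h : (y, θ) ∈ interior (saddleDomain Θ ν)) :
    ∃ (T : Vec m × Vec p →L[ℝ] Vec m) (Q : Vec m × Vec p →L[ℝ] Vec m),
      HasStrictFDerivAt (fun q : Vec m × Vec p => saddlepoint ν q.2 q.1) T (y, θ) ∧
      HasStrictFDerivAt (fun q : Vec m × Vec p => meanVec ν q.1 q.2) Q (saddlepoint ν θ y, θ) ∧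
      ∀ τ, Q (T (0, τ), τ) = 0 := by
  obtain ⟨hθ, hex, hint⟩ := interior_subset h
  have := hν θ hθ
  set s := saddlepoint ν θ y with hs
  have hmean : meanVec ν s θ = y := (isSaddlepoint_iff hg hint y).1 (isSaddlepoint_saddlepoint hex)
  obtain ⟨Q, hQ, hQs, -⟩ := exists_hasStrictFDerivAt_meanVec hg hint
  obtain ⟨δ, hδc, hδ⟩ := hd
  obtain ⟨hδ0, hδd⟩ := hδ s θ hint
  -- If τ = 0 and Q(w, 0) = 0 then the variance in direction w vanishes, which the decay bound
  -- excludes unless w = 0.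
  have hinj : Function.Injective (Q.prod (ContinuousLinearMap.snd ℝ (Vec m) (Vec p))) := by
    rw [injective_iff_map_eq_zero]
    rintro ⟨w, τ⟩ hwτ
    simp only [ContinuousLinearMap.prod_apply, ContinuousLinearMap.coe_snd', Prod.mk_eq_zero]
      at hwτ
    obtain ⟨h1, rfl⟩ := hwτ
    have h2 := le_variance_tilt hint hδ0 hδd w
    rw [integral_inner_mul_inner_tilt hint] at h2
    simp only [← hQs, h1, PiLp.zero_apply, mul_zero, Finset.sum_const_zero] at h2
    have : ‖w‖ ^ 2 ≤ 0 := by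
      by_contra! hc
      have : 0 < 2 * δ (s, θ) ^ 2 * ‖w‖ ^ 2 := by positivity
      linarith
    have : w = 0 := by
      rw [← norm_eq_zero]
      exact pow_eq_zero_iff (two_ne_zero) |>.1 (le_antisymm this (sq_nonneg _))
    simp [this]
  -- The inverse function theorem is applied to (s, θ) ↦ (K'(s;θ), θ), whose local inverse carries
  -- (y, θ) to the saddlepoint together with θ.
  set Φ : Vec m × Vec p → Vec m × Vec p := fun q => (meanVec ν q.1 q.2, q.2) with hΦ
  set e : (Vec m × Vec p) ≃L[ℝ] (Vec m × Vec p) := (LinearEquiv.ofInjectiveEndo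
    (Q.prod (ContinuousLinearMap.snd ℝ (Vec m) (Vec p)) : Vec m × Vec p →ₗ[ℝ] Vec m × Vec p)
    hinj).toContinuousLinearEquiv with he
  have hee : (e : Vec m × Vec p →L[ℝ] Vec m × Vec p) =
      Q.prod (ContinuousLinearMap.snd ℝ (Vec m) (Vec p)) := by
    ext v <;> rfl
  have hΦd : HasStrictFDerivAt Φ (e : Vec m × Vec p →L[ℝ] Vec m × Vec p) (s, θ) := by
    rw [hee]
    exact hQ.prodMk hasStrictFDerivAt_snd
  have hΦ0 : Φ (s, θ) = (y, θ) := by simp [hΦ, hmean]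
  set g := hΦd.localInverse Φ e (s, θ) with hgdef
  have hgd : HasStrictFDerivAt g (e.symm : Vec m × Vec p →L[ℝ] Vec m × Vec p) (y, θ) := by
    rw [← hΦ0]
    exact hΦd.to_localInverse
  have hg0 : g (y, θ) = (s, θ) := by
    rw [← hΦ0]
    exact hΦd.localInverse_apply_image
  have hright : ∀ᶠ q in 𝓝 (y, θ), Φ (g q) = q := by
    rw [← hΦ0]
    exact hΦd.eventually_right_inverse
  have hdom : ∀ᶠ q in 𝓝 (y, θ), g q ∈ interior (mgfDomain Θ ν) :=
    hgd.continuousAt.eventually_mem (isOpen_interior.mem_nhds (by rw [hg0]; exact hint))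
  have hsad : ∀ᶠ q in 𝓝 (y, θ), q ∈ saddleDomain Θ ν := mem_interior_iff_mem_nhds.1 h
  -- The local inverse solves the saddlepoint equation inside the interior, so uniqueness identifies
  -- it with the chosen saddlepoint, provided the latter is also interior. That holds because (y, θ)
  -- is interior to the saddlepoint domain.
  have heq : (fun q : Vec m × Vec p => (g q).1) =ᶠ[𝓝 (y, θ)] fun q => saddlepoint ν q.2 q.1 := by
    filter_upwards [hright, hdom, hsad] with q hq1 hq2 hq3
    obtain ⟨hθ', hex', hint'⟩ := hq3
    have := hν q.2 hθ'
    have e1 : (Φ (g q)).2 = q.2 := congrArg Prod.snd hq1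
    change (g q).2 = q.2 at e1
    have e2 : (Φ (g q)).1 = q.1 := congrArg Prod.fst hq1
    change meanVec ν (g q).1 (g q).2 = q.1 at e2
    have hq2' : ((g q).1, q.2) ∈ interior (mgfDomain Θ ν) := by rw [← e1]; exact hq2
    rw [e1] at e2
    exact meanVec_injective hq2' hint' ⟨δ, hδc, hδ⟩ (e2.trans
      ((isSaddlepoint_iff hg hint' q.1).1 (isSaddlepoint_saddlepoint hex')).symm)
  refine ⟨(ContinuousLinearMap.fst ℝ (Vec m) (Vec p)).comp
    (e.symm : Vec m × Vec p →L[ℝ] Vec m × Vec p), Q,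
    (hasStrictFDerivAt_fst.comp (y, θ) hgd).congr_of_eventuallyEq heq, hQ, fun τ => ?_⟩
  have h1 : e (e.symm (0, τ)) = (0, τ) := e.apply_symm_apply _
  have h2 : ∀ v, e v = (Q v, v.2) := fun v => by
    rw [← ContinuousLinearEquiv.coe_coe, hee]; rfl
  rw [h2] at h1
  have h3 : (e.symm (0, τ)).2 = τ := congrArg Prod.snd h1
  have h4 : Q (e.symm (0, τ)) = 0 := congrArg Prod.fst h1
  have h5 : (((ContinuousLinearMap.fst ℝ (Vec m) (Vec p)).comp
    (e.symm : Vec m × Vec p →L[ℝ] Vec m × Vec p)) (0, τ), τ) = e.symm (0, τ) :=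
    Prod.ext rfl h3.symm
  rw [h5, h4]

end Implicit

/-! ### The gradient of the saddlepoint approximation -/

section Det

variable {m : ℕ} {E : Type*} [NormedAddCommGroup E] [NormedSpace ℝ E]

/-- Jacobi's formula. -/
theorem exists_hasFDerivAt_det {A : E → Matrix (Fin m) (Fin m) ℝ} {A' : Fin m → Fin m → E →L[ℝ] ℝ}
    {x : E} (hA : ∀ i j, HasFDerivAt (fun e => A e i j) (A' i j) x) :
    ∃ D : E →L[ℝ] ℝ, HasFDerivAt (fun e => (A e).det) D x ∧
      ∀ v, D v = ((A x).adjugate * Matrix.of fun i j => A' i j v).trace := by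
  -- The determinant is multilinear in the rows; its derivative replaces one row at a time, and
  -- Cramer's rule turns these determinants into the adjugate.
  let f : ContinuousMultilinearMap ℝ (fun _ : Fin m => Fin m → ℝ) ℝ :=
    { toMultilinearMap := (Matrix.detRowAlternating (n := Fin m) (R := ℝ)).toMultilinearMap
      cont := Continuous.matrix_det (A := fun M : Fin m → Fin m → ℝ => Matrix.of M) continuous_id }
  have hA1 : HasFDerivAt (fun e i j => A e i j)
      (ContinuousLinearMap.pi fun i => ContinuousLinearMap.pi fun j => A' i j) x :=
    hasFDerivAt_pi.2 fun i => hasFDerivAt_pi.2 fun j => hA i j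
  have h1 := (f.hasFDerivAt (fun i j => A x i j)).comp x hA1
  refine ⟨_, h1, fun v => ?_⟩
  rw [ContinuousLinearMap.comp_apply, ContinuousMultilinearMap.linearDeriv_apply]
  simp only [Matrix.trace, Matrix.diag_apply, Matrix.mul_apply]
  rw [Finset.sum_comm]
  refine Finset.sum_congr rfl fun i _ => ?_
  have h2 := Matrix.cramer_transpose_apply (A x) (fun j => A' i j v) i
  rw [Matrix.cramer_eq_adjugate_mulVec, ← Matrix.adjugate_transpose] at h2
  have h3 : f (Function.update (fun i j => A x i j) i fun j => A' i j v) =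
      ((A x).updateRow i fun j => A' i j v).det := rfl
  refine (h3.trans h2.symm).trans ?_
  simp [Matrix.mulVec, dotProduct]

end Det

/-! ### Logarithmic derivative of the saddlepoint approximation -/

section LogSaddle

variable {m p : ℕ} {Θ : Set (Vec p)} {ν : Vec p → Measure (Vec m)} {s y : Vec m} {θ : Vec p}

theorem tiltMoment_comm (i j : Fin m) : tiltMoment ν [i, j] s θ = tiltMoment ν [j, i] s θ := by
  have : ∀ x : Vec m, monomial [i, j] x = monomial [j, i] x := fun x => by
    simp [monomial, mul_comm]
  simp only [tiltMoment, realMoment, this]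

theorem integral_inner_mul_inner_eq_cgfHess [IsProbabilityMeasure (ν θ)] (hg : GrowthBound Θ ν)
    (h : (s, θ) ∈ interior (mgfDomain Θ ν)) (w v : Vec m) :
    ∫ x, inner ℝ (x - meanVec ν s θ) w * inner ℝ x v ∂(tilt ν s θ) =
      ∑ j, v j * ∑ k, cgfHess ν s θ j k * w k := by
  rw [integral_inner_mul_inner_tilt h]
  refine Finset.sum_congr rfl fun j _ => ?_
  rw [integral_inner_mul_monomial_tilt h]
  congr 1
  refine Finset.sum_congr rfl fun k _ => ?_
  rw [cgfHess_apply hg h, tiltMoment_comm]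
  simp only [tiltMoment, meanVec]
  field_simp

theorem posDef_cgfHess [IsProbabilityMeasure (ν θ)] (hd : DecayBound Θ ν) (hg : GrowthBound Θ ν)
    (h : (s, θ) ∈ interior (mgfDomain Θ ν)) : (cgfHess ν s θ).PosDef := by
  obtain ⟨δ, -, hδ⟩ := hd
  obtain ⟨hδ0, hδd⟩ := hδ s θ h
  refine Matrix.PosDef.of_dotProduct_mulVec_pos ?_ fun w hw => ?_
  · ext i j
    have := tiltMoment_comm (ν := ν) (s := s) (θ := θ) i j
    simp only [tiltMoment] at this
    rw [Matrix.conjTranspose_apply, star_trivial, cgfHess_apply hg h, cgfHess_apply hg h, this]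
    ring
  · have h1 := le_variance_tilt h hδ0 hδd (WithLp.toLp 2 w)
    rw [integral_inner_mul_inner_eq_cgfHess hg h] at h1
    refine lt_of_lt_of_le ?_ h1
    have : 0 < ‖(WithLp.toLp 2 w : Vec m)‖ := norm_pos_iff.2 (by simpa using hw)
    positivity

theorem eventually_mem_saddleDomain (h : (y, θ) ∈ interior (saddleDomain Θ ν)) :
    ∀ᶠ θ' in 𝓝 θ, (y, θ') ∈ interior (saddleDomain Θ ν) :=
  (Continuous.continuousAt (by fun_prop : Continuous fun θ' : Vec p => (y, θ'))).eventually_mem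
    (isOpen_interior.mem_nhds h)

theorem log_saddleLikelihood (hν : ∀ θ ∈ Θ, IsProbabilityMeasure (ν θ))
    (hd : DecayBound Θ ν) (hg : GrowthBound Θ ν) (h : (y, θ) ∈ saddleDomain Θ ν)
    {n : ℕ} (hn : 1 ≤ n) :
    0 < saddleLikelihood (sumLaw ν n) θ ((n : ℝ) • y) ∧
    Real.log (saddleLikelihood (sumLaw ν n) θ ((n : ℝ) • y)) =
      n * (cgf ν (saddlepoint ν θ y) θ - inner ℝ (saddlepoint ν θ y) y) -
        (Real.log ((2 * Real.pi * n) ^ m) +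
          Real.log (cgfHess ν (saddlepoint ν θ y) θ).det) / 2 := by
  obtain ⟨hθ, hex, hint⟩ := h
  have := hν θ hθ
  have hpos := (posDef_cgfHess hd hg hint).det_pos
  have hn' : (0 : ℝ) < n := by positivity
  rw [saddleLikelihood_sumLaw hn]
  refine ⟨by positivity, ?_⟩
  rw [Real.log_div (by positivity) (by positivity), Real.log_exp, Real.log_sqrt (by positivity),
    Real.log_mul (by positivity) hpos.ne']

/-- The derivative of the logarithm of the saddlepoint approximation. -/
theorem exists_hasFDerivAt_log_saddleLikelihood (hν : ∀ θ ∈ Θ, IsProbabilityMeasure (ν θ))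
    (hd : DecayBound Θ ν) (hg : GrowthBound Θ ν) (h : (y, θ) ∈ interior (saddleDomain Θ ν)) :
    ∃ σ : Fin p → Vec m,
      (∀ i j, ∫ x, inner ℝ (x - y) (σ i) * monomial [j] x ∂(tilt ν (saddlepoint ν θ y) θ) +
        thetaMoment ν i [j] (saddlepoint ν θ y) θ / realMoment (ν θ) [] (saddlepoint ν θ y) -
        thetaMoment ν i [] (saddlepoint ν θ y) θ / realMoment (ν θ) [] (saddlepoint ν θ y) *
          tiltMoment ν [j] (saddlepoint ν θ y) θ = 0) ∧
      ∀ n : ℕ, 1 ≤ n → ∃ D : Vec p →L[ℝ] ℝ,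
        HasFDerivAt (fun θ' => Real.log (saddleLikelihood (sumLaw ν n) θ' ((n : ℝ) • y))) D θ ∧
        ∀ i, D (basisVec i) =
          n * (thetaMoment ν i [] (saddlepoint ν θ y) θ /
            realMoment (ν θ) [] (saddlepoint ν θ y)) -
          ((cgfHess ν (saddlepoint ν θ y) θ)⁻¹ * Matrix.of fun j k =>
            (∫ x, inner ℝ (x - y) (σ i) * monomial [j, k] x ∂(tilt ν (saddlepoint ν θ y) θ) +
            thetaMoment ν i [j, k] (saddlepoint ν θ y) θ /
              realMoment (ν θ) [] (saddlepoint ν θ y) -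
            thetaMoment ν i [] (saddlepoint ν θ y) θ /
              realMoment (ν θ) [] (saddlepoint ν θ y) *
              tiltMoment ν [j, k] (saddlepoint ν θ y) θ)).trace / 2 := by
  obtain ⟨T, Q, hT, hQ, hQT⟩ := exists_hasStrictFDerivAt_saddlepoint hν hd hg h
  obtain ⟨hθ, hex, hint⟩ := interior_subset h
  have := hν θ hθ
  set s := saddlepoint ν θ y with hs
  have hmean : meanVec ν s θ = y := (isSaddlepoint_iff hg hint y).1 (isSaddlepoint_saddlepoint hex)
  have hpos := realMoment_nil_pos (mem_interior_expSet hint)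
  set S : Vec p →L[ℝ] Vec m × Vec p :=
    (T.comp (ContinuousLinearMap.inr ℝ (Vec m) (Vec p))).prod (ContinuousLinearMap.id ℝ (Vec p))
    with hS
  have hsθ : HasFDerivAt (fun θ' : Vec p => saddlepoint ν θ' y)
      (T.comp (ContinuousLinearMap.inr ℝ (Vec m) (Vec p))) θ :=
    HasFDerivAt.comp (f := fun θ' : Vec p => (y, θ'))
      (g := fun q : Vec m × Vec p => saddlepoint ν q.2 q.1) θ hT.hasFDerivAt
      (hasFDerivAt_prodMk_right y θ)
  have hcurve : HasFDerivAt (fun θ' : Vec p => (saddlepoint ν θ' y, θ')) S θ :=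
    hsθ.prodMk (hasFDerivAt_id θ)
  choose N hN hNs hNt using fun (J : {J : List (Fin m) // J.length ≤ 5}) =>
    exists_hasStrictFDerivAt_tiltMoment hg hint J.1 J.2
  have hNc : ∀ J, HasFDerivAt (fun θ' => tiltMoment ν J.1 (saddlepoint ν θ' y) θ')
      ((N J).comp S) θ := fun J =>
    HasFDerivAt.comp (f := fun θ' : Vec p => (saddlepoint ν θ' y, θ'))
      (g := fun q : Vec m × Vec p => tiltMoment ν J.1 q.1 q.2) θ (hN J).hasFDerivAt hcurve
  have hsplit : ∀ (L : Vec m × Vec p →L[ℝ] ℝ) i, L (S (basisVec i)) =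
      L (T (0, basisVec i), 0) + L (0, basisVec i) := fun L i => by
    rw [← map_add]
    simp [hS]
  have hNv : ∀ J i, N J (S (basisVec i)) =
      ∫ x, inner ℝ (x - y) (T (0, basisVec i)) * monomial J.1 x ∂(tilt ν s θ) +
        thetaMoment ν i J.1 s θ / realMoment (ν θ) [] s -
        thetaMoment ν i [] s θ / realMoment (ν θ) [] s * tiltMoment ν J.1 s θ := fun J i => by
    rw [hsplit, hNs, hNt, hmean, add_sub_assoc]
  have hone : ∀ j : Fin m, [j].length ≤ 5 := fun j => by simp
  have htwo : ∀ j k : Fin m, [j, k].length ≤ 5 := fun j k => by simp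
  -- Along the saddlepoint curve the tilted mean stays equal to y, so first moments have zero
  -- derivative.
  have hN1 : ∀ (j : Fin m) τ, N ⟨[j], hone j⟩ (S τ) = 0 := by
    intro j τ
    have h1 : HasStrictFDerivAt (fun q : Vec m × Vec p => meanVec ν q.1 q.2 j)
      ((PiLp.proj 2 (fun _ : Fin m => ℝ) j).comp Q) (s, θ) := hasStrictFDerivAt_euclidean.1 hQ j
    have h2 : N ⟨[j], hone j⟩ = (PiLp.proj 2 (fun _ : Fin m => ℝ) j).comp Q :=
      (hN ⟨[j], hone j⟩).hasFDerivAt.unique h1.hasFDerivAt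
    have h3 : Q (S τ) = 0 := hQT τ
    rw [h2, ContinuousLinearMap.comp_apply, h3, map_zero]
  refine ⟨fun i => T (0, basisVec i), fun i j => ?_, fun n hn => ?_⟩
  · have := hNv ⟨[j], hone j⟩ i
    rw [hN1] at this
    exact this.symm
  have hev := eventually_mem_saddleDomain h
  obtain ⟨R, hR, hRs, hRt⟩ := exists_hasStrictFDerivAt_realMoment hg hint [] (by simp)
  have hK : HasFDerivAt (fun θ' => Real.log (realMoment (ν θ') [] (saddlepoint ν θ' y)))
      ((realMoment (ν θ) [] s)⁻¹ • (R.comp S)) θ :=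
    (HasFDerivAt.comp (f := fun θ' : Vec p => (saddlepoint ν θ' y, θ'))
      (g := fun q : Vec m × Vec p => realMoment (ν q.2) [] q.1) θ hR.hasFDerivAt hcurve).log hpos.ne'
  have hin : HasFDerivAt (fun θ' => inner ℝ y (saddlepoint ν θ' y))
      ((innerSL ℝ y).comp (T.comp (ContinuousLinearMap.inr ℝ (Vec m) (Vec p)))) θ :=
    (innerSL ℝ y).hasFDerivAt.comp θ hsθ
  -- Since first moments are stationary, the derivative of the covariance equals that of the second
  -- moment.
  have hA : ∀ j k, HasFDerivAt (fun θ' => tiltMoment ν [j, k] (saddlepoint ν θ' y) θ' -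
      tiltMoment ν [j] (saddlepoint ν θ' y) θ' * tiltMoment ν [k] (saddlepoint ν θ' y) θ')
      ((N ⟨[j, k], htwo j k⟩).comp S) θ := fun j k => by
    have h1 := (hNc ⟨[j, k], htwo j k⟩).sub ((hNc ⟨[j], hone j⟩).mul (hNc ⟨[k], hone k⟩))
    have h2 : ∀ l : Fin m, (N ⟨[l], hone l⟩).comp S = 0 := fun l => by
      ext τ
      exact hN1 l τ
    rw [h2, h2] at h1
    simpa only [smul_zero, add_zero, sub_zero] using! h1
  obtain ⟨D, hD, hDv⟩ := exists_hasFDerivAt_det (A := fun θ' => Matrix.of fun j k =>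
    tiltMoment ν [j, k] (saddlepoint ν θ' y) θ' -
      tiltMoment ν [j] (saddlepoint ν θ' y) θ' * tiltMoment ν [k] (saddlepoint ν θ' y) θ') hA
  have hcov : ∀ s' θ', IsProbabilityMeasure (ν θ') → (s', θ') ∈ interior (mgfDomain Θ ν) →
      cgfHess ν s' θ' = Matrix.of fun j k => tiltMoment ν [j, k] s' θ' -
      tiltMoment ν [j] s' θ' * tiltMoment ν [k] s' θ' := by
    intro s' θ' _ h'
    ext j k
    rw [cgfHess_apply hg h', Matrix.of_apply]
    simp only [tiltMoment]
    field_simp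
  have hdet := (posDef_cgfHess hd hg hint).det_pos
  have hcov0 := hcov s θ this hint
  have hlog : (fun θ' => Real.log (saddleLikelihood (sumLaw ν n) θ' ((n : ℝ) • y))) =ᶠ[𝓝 θ]
      fun θ' => n * (Real.log (realMoment (ν θ') [] (saddlepoint ν θ' y)) -
        inner ℝ y (saddlepoint ν θ' y)) -
        (Real.log ((2 * Real.pi * n) ^ m) + Real.log (Matrix.of fun j k =>
          tiltMoment ν [j, k] (saddlepoint ν θ' y) θ' -
            tiltMoment ν [j] (saddlepoint ν θ' y) θ' *
              tiltMoment ν [k] (saddlepoint ν θ' y) θ').det) / 2 := by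
    filter_upwards [hev] with θ' hθ'
    have h1 := interior_subset hθ'
    rw [(log_saddleLikelihood hν hd hg h1 hn).2, cgf_eq, hcov _ _ (hν θ' h1.1) h1.2.2,
      real_inner_comm y]
  have hfin := (((hK.fun_sub hin).const_mul (n : ℝ)).fun_sub (((hD.log (by
    rw [← hcov0]; exact hdet.ne')).const_add
      (Real.log ((2 * Real.pi * n) ^ m))).mul_const (2⁻¹ : ℝ)))
  simp only [← div_eq_mul_inv] at hfin
  refine ⟨_, hfin.congr_of_eventuallyEq hlog, fun i => ?_⟩
  -- The chain rule for K along the curve produces y·σ plus the parameter derivative at fixed s; the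
  -- term y·σ cancels against the derivative of the linear term s·y.
  have hRi : (realMoment (ν θ) [] s)⁻¹ * R (S (basisVec i)) =
      inner ℝ y (T (0, basisVec i)) + thetaMoment ν i [] s θ / realMoment (ν θ) [] s := by
    have e1 := congrArg (R.comp (ContinuousLinearMap.inl ℝ (Vec m) (Vec p)))
      (eq_sum_basisVec (T (0, basisVec i)))
    rw [map_sum] at e1
    simp only [ContinuousLinearMap.comp_apply, ContinuousLinearMap.inl_apply, map_smul,
      smul_eq_mul, hRs] at e1
    rw [hsplit, e1, hRt, mul_add, inv_mul_eq_div _ (thetaMoment _ _ _ _ _)]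
    congr 1
    rw [Finset.mul_sum, PiLp.inner_apply]
    refine Finset.sum_congr rfl fun k _ => ?_
    rw [← hmean]
    simp only [meanVec, RCLike.inner_apply, conj_trivial]
    field_simp
  simp only [sub_apply, _root_.smul_apply, ContinuousLinearMap.comp_apply, smul_eq_mul, hRi, hDv,
    innerSL_apply_apply, ContinuousLinearMap.inr_apply, hNv]
  rw [add_sub_cancel_left, ← hcov0, Matrix.inv_def, Ring.inverse_eq_inv', Matrix.smul_mul,
    Matrix.trace_smul, smul_eq_mul]
  ring

end LogSaddle

/-! ### The gradient of the true likelihood -/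

section TrueLikelihood

variable {m p : ℕ} {Θ : Set (Vec p)} {ν : Vec p → Measure (Vec m)} {s y : Vec m} {θ : Vec p}
  {n : ℕ}

theorem norm_expMoment_le [IsProbabilityMeasure (ν θ)]
    (h : (s, θ) ∈ interior (mgfDomain Θ ν)) {δ₀ δ : ℝ} (hδ₀ : 0 < δ₀) (hδ : δ₀ ≤ δ)
    (hδd : ∀ φ : Vec m, ‖mgfC ν s φ θ / (mgf ν s θ : ℂ)‖ ≤ (1 + δ * ‖φ‖ ^ 2) ^ (-δ)) (φ : Vec m) :
    ‖expMoment (ν θ) [] s φ‖ ≤ realMoment (ν θ) [] s * env δ₀ φ := by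
  have hpos := realMoment_nil_pos (mem_interior_expSet h)
  have h1 := (hδd φ).trans (env_anti hδ₀ hδ φ)
  rw [mgfC_eq_expMoment, mgf_eq_realMoment, norm_div, Complex.norm_real,
    Real.norm_of_nonneg hpos.le, div_le_iff₀ hpos] at h1
  linarith

theorem continuous_expMoment (h : (s, θ) ∈ interior (mgfDomain Θ ν)) (J : List (Fin m)) :
    Continuous (expMoment (ν θ) J s) := by
  have := continuous_integral_mul_cexp (y := 0) (integrable_monomial_mul_exp
    (mem_interior_expSet h) J)
  simp only [sub_zero] at this
  exact this

/-- The likelihood of a sum, as a Fourier integral along `s + iℝ^m`. -/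
theorem likelihood_sumLaw [IsProbabilityMeasure (ν θ)] (h : (s, θ) ∈ interior (mgfDomain Θ ν))
    (hn : 1 ≤ n) (hint : Integrable fun φ => expMoment (ν θ) [] s φ ^ n) (x : Vec m) :
    (∃ f, IsContDensity (sumLaw ν n θ) f) ∧
    likelihood (sumLaw ν n) θ x = Real.exp (-inner ℝ s x) * (((2 * Real.pi) ^ m)⁻¹ *
      (∫ φ, Complex.exp (-((inner ℝ φ x : ℝ) * Complex.I)) * expMoment (ν θ) [] s φ ^ n).re) := by
  have := isProbabilityMeasure_sumLaw (ν := ν) (n := n) (θ := θ)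
  have hs : s ∈ expSet (sumLaw ν n θ) := by
    have : s ∈ mgfDomainAt (sumLaw ν n) θ := by
      rw [mgfDomainAt_sumLaw hn]
      exact (interior_subset h).2
    exact this
  have hd := isContDensity_of_integrable_expMoment hs (by simpa only [expMoment_sumLaw] using hint)
  simp only [expMoment_sumLaw] at hd
  have hex : ∃ f, IsContDensity (sumLaw ν n θ) f := ⟨_, hd⟩
  refine ⟨hex, ?_⟩
  unfold likelihood
  rw [dif_pos hex, hex.choose_spec.unique hd]

/-- The Fourier integrand in terms of the centered characteristic function. -/
theorem cexp_mul_expMoment_pow [IsProbabilityMeasure (ν θ)]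
    (h : (s, θ) ∈ interior (mgfDomain Θ ν)) (φ : Vec m) :
    Complex.exp (-((inner ℝ φ ((n : ℝ) • y) : ℝ) * Complex.I)) * expMoment (ν θ) [] s φ ^ n =
      (realMoment (ν θ) [] s : ℂ) ^ n * centeredChar (tilt ν s θ) y φ ^ n := by
  have hpos : (realMoment (ν θ) [] s : ℂ) ≠ 0 :=
    Complex.ofReal_ne_zero.2 (realMoment_nil_pos (mem_interior_expSet h)).ne'
  rw [centeredChar_eq, integral_cexp_tilt, mgfC_eq_expMoment, mgf_eq_realMoment, ← mul_pow,
    inner_smul_right, real_inner_comm]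
  have : Complex.exp (-((((n : ℝ) * inner ℝ y φ : ℝ) : ℂ) * Complex.I)) =
      Complex.exp (-((inner ℝ y φ : ℝ) * Complex.I)) ^ n := by
    rw [← Complex.exp_nat_mul]
    congr 1
    push_cast
    ring
  rw [this, ← mul_pow]
  congr 1
  field_simp

theorem hasFDerivAt_expMoment_theta (hg : GrowthBound Θ ν)
    (h : (s, θ) ∈ interior (mgfDomain Θ ν)) (φ : Vec m) :
    HasFDerivAt (fun θ' => expMoment (ν θ') [] s φ)
      (∑ i, (PiLp.proj 2 (fun _ : Fin p => ℝ) i : Vec p →L[ℝ] ℝ).smulRight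
        (mgfPartial ν [i] [] s φ θ)) θ := by
  have hev : ∀ᶠ θ' in 𝓝 θ, (s, θ') ∈ interior (mgfDomain Θ ν) :=
    (Continuous.continuousAt (by fun_prop : Continuous fun θ' : Vec p => (s, θ'))).eventually_mem
      (isOpen_interior.mem_nhds h)
  obtain ⟨L, hL, hLb⟩ := exists_hasStrictFDerivAt_of_hasLineDerivAt
    (EuclideanSpace.basisFun (Fin p) ℝ).toBasis (f := fun θ' => expMoment (ν θ') [] s φ)
    (g := fun i θ' => mgfPartial ν [i] [] s φ θ') (x₀ := θ) (fun i => by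
      filter_upwards [hev] with θ' hθ'
      have := hasLineDerivAt_theta hg hθ' i [] (by simp) φ
      have e : (fun θ' => mgfPartial ν [] [] s φ θ') = fun θ' => expMoment (ν θ') [] s φ :=
        funext fun θ' => mgfC_eq_expMoment s φ θ'
      rw [e] at this
      simpa using this) (fun i =>
      ContinuousAt.comp (x := θ) (f := fun θ' : Vec p => ((s, φ, θ') : Vec m × Vec m × Vec p))
        (continuousAt_theta hg h i [] (by simp) φ) (Continuous.continuousAt (by fun_prop)))
  convert! hL.hasFDerivAt
  refine ContinuousLinearMap.coe_injective
    ((EuclideanSpace.basisFun (Fin p) ℝ).toBasis.ext fun i => ?_)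
  have h1 := hLb i
  simp only [OrthonormalBasis.coe_toBasis, EuclideanSpace.basisFun_apply] at h1 ⊢
  simp [h1, apply_ite Complex.ofReal, ite_mul]

/-- Differentiation of the Fourier integral with respect to the parameter. -/
theorem exists_hasFDerivAt_integral (hg : GrowthBound Θ ν)
    (h : (s, θ) ∈ interior (mgfDomain Θ ν)) {δ₀ B : ℝ} {G : ℕ} (hδ₀ : 0 < δ₀) (hB : 0 ≤ B)
    (hnear : ∀ᶠ θ' in 𝓝 θ, (s, θ') ∈ interior (mgfDomain Θ ν) ∧
      (∀ φ, ‖expMoment (ν θ') [] s φ‖ ≤ B * env δ₀ φ) ∧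
      ∀ i φ, ‖mgfPartial ν [i] [] s φ θ'‖ ≤ G * (1 + ‖φ‖) ^ G)
    (hn : Integrable fun φ : Vec m => env δ₀ φ ^ n)
    (hn1 : Integrable fun φ : Vec m => (1 + ‖φ‖) ^ G * env δ₀ φ ^ (n - 1)) (x : Vec m) :
    ∃ D : Vec p →L[ℝ] ℂ, HasFDerivAt (fun θ' => ∫ φ,
        Complex.exp (-((inner ℝ φ x : ℝ) * Complex.I)) * expMoment (ν θ') [] s φ ^ n) D θ ∧
      ∀ i, D (basisVec i) = ∫ φ, Complex.exp (-((inner ℝ φ x : ℝ) * Complex.I)) *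
        (n * expMoment (ν θ) [] s φ ^ (n - 1) * mgfPartial ν [i] [] s φ θ) := by
  set e : Vec m → ℂ := fun φ => Complex.exp (-((inner ℝ φ x : ℝ) * Complex.I)) with he
  have hec : Continuous e := by fun_prop
  have hen : ∀ φ, ‖e φ‖ = 1 := fun φ => by
    simp only [he]
    rw [← neg_mul, ← Complex.ofReal_neg]; exact Complex.norm_exp_ofReal_mul_I _
  set Λ : Vec p → Vec m → Vec p →L[ℝ] ℂ := fun θ' φ =>
    ∑ i, (PiLp.proj 2 (fun _ : Fin p => ℝ) i : Vec p →L[ℝ] ℝ).smulRight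
        (mgfPartial ν [i] [] s φ θ') with hΛ
  set F' : Vec p → Vec m → Vec p →L[ℝ] ℂ := fun θ' φ =>
    e φ • ((n * expMoment (ν θ') [] s φ ^ (n - 1)) • Λ θ' φ) with hF'
  have hpc : ∀ i, Continuous fun φ => mgfPartial ν [i] [] s φ θ := fun i =>
    continuous_iff_continuousAt.2 fun φ =>
      ContinuousAt.comp (x := φ) (f := fun φ : Vec m => ((s, φ, θ) : Vec m × Vec m × Vec p))
        (continuousAt_theta hg h i [] (by simp) φ) (Continuous.continuousAt (by fun_prop))
  have hFc := continuous_expMoment h []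
  have hΛc : Continuous (Λ θ) := by
    refine continuous_finsetSum _ fun i _ => ?_
    exact ((ContinuousLinearMap.smulRightL ℝ (Vec p) ℂ
      (PiLp.proj 2 (fun _ : Fin p => ℝ) i : Vec p →L[ℝ] ℝ)).continuous.comp (hpc i))
  have hF'c : Continuous (F' θ) := by
    simp only [hF']
    fun_prop
  have hF'n : ∀ θ', (∀ φ, ‖expMoment (ν θ') [] s φ‖ ≤ B * env δ₀ φ) →
      (∀ i φ, ‖mgfPartial ν [i] [] s φ θ'‖ ≤ G * (1 + ‖φ‖) ^ G) → ∀ φ,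
      ‖F' θ' φ‖ ≤ (n * B ^ (n - 1) * (p * G)) * ((1 + ‖φ‖) ^ G * env δ₀ φ ^ (n - 1)) := by
    intro θ' h1 h2 φ
    have e1 : ‖Λ θ' φ‖ ≤ p * (G * (1 + ‖φ‖) ^ G) := by
      refine (norm_sum_le_of_le _ (n := fun _ => (G : ℝ) * (1 + ‖φ‖) ^ G) fun i _ => ?_).trans
        (by simp)
      rw [ContinuousLinearMap.norm_smulRight_apply]
      have : ‖(PiLp.proj 2 (fun _ : Fin p => ℝ) i : Vec p →L[ℝ] ℝ)‖ ≤ 1 :=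
        ContinuousLinearMap.opNorm_le_bound _ zero_le_one fun v => by
          rw [one_mul]; exact PiLp.norm_apply_le v i
      calc _ ≤ 1 * ((G : ℝ) * (1 + ‖φ‖) ^ G) := by gcongr; exact h2 i φ
        _ = _ := one_mul _
    have e2 : ‖expMoment (ν θ') [] s φ ^ (n - 1)‖ ≤ (B * env δ₀ φ) ^ (n - 1) := by
      rw [norm_pow]; exact pow_le_pow_left₀ (norm_nonneg _) (h1 φ) _
    simp only [hF', norm_smul, hen, norm_mul, Complex.norm_natCast, one_mul]
    have := (env_pos hδ₀ φ).le
    calc _ ≤ n * (B * env δ₀ φ) ^ (n - 1) * (p * (G * (1 + ‖φ‖) ^ G)) := by gcongr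
      _ = _ := by rw [mul_pow]; ring
  have hbnd := hn1.const_mul (n * B ^ (n - 1) * (p * G))
  have hint : Integrable (F' θ) := hbnd.mono' hF'c.aestronglyMeasurable
    (Eventually.of_forall (hF'n θ hnear.self_of_nhds.2.1 hnear.self_of_nhds.2.2))
  -- The set of parameters satisfying the bounds `hnear` serves as the neighbourhood of domination.
  -- The contour through s does not move with the parameter, so only the moment generating function
  -- is differentiated.
  have key := hasFDerivAt_integral_of_dominated_of_fderiv_le (μ := (volume : Measure (Vec m)))
    (F := fun θ' φ => e φ * expMoment (ν θ') [] s φ ^ n) (F' := F') (x₀ := θ) (𝕜 := ℝ)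
    (bound := fun φ => (n * B ^ (n - 1) * (p * G)) * ((1 + ‖φ‖) ^ G * env δ₀ φ ^ (n - 1)))
    hnear (by
      filter_upwards [hnear] with θ' hθ'
      have := continuous_expMoment hθ'.1 []
      exact Continuous.aestronglyMeasurable (by fun_prop))
    ((hn.const_mul (B ^ n)).mono' (Continuous.aestronglyMeasurable (by fun_prop))
      (Eventually.of_forall fun φ => by
        rw [norm_mul, hen, one_mul, norm_pow, ← mul_pow]
        exact pow_le_pow_left₀ (norm_nonneg _) (hnear.self_of_nhds.2.1 φ) _))
    hF'c.aestronglyMeasurable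
    (Eventually.of_forall fun φ θ' hθ' => hF'n θ' hθ'.2.1 hθ'.2.2 φ) hbnd
    (Eventually.of_forall fun φ θ' hθ' =>
      ((hasFDerivAt_expMoment_theta hg hθ'.1 φ).pow n).const_mul (e φ) |>.congr_fderiv (by
        simp [hF', hΛ, nsmul_eq_mul, mul_smul]))
  refine ⟨_, key, fun i => ?_⟩
  rw [ContinuousLinearMap.integral_apply hint]
  refine integral_congr_ae (Eventually.of_forall fun φ => ?_)
  simp [hF', hΛ, he]

end TrueLikelihood

/-! ### Uniform estimates -/

section Uniform

variable {m p : ℕ} {Θ : Set (Vec p)} {ν : Vec p → Measure (Vec m)} {s y σ : Vec m} {θ : Vec p}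
  {i : Fin p} {G : ℕ} {ε δ₀ Y : ℝ}

/-- Decay and growth bounds at a point, with explicit constants. -/
structure BoundsAt (ν : Vec p → Measure (Vec m)) (δ₀ ε : ℝ) (G : ℕ) (s : Vec m) (θ : Vec p) :
    Prop where
  decay : ∀ φ : Vec m, ‖mgfC ν s φ θ / (mgf ν s θ : ℂ)‖ ≤ (1 + δ₀ * ‖φ‖ ^ 2) ^ (-δ₀)
  growth : ∀ (I : List (Fin p)) (J : List (Fin m)), ControlledOrder I.length J.length → ∀ φ,
    ‖mgfPartial ν I J s φ θ‖ ≤ G * (1 + ‖φ‖) ^ G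
  le_mgf : ε ≤ realMoment (ν θ) [] s

theorem BoundsAt.norm_theta_le (hb : BoundsAt ν δ₀ ε G s θ) (i : Fin p) {J : List (Fin m)}
    (hJ : J.length ≤ 5) (φ : Vec m) : ‖mgfPartial ν [i] J s φ θ‖ ≤ G * (1 + ‖φ‖) ^ G := by
  refine hb.growth [i] J ?_ φ
  left; simp only [List.length_cons, List.length_nil]; omega

theorem BoundsAt.abs_thetaMoment_le (hb : BoundsAt ν δ₀ ε G s θ) (i : Fin p)
    {J : List (Fin m)} (hJ : J.length ≤ 5) : |thetaMoment ν i J s θ| ≤ G := by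
  refine (Complex.abs_re_le_norm _).trans ((hb.norm_theta_le i hJ 0).trans ?_)
  simp

theorem BoundsAt.abs_realMoment_le (h : (s, θ) ∈ interior (mgfDomain Θ ν))
    (hb : BoundsAt ν δ₀ ε G s θ) {J : List (Fin m)} (hJ1 : 1 ≤ J.length) (hJ : J.length ≤ 6) :
    |realMoment (ν θ) J s| ≤ G := by
  have h1 := hb.growth [] J (by left; simp only [List.length_nil]; omega) 0
  rw [mgfPartial_nil_eq J (mem_interior_expSet h), expMoment_zero_eq_realMoment,
    Complex.norm_real] at h1
  simpa using h1

theorem abs_div_le_div {a b ε G : ℝ} (hε : 0 < ε) (hb : ε ≤ b) (ha : |a| ≤ G) :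
    |a / b| ≤ G / ε := by
  rw [abs_div, abs_of_pos (hε.trans_le hb)]
  exact div_le_div₀ ((abs_nonneg a).trans ha) ha hε hb

theorem BoundsAt.abs_tiltMoment_le (h : (s, θ) ∈ interior (mgfDomain Θ ν))
    (hb : BoundsAt ν δ₀ ε G s θ) (hε : 0 < ε) {J : List (Fin m)} (hJ1 : 1 ≤ J.length)
    (hJ : J.length ≤ 6) : |tiltMoment ν J s θ| ≤ G / ε :=
  abs_div_le_div hε hb.le_mgf (hb.abs_realMoment_le h hJ1 hJ)

/-- A bound on the weighted moment. -/
def weightBound (m G : ℕ) (ε Y : ℝ) : ℝ := 2 ^ 5 * ((1 + Y) ^ 6 + m ^ 2 * (m * (G / ε)))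

/-- The power mean inequality. An even exponent is used because |x|⁶ is controlled by pure
monomials, which an odd power of |x| is not. -/
theorem norm_pow_six_le (x : Vec m) :
    ‖x‖ ^ 6 ≤ m ^ 2 * ∑ j, monomial (List.replicate 6 j) x := by
  have h1 : ‖x‖ ^ 6 = (∑ j, x j ^ 2) ^ 3 := by
    rw [show (6 : ℕ) = 2 * 3 from rfl, pow_mul, EuclideanSpace.norm_sq_eq]
    simp
  have h2 : ∀ j, monomial (List.replicate 6 j) x = (x j ^ 2) ^ 3 := fun j => by
    simp [monomial]
    ring
  have h4 := pow_sum_div_card_le_sum_pow (s := (Finset.univ : Finset (Fin m)))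
    (f := fun j => x j ^ 2) (fun j _ => sq_nonneg _) 2
  rw [h1]
  simp only [h2]
  rcases Nat.eq_zero_or_pos m with rfl | hm
  · simp
  · rw [div_le_iff₀ (by simp; positivity)] at h4
    simpa [mul_comm] using h4

/-- The fifth moment of the weight is below the sixth, which is controlled by the sixth
s-derivatives of the moment generating function, the highest order that the growth bound provides.
-/
theorem integral_weight_le [IsProbabilityMeasure (ν θ)] (h : (s, θ) ∈ interior (mgfDomain Θ ν))
    (hb : BoundsAt ν δ₀ ε G s θ) (hε : 0 < ε) (hy : ‖y‖ ≤ Y) :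
    ∫ x, (1 + ‖y‖ + ‖x‖) ^ 5 ∂(tilt ν s θ) ≤ weightBound m G ε Y := by
  have := isProbabilityMeasure_tilt h
  have hY : 0 ≤ Y := (norm_nonneg y).trans hy
  have hpt : ∀ x : Vec m, (1 + ‖y‖ + ‖x‖) ^ 5 ≤
      2 ^ 5 * ((1 + Y) ^ 6 + m ^ 2 * ∑ j, monomial (List.replicate 6 j) x) := by
    intro x
    have h1 : 1 ≤ 1 + ‖y‖ + ‖x‖ := one_le_weight x
    calc (1 + ‖y‖ + ‖x‖) ^ 5 ≤ (1 + ‖y‖ + ‖x‖) ^ 6 := pow_le_pow_right₀ h1 (by norm_num)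
      _ ≤ ((1 + Y) + ‖x‖) ^ 6 := by gcongr
      _ ≤ 2 ^ 5 * ((1 + Y) ^ 6 + ‖x‖ ^ 6) := add_pow_le (by positivity) (norm_nonneg x) 6
      _ ≤ _ := by gcongr; exact norm_pow_six_le x
  have hi : ∀ j, Integrable (monomial (List.replicate 6 j)) (tilt ν s θ) := fun j =>
    integrable_monomial_tilt h _
  have hi2 : Integrable (fun x => 2 ^ 5 * ((1 + Y) ^ 6 + m ^ 2 *
      ∑ j, monomial (List.replicate 6 j) x)) (tilt ν s θ) :=
    ((integrable_const _).add ((integrable_finsetSum _ fun j _ => hi j).const_mul _)).const_mul _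
  refine (integral_mono (integrable_weight_tilt h y 5) hi2 hpt).trans ?_
  rw [integral_const_mul, integral_add (integrable_const _)
    ((integrable_finsetSum _ fun j _ => hi j).const_mul _), integral_const_mul,
    integral_finsetSum _ fun j _ => hi j]
  unfold weightBound
  simp only [integral_const, probReal_univ, one_smul, integral_monomial_tilt]
  gcongr
  calc _ ≤ ∑ _j : Fin m, (G / ε : ℝ) := Finset.sum_le_sum fun j _ =>
        (le_abs_self _).trans (hb.abs_tiltMoment_le h hε (J := List.replicate 6 j)
          (by simp) (by simp))
    _ = _ := by simp

/-- The total derivative of `K''` along the saddlepoint curve with velocity `σ`. -/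
def hessDeriv (ν : Vec p → Measure (Vec m)) (i : Fin p) (y σ s : Vec m) (θ : Vec p) :
    Matrix (Fin m) (Fin m) ℝ :=
  Matrix.of fun j k => ∫ x, inner ℝ (x - y) σ * monomial [j, k] x ∂(tilt ν s θ) +
    thetaMoment ν i [j, k] s θ / realMoment (ν θ) [] s -
    thetaMoment ν i [] s θ / realMoment (ν θ) [] s * tiltMoment ν [j, k] s θ

/-- The saddlepoint equation, differentiated along `θ_i`. -/
def IsVelocity (ν : Vec p → Measure (Vec m)) (i : Fin p) (y σ s : Vec m) (θ : Vec p) : Prop :=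
  ∀ j, ∫ x, inner ℝ (x - y) σ * monomial [j] x ∂(tilt ν s θ) +
        thetaMoment ν i [j] s θ / realMoment (ν θ) [] s -
        thetaMoment ν i [] s θ / realMoment (ν θ) [] s * tiltMoment ν [j] s θ = 0

theorem abs_sum_mul_le (w : Vec m) {a : Fin m → ℝ} {A : ℝ} (ha : ∀ j, |a j| ≤ A) :
    |∑ j, w j * a j| ≤ ‖w‖ * (m * A) := by
  refine (Finset.abs_sum_le_sum_abs _ _).trans ?_
  calc _ ≤ ∑ _j : Fin m, ‖w‖ * A := Finset.sum_le_sum fun j _ => by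
        rw [abs_mul]
        exact mul_le_mul (by simpa using PiLp.norm_apply_le w j) (ha j) (abs_nonneg _)
          (norm_nonneg _)
    _ = _ := by simp; ring

theorem norm_le_of_sq_le {V : Type*} [NormedAddCommGroup V] {w : V} {a C : ℝ} (ha : 0 < a)
    (hC : 0 ≤ C) (h : a * ‖w‖ ^ 2 ≤ ‖w‖ * C) : ‖w‖ ≤ C / a := by
  rw [le_div_iff₀ ha]
  rcases (norm_nonneg w).eq_or_lt with h0 | h0
  · rw [← h0]; simpa
  · nlinarith

/-- Contract the differentiated saddlepoint equation with σ: the left side is the variance in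
direction σ, at least 2δ₀²|σ|², while the right side is linear in σ. -/
theorem norm_velocity_le [IsProbabilityMeasure (ν θ)] (h : (s, θ) ∈ interior (mgfDomain Θ ν))
    (hb : BoundsAt ν δ₀ ε G s θ) (hδ₀ : 0 < δ₀) (hε : 0 < ε) (hmean : meanVec ν s θ = y)
    (hσ : IsVelocity ν i y σ s θ) :
    ‖σ‖ ≤ m * (G / ε * (G / ε) + G / ε) / (2 * δ₀ ^ 2) := by
  have h1 := le_variance_tilt h hδ₀ hb.decay σ
  rw [integral_inner_mul_inner_tilt h, hmean] at h1
  refine norm_le_of_sq_le (by positivity) (by positivity)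
    (h1.trans ((le_abs_self _).trans (abs_sum_mul_le σ fun j => ?_)))
  have h2 : ∫ x, inner ℝ (x - y) σ * monomial [j] x ∂(tilt ν s θ) =
      thetaMoment ν i [] s θ / realMoment (ν θ) [] s * tiltMoment ν [j] s θ -
        thetaMoment ν i [j] s θ / realMoment (ν θ) [] s := by linarith [hσ j]
  rw [h2]
  refine (abs_sub _ _).trans (add_le_add ?_ ?_)
  · rw [abs_mul]
    exact mul_le_mul (abs_div_le_div hε hb.le_mgf (hb.abs_thetaMoment_le i (by simp)))
      (hb.abs_tiltMoment_le h hε (by simp) (by simp)) (abs_nonneg _) (by positivity)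
  · exact abs_div_le_div hε hb.le_mgf (hb.abs_thetaMoment_le i (by simp))

theorem abs_hessDeriv_le [IsProbabilityMeasure (ν θ)] (h : (s, θ) ∈ interior (mgfDomain Θ ν))
    (hb : BoundsAt ν δ₀ ε G s θ) (hε : 0 < ε) (hy : ‖y‖ ≤ Y) (j k : Fin m) :
    |hessDeriv ν i y σ s θ j k| ≤
      ‖σ‖ * weightBound m G ε Y + G / ε + G / ε * (G / ε) := by
  unfold hessDeriv
  rw [Matrix.of_apply]
  have h1 : |∫ x, inner ℝ (x - y) σ * monomial [j, k] x ∂(tilt ν s θ)| ≤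
      ‖σ‖ * weightBound m G ε Y := by
    have h2 : ∀ x : Vec m, |inner ℝ (x - y) σ * monomial [j, k] x| ≤
        ‖σ‖ * (1 + ‖y‖ + ‖x‖) ^ 5 := by
      intro x
      have h3 : 1 ≤ 1 + ‖y‖ + ‖x‖ := one_le_weight x
      have h4 : |monomial [j, k] x| ≤ (1 + ‖y‖ + ‖x‖) ^ 2 := by
        refine (abs_monomial_le [j, k] x).trans ?_
        simp only [List.length_cons, List.length_nil]
        gcongr
        linarith [norm_nonneg y]
      rw [abs_mul]
      calc _ ≤ ‖σ‖ * (1 + ‖y‖ + ‖x‖) * (1 + ‖y‖ + ‖x‖) ^ 2 :=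
            mul_le_mul (abs_inner_sub_le x σ) h4 (abs_nonneg _) (by positivity)
        _ = ‖σ‖ * (1 + ‖y‖ + ‖x‖) ^ 3 := by ring
        _ ≤ _ := by gcongr <;> norm_num
    refine (norm_integral_le_of_norm_le ((integrable_weight_tilt h y 5).const_mul ‖σ‖)
      (Eventually.of_forall fun x => by rw [Real.norm_eq_abs]; exact h2 x)).trans ?_
    rw [integral_const_mul]
    gcongr
    exact integral_weight_le h hb hε hy
  refine (abs_sub _ _).trans (add_le_add ((abs_add_le _ _).trans (add_le_add h1 ?_)) ?_)
  · exact abs_div_le_div hε hb.le_mgf (hb.abs_thetaMoment_le i (by simp))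
  · rw [abs_mul]
    exact mul_le_mul (abs_div_le_div hε hb.le_mgf (hb.abs_thetaMoment_le i (by simp)))
      (hb.abs_tiltMoment_le h hε (by simp) (by simp)) (abs_nonneg _) (by positivity)

theorem cgfHess_mul_inv [IsProbabilityMeasure (ν θ)] (hd : DecayBound Θ ν) (hg : GrowthBound Θ ν)
    (h : (s, θ) ∈ interior (mgfDomain Θ ν)) : cgfHess ν s θ * (cgfHess ν s θ)⁻¹ = 1 :=
  Matrix.mul_nonsing_inv _ (posDef_cgfHess hd hg h).det_pos.ne'.isUnit

/-- The operator `-K''⁻¹ dK'' / 2`. -/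
def correction (ν : Vec p → Measure (Vec m)) (i : Fin p) (y σ s : Vec m) (θ : Vec p) :
    Vec m →L[ℝ] Vec m :=
  (-(1 / 2 : ℝ)) • Matrix.toEuclideanCLM (𝕜 := ℝ)
    ((cgfHess ν s θ)⁻¹ * hessDeriv ν i y σ s θ)

theorem correction_apply (φ : Vec m) (k : Fin m) : correction ν i y σ s θ φ k =
    -(1 / 2) * ((cgfHess ν s θ)⁻¹ * hessDeriv ν i y σ s θ).mulVec φ k := by
  simp [correction, Matrix.ofLp_toEuclideanCLM]

theorem sum_correction : ∑ j, correction ν i y σ s θ (basisVec j) j =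
    -((cgfHess ν s θ)⁻¹ * hessDeriv ν i y σ s θ).trace / 2 := by
  simp only [correction_apply, ← Finset.mul_sum]
  rw [Matrix.trace, neg_div, neg_mul, one_div, inv_mul_eq_div]
  congr 2
  refine Finset.sum_congr rfl fun j _ => ?_
  rw [show ((basisVec j : Vec m) : Fin m → ℝ) = Pi.single j 1 from rfl, Matrix.mulVec_single_one]
  rfl

theorem cgfHess_mulVec_correction [IsProbabilityMeasure (ν θ)] (hd : DecayBound Θ ν)
    (hg : GrowthBound Θ ν) (h : (s, θ) ∈ interior (mgfDomain Θ ν)) (φ : Vec m) (j : Fin m) :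
    ∑ k, cgfHess ν s θ j k * correction ν i y σ s θ φ k =
      -(1 / 2) * ∑ k, hessDeriv ν i y σ s θ j k * φ k := by
  have h1 : (cgfHess ν s θ).mulVec (((cgfHess ν s θ)⁻¹ * hessDeriv ν i y σ s θ).mulVec φ) =
      (hessDeriv ν i y σ s θ).mulVec φ := by
    rw [Matrix.mulVec_mulVec, ← Matrix.mul_assoc, cgfHess_mul_inv hd hg h, Matrix.one_mul]
  have h2 := congrFun h1 j
  simp only [correction_apply]
  rw [Matrix.mulVec, dotProduct] at h2
  conv at h2 => rhs; rw [Matrix.mulVec, dotProduct]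
  rw [← h2, Finset.mul_sum]
  exact Finset.sum_congr rfl fun k _ => by ring

/-- K'' times the correction is -½ of the total derivative of K''. This is the identity by which the
correction removes the quadratic term of the integrand. -/
theorem integral_inner_correction [IsProbabilityMeasure (ν θ)] (hd : DecayBound Θ ν)
    (hg : GrowthBound Θ ν) (h : (s, θ) ∈ interior (mgfDomain Θ ν)) (hmean : meanVec ν s θ = y)
    (φ v : Vec m) :
    ∫ x, inner ℝ (x - y) (correction ν i y σ s θ φ) * inner ℝ x v ∂(tilt ν s θ) =
      -(1 / 2) * ∑ j, v j * ∑ k, hessDeriv ν i y σ s θ j k * φ k := by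
  have h1 := integral_inner_mul_inner_eq_cgfHess hg h (correction ν i y σ s θ φ) v
  rw [hmean] at h1
  rw [h1, Finset.mul_sum]
  refine Finset.sum_congr rfl fun j _ => ?_
  rw [cgfHess_mulVec_correction hd hg h]
  ring

/-- Coercivity of the tilted variance replaces a bound on the inverse Hessian: pair the correction
of φ with itself and use that K'' times it is bounded by a multiple of |φ|. -/
theorem norm_correction_le [IsProbabilityMeasure (ν θ)] (hd : DecayBound Θ ν)
    (hg : GrowthBound Θ ν) (h : (s, θ) ∈ interior (mgfDomain Θ ν))
    (hb : BoundsAt ν δ₀ ε G s θ) (hδ₀ : 0 < δ₀) (hmean : meanVec ν s θ = y) {H : ℝ}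
    (hH : ∀ j k, |hessDeriv ν i y σ s θ j k| ≤ H) (hH0 : 0 ≤ H) :
    ‖correction ν i y σ s θ‖ ≤ m * (m * H) / (2 * δ₀ ^ 2) := by
  refine ContinuousLinearMap.opNorm_le_bound _ (by positivity) fun φ => ?_
  have h1 := le_variance_tilt h hδ₀ hb.decay (correction ν i y σ s θ φ)
  rw [hmean, integral_inner_correction hd hg h hmean] at h1
  rw [div_mul_eq_mul_div]
  refine norm_le_of_sq_le (by positivity) (by positivity) (h1.trans ((le_abs_self _).trans ?_))
  have h2 : ∀ j, |∑ k, hessDeriv ν i y σ s θ j k * φ k| ≤ ‖φ‖ * (m * H) := fun j => by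
    simpa only [mul_comm] using abs_sum_mul_le φ (hH j)
  have h3 := abs_sum_mul_le (correction ν i y σ s θ φ) h2
  rw [abs_mul]
  calc _ ≤ 1 * (‖correction ν i y σ s θ φ‖ * (m * (‖φ‖ * (m * H)))) := by
        gcongr
        rw [abs_neg, abs_of_pos] <;> norm_num
    _ = _ := by ring

end Uniform

/-! ### The expansion applied to the parameter derivative of the moment generating function -/

section Core

variable {m p : ℕ} {Θ : Set (Vec p)} {ν : Vec p → Measure (Vec m)} {s y σ : Vec m} {θ : Vec p}
  {i : Fin p} {G : ℕ} {ε δ₀ Y : ℝ}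

theorem integral_inner_mul_inner_sq_tilt [IsProbabilityMeasure (ν θ)]
    (h : (s, θ) ∈ interior (mgfDomain Θ ν)) (w φ : Vec m) :
    ∫ x, inner ℝ (x - y) w * inner ℝ x φ ^ 2 ∂(tilt ν s θ) =
      ∑ j, φ j * ∑ k, (∫ x, inner ℝ (x - y) w * monomial [j, k] x ∂(tilt ν s θ)) * φ k := by
  have hi : ∀ j k, Integrable (fun x => inner ℝ (x - y) w * monomial [j, k] x) (tilt ν s θ) := by
    intro j k
    have := isProbabilityMeasure_tilt h
    have h1 : ∀ x : Vec m, inner ℝ (x - y) w * monomial [j, k] x =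
        ∑ l, w l * (monomial [l, j, k] x - y l * monomial [j, k] x) := fun x => by
      simp only [PiLp.inner_apply, monomial_cons, Finset.sum_mul, PiLp.sub_apply,
        RCLike.inner_apply, conj_trivial]
      exact Finset.sum_congr rfl fun l _ => by ring
    simp only [h1]
    exact integrable_finsetSum _ fun l _ => ((integrable_monomial_tilt h _).sub
      ((integrable_monomial_tilt h _).const_mul _)).const_mul _
  simp only [← integral_mul_const]
  have hi' : ∀ j k, Integrable (fun x => inner ℝ (x - y) w * monomial [j, k] x * φ k)
      (tilt ν s θ) := fun j k => (hi j k).mul_const _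
  have h2 : ∀ j, ∑ k, ∫ x, inner ℝ (x - y) w * monomial [j, k] x * φ k ∂(tilt ν s θ) =
      ∫ x, ∑ k, inner ℝ (x - y) w * monomial [j, k] x * φ k ∂(tilt ν s θ) := fun j =>
    (integral_finsetSum _ fun k _ => hi' j k).symm
  simp only [h2, ← integral_const_mul]
  rw [← integral_finsetSum _ fun j _ => (integrable_finsetSum _ fun k _ => hi' j k).const_mul _]
  refine integral_congr_ae (Eventually.of_forall fun x => ?_)
  have h3 : inner ℝ x φ = ∑ j, φ j * x j := by
    simp [PiLp.inner_apply]
  simp only [h3, sq, Finset.sum_mul, monomial, List.map_cons, List.map_nil, List.prod_cons,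
    List.prod_nil, mul_one, Finset.mul_sum]
  exact Finset.sum_congr rfl fun j _ => Finset.sum_congr rfl fun k _ => by ring

theorem integral_inner_tilt_eq (h : (s, θ) ∈ interior (mgfDomain Θ ν)) (φ : Vec m) :
    ∫ x, inner ℝ x φ ∂(tilt ν s θ) = ∑ j, φ j * tiltMoment ν [j] s θ := by
  have h3 : ∀ x : Vec m, inner ℝ x φ = ∑ j, φ j * monomial [j] x := fun x => by
    simp [PiLp.inner_apply, monomial]
  simp only [h3]
  rw [integral_finsetSum _ fun j _ => (integrable_monomial_tilt h [j]).const_mul _]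
  simp only [integral_const_mul, integral_monomial_tilt, tiltMoment]

theorem integral_inner_sq_tilt_eq (h : (s, θ) ∈ interior (mgfDomain Θ ν)) (φ : Vec m) :
    ∫ x, inner ℝ x φ ^ 2 ∂(tilt ν s θ) =
      ∑ j, φ j * ∑ k, tiltMoment ν [j, k] s θ * φ k := by
  have h3 : ∀ x : Vec m, inner ℝ x φ ^ 2 = ∑ j, φ j * ∑ k, monomial [j, k] x * φ k := fun x => by
    have : inner ℝ x φ = ∑ j, φ j * x j := by simp [PiLp.inner_apply]
    simp only [this, sq, Finset.sum_mul, monomial, List.map_cons, List.map_nil,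
      List.prod_cons, List.prod_nil, mul_one, Finset.mul_sum]
    exact Finset.sum_congr rfl fun j _ => Finset.sum_congr rfl fun k _ => by ring
  have hi : ∀ j k, Integrable (fun x => monomial [j, k] x * φ k) (tilt ν s θ) :=
    fun j k => (integrable_monomial_tilt h [j, k]).mul_const _
  simp only [h3]
  rw [integral_finsetSum _ fun j _ => (integrable_finsetSum _ fun k _ => hi j k).const_mul _]
  refine Finset.sum_congr rfl fun j _ => ?_
  rw [integral_const_mul, integral_finsetSum _ fun k _ => hi j k]
  simp only [integral_mul_const, integral_monomial_tilt, tiltMoment]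

/-- The expansion of the Fourier integral of `∂_{θ_i} M / M` against powers of the centered
characteristic function, uniformly under explicit bounds. -/
theorem exists_norm_integral_theta_sub_le (hd : DecayBound Θ ν) (hg : GrowthBound Θ ν)
    (hδ₀ : 0 < δ₀) (hε : 0 < ε) (hY : 0 ≤ Y) (G : ℕ) :
    ∃ (n₀ : ℕ) (C : ℝ), 1 ≤ n₀ ∧ 0 ≤ C ∧ ∀ (s y σ : Vec m) (θ : Vec p) (i : Fin p),
      IsProbabilityMeasure (ν θ) → (s, θ) ∈ interior (mgfDomain Θ ν) → BoundsAt ν δ₀ ε G s θ →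
      ‖y‖ ≤ Y → meanVec ν s θ = y → IsVelocity ν i y σ s θ → ∀ n ≥ n₀,
      ‖(∫ φ, mgfPartial ν [i] [] s φ θ / (realMoment (ν θ) [] s : ℂ) *
          Complex.exp (-((inner ℝ y φ : ℝ) * Complex.I)) *
          centeredChar (tilt ν s θ) y φ ^ (n - 1)) -
        ((thetaMoment ν i [] s θ / realMoment (ν θ) [] s : ℝ) +
          ((-((cgfHess ν s θ)⁻¹ * hessDeriv ν i y σ s θ).trace / 2 : ℝ) : ℂ) / n) *
          ∫ φ, centeredChar (tilt ν s θ) y φ ^ n‖ ≤ C / Real.sqrt n ^ (m + 4) := by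
  set g : ℝ := G / ε with hgdef
  have hg0 : 0 ≤ g := by positivity
  set W : ℝ := weightBound m G ε Y with hW
  have hW0 : 0 ≤ W := by rw [hW, weightBound]; positivity
  set S : ℝ := m * (g * g + g) / (2 * δ₀ ^ 2) with hS
  have hS0 : 0 ≤ S := by positivity
  set H : ℝ := S * W + g + g * g with hH
  have hH0 : 0 ≤ H := by positivity
  set Lb : ℝ := m * (m * H) / (2 * δ₀ ^ 2) with hLb
  have hLb0 : 0 ≤ Lb := by positivity
  -- One constant above all bounds required by the expansion: the weight, velocity, correction,
  -- leading coefficient, data, and the quartic and cubic Taylor terms.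
  set B : ℝ := W + S + Lb + g + Y + m ^ 4 * g + m ^ 3 * g with hB
  have hm4 : 0 ≤ (m : ℝ) ^ 4 * g := by positivity
  have hm3 : 0 ≤ (m : ℝ) ^ 3 * g := by positivity
  obtain ⟨n₀, C, hn₀, hC, key⟩ := exists_norm_integral_sub_le m G δ₀ B hδ₀
  refine ⟨n₀, C, hn₀, hC, fun s y σ θ i _ h hb hy hmean hσ n hn => ?_⟩
  have hprob := isProbabilityMeasure_tilt h
  set M := realMoment (ν θ) [] s with hM
  have hMpos : 0 < M := hε.trans_le hb.le_mgf
  have hMC : (M : ℂ) ≠ 0 := Complex.ofReal_ne_zero.2 hMpos.ne'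
  have hσn : ‖σ‖ ≤ S := norm_velocity_le h hb hδ₀ hε hmean hσ
  have hHb : ∀ j k, |hessDeriv ν i y σ s θ j k| ≤ H := fun j k =>
    (abs_hessDeriv_le h hb hε hy j k).trans (by rw [hH]; gcongr)
  have hTay := norm_theta_sub_taylor_le hg h i (A := G) (G := G)
    (fun J hJ φ => hb.norm_theta_le i (by omega) φ) (by positivity)
  set T : List (Fin m) → ℝ := fun J => thetaMoment ν i J s θ with hT
  -- The constant field -σ is forced by matching first-order terms and the linear field `correction`
  -- by matching second-order terms.
  have hmeas := key (tilt ν s θ) y (-σ) (correction ν i y σ s θ) (thetaMoment ν i [] s θ / M)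
    (fun φ => mgfPartial ν [i] [] s φ θ / (M : ℂ))
    (fun φ => iterSum (fun j => φ j) T 1 [] / M) (fun φ => iterSum (fun j => φ j) T 2 [] / M)
    (fun φ => iterSum (fun j => φ j) T 3 [] / 6 / M)
    (integrable_weight_tilt h y 5)
    ((integral_weight_le h hb hε hy).trans (by rw [hB]; linarith))
    (by rw [← hmean]; exact integral_inner_tilt h)
    (norm_integral_cexp_tilt_le hb.decay)
    (by rw [norm_neg, hB]; linarith)
    ((norm_correction_le hd hg h hb hδ₀ hmean hHb hH0).trans (by rw [hB]; linarith))
    ((abs_div_le_div hε hb.le_mgf (hb.abs_thetaMoment_le i (by simp))).trans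
      (by rw [hB]; linarith))
    (by rw [hB]; linarith)
    (by
      refine Continuous.div_const (continuous_iff_continuousAt.2 fun φ => ?_) _
      exact ContinuousAt.comp (x := φ)
        (f := fun φ : Vec m => ((s, φ, θ) : Vec m × Vec m × Vec p))
        (continuousAt_theta hg h i [] (by simp) φ) (Continuous.continuousAt (by fun_prop)))
    (fun φ => by
      have h1 := div_le_div_of_nonneg_right (hTay φ) hMpos.le
      rw [← Real.norm_of_nonneg hMpos.le, ← Complex.norm_real, ← norm_div,
        Complex.norm_real, Real.norm_of_nonneg hMpos.le] at h1
      refine (le_of_eq ?_).trans (h1.trans ?_)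
      · congr 1
        push_cast
        field_simp
      · have h2 : (m : ℝ) ^ 4 * G / M ≤ B := by
          rw [mul_div_assoc]
          have : (G : ℝ) / M ≤ g := div_le_div_of_nonneg_left (by positivity) hε hb.le_mgf
          have := mul_le_mul_of_nonneg_left this (by positivity : (0 : ℝ) ≤ (m : ℝ) ^ 4)
          rw [hB]; linarith
        calc _ = (m : ℝ) ^ 4 * G / M * ‖φ‖ ^ 4 * (1 + ‖φ‖) ^ G := by ring
          _ ≤ _ := by gcongr)
    (((continuous_iterSum T 3 []).div_const _).div_const _)
    (fun φ => by
      have := iterSum_neg (fun j => φ j) T 3 []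
      simp only [PiLp.neg_apply, this]
      ring)
    (fun φ => by
      have h1 := norm_iterSum_le (R := ℝ) (c := fun j => φ j) (a := T) (r := ‖φ‖) (A := G)
        (fun j => PiLp.norm_apply_le φ j) (norm_nonneg _) 3 []
        (fun J hJ => hb.abs_thetaMoment_le i (by simp at hJ; omega))
      rw [Real.norm_eq_abs] at h1
      have h2 : |iterSum (fun j => φ j) T 3 [] / M| ≤ (m * ‖φ‖) ^ 3 * G / ε :=
        abs_div_le_div hε hb.le_mgf h1
      rw [div_right_comm, abs_div, abs_of_pos (by norm_num : (0 : ℝ) < 6)]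
      have h3 : (m * ‖φ‖) ^ 3 * G / ε = m ^ 3 * g * ‖φ‖ ^ 3 := by rw [hgdef]; ring
      rw [h3] at h2
      have h4 : (m : ℝ) ^ 3 * g * ‖φ‖ ^ 3 ≤ B * ‖φ‖ ^ 3 := by
        refine mul_le_mul_of_nonneg_right ?_ (by positivity)
        rw [hB]; linarith
      linarith [abs_nonneg (iterSum (fun j => φ j) T 3 [] / M)])
    -- First-order matching is the differentiated saddlepoint equation, multiplied by φ_j and
    -- summed.
    (fun φ => by
      rw [integral_inner_tilt_eq h, integral_inner_mul_inner_tilt h, Finset.mul_sum,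
        ← Finset.sum_add_distrib]
      simp only [iterSum, Finset.sum_div]
      refine Finset.sum_congr rfl fun j _ => ?_
      have h1 := hσ j
      simp only [inner_neg_right, neg_mul, integral_neg]
      have h2 : T [j] / M = thetaMoment ν i [] s θ / M * tiltMoment ν [j] s θ -
        ∫ x, inner ℝ (x - y) σ * monomial [j] x ∂(tilt ν s θ) := by linarith
      rw [mul_div_assoc, h2]
      ring)
    -- Second-order matching: twice the correction term restores the total derivative of K''.
    -- `iterSum` builds its index lists in reverse, hence the exchange of the two sums.
    (fun φ => by
      rw [integral_inner_sq_tilt_eq h, integral_inner_mul_inner_sq_tilt h,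
        integral_inner_correction hd hg h hmean]
      simp only [iterSum, Finset.sum_div, Finset.mul_sum, ← Finset.sum_add_distrib,
        ← Finset.sum_sub_distrib, hessDeriv, Matrix.of_apply, inner_neg_right, neg_mul,
        integral_neg]
      rw [Finset.sum_comm]
      refine Finset.sum_congr rfl fun j _ => Finset.sum_congr rfl fun k _ => ?_
      simp only [hT]
      ring) n hn
  rw [sum_correction] at hmeas
  exact hmeas

end Core

/-! ### The gradient error bound -/

section GradientError

variable {m p : ℕ} {Θ : Set (Vec p)} {ν : Vec p → Measure (Vec m)} {s y : Vec m} {θ : Vec p}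

theorem boundsAt_of_le {G : ℕ} {ε δ₀ δ γ : ℝ} (hδ₀ : 0 < δ₀) (hδ : δ₀ ≤ δ)
    (hδd : ∀ φ : Vec m, ‖mgfC ν s φ θ / (mgf ν s θ : ℂ)‖ ≤ (1 + δ * ‖φ‖ ^ 2) ^ (-δ))
    (hγ : γ ≤ G) (hγd : ∀ (I : List (Fin p)) (J : List (Fin m)),
      ControlledOrder I.length J.length → ∀ φ, ‖mgfPartial ν I J s φ θ‖ ≤ γ * (1 + ‖φ‖) ^ γ)
    (hε : ε ≤ realMoment (ν θ) [] s) : BoundsAt ν δ₀ ε G s θ where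
  decay φ := (hδd φ).trans (env_anti hδ₀ hδ φ)
  growth I J hIJ φ := by
    refine (hγd I J hIJ φ).trans ?_
    have h1 : 1 ≤ 1 + ‖φ‖ := by linarith [norm_nonneg φ]
    have h2 : (1 + ‖φ‖) ^ γ ≤ (1 + ‖φ‖) ^ G := by
      rw [← Real.rpow_natCast]
      exact Real.rpow_le_rpow_of_exponent_le h1 hγ
    exact mul_le_mul hγ h2 (by positivity) (by positivity)
  le_mgf := hε

/-- Only n - 1 of the n factors e^{-iφy} are absorbed in centring the powers of the characteristic
function; the last one stays with the parameter derivative. -/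
theorem cexp_mul_expMoment_pow_sub [IsProbabilityMeasure (ν θ)]
    (h : (s, θ) ∈ interior (mgfDomain Θ ν)) {n : ℕ} (hn : 1 ≤ n) (P : ℂ) (φ : Vec m) :
    Complex.exp (-((inner ℝ φ ((n : ℝ) • y) : ℝ) * Complex.I)) *
      (n * expMoment (ν θ) [] s φ ^ (n - 1) * P) =
      ((n : ℂ) * (realMoment (ν θ) [] s : ℂ) ^ n) * (P / (realMoment (ν θ) [] s : ℂ) *
        Complex.exp (-((inner ℝ y φ : ℝ) * Complex.I)) *
          centeredChar (tilt ν s θ) y φ ^ (n - 1)) := by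
  obtain ⟨k, rfl⟩ := Nat.exists_eq_add_of_le' hn
  have hpos : (realMoment (ν θ) [] s : ℂ) ≠ 0 :=
    Complex.ofReal_ne_zero.2 (realMoment_nil_pos (mem_interior_expSet h)).ne'
  have h1 := cexp_mul_expMoment_pow (y := y) (n := k) h φ
  have h2 : Complex.exp (-((inner ℝ φ (((k + 1 : ℕ) : ℝ) • y) : ℝ) * Complex.I)) =
      Complex.exp (-((inner ℝ φ ((k : ℝ) • y) : ℝ) * Complex.I)) *
        Complex.exp (-((inner ℝ y φ : ℝ) * Complex.I)) := by
    rw [← Complex.exp_add, inner_smul_right, inner_smul_right, real_inner_comm]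
    congr 1
    push_cast
    ring
  rw [Nat.add_sub_cancel, h2]
  calc _ = ((k + 1 : ℕ) : ℂ) * P * Complex.exp (-((inner ℝ y φ : ℝ) * Complex.I)) *
        (Complex.exp (-((inner ℝ φ ((k : ℝ) • y) : ℝ) * Complex.I)) *
          expMoment (ν θ) [] s φ ^ k) := by ring
    _ = _ := by
      rw [h1]
      field_simp
      ring

theorem norm_le_sum_abs (v : Vec p) : ‖v‖ ≤ ∑ i, |v i| := by
  conv_lhs => rw [eq_sum_basisVec v]
  refine norm_sum_le_of_le _ fun i _ => ?_
  rw [norm_smul, Real.norm_eq_abs]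
  simp

theorem gradient_apply_eq {f : Vec p → ℝ} {D : Vec p →L[ℝ] ℝ} (h : HasFDerivAt f D θ) (i : Fin p) :
    gradient f θ i = D (basisVec i) := by
  rw [← inner_basisVec, gradient, h.fderiv, InnerProductSpace.toDual_symm_apply]

/-- The error of J, of order n^{-m/2-2}, is multiplied by n and divided by Re I ≥ c n^{-m/2}, which
leaves 1/n. -/
theorem abs_ratio_sub_le {n m : ℕ} (hn : 1 ≤ n) {I J : ℂ} {a τ c C : ℝ} (hc : 0 < c) (hC : 0 ≤ C)
    (hI : c / Real.sqrt n ^ m ≤ I.re)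
    (hJ : ‖J - ((a : ℝ) + ((τ : ℝ) : ℂ) / n) * I‖ ≤ C / Real.sqrt n ^ (m + 4)) :
    |n * a + τ - n * J.re / I.re| ≤ C / c * (1 / n) := by
  have hn0 : (0 : ℝ) < n := by positivity
  have hs : 0 < Real.sqrt n := Real.sqrt_pos.2 hn0
  have hIpos : 0 < I.re := lt_of_lt_of_le (by positivity) hI
  have h1 : |J.re - (a + τ / n) * I.re| ≤ C / Real.sqrt n ^ (m + 4) := by
    refine le_trans (le_of_eq ?_) ((Complex.abs_re_le_norm _).trans hJ)
    congr 1
    rw [Complex.sub_re]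
    have : ((a : ℝ) : ℂ) + ((τ : ℝ) : ℂ) / n = ((a + τ / n : ℝ) : ℂ) := by push_cast; ring
    rw [this, Complex.re_ofReal_mul]
  have h2 : n * a + τ - n * J.re / I.re = -(n * (J.re - (a + τ / n) * I.re) / I.re) := by
    field_simp
    ring
  rw [h2, abs_neg, abs_div, abs_mul, abs_of_pos hn0, abs_of_pos hIpos, div_le_iff₀ hIpos]
  calc n * |J.re - (a + τ / n) * I.re| ≤ n * (C / Real.sqrt n ^ (m + 4)) := by gcongr
    _ = C / c * (1 / n) * (c / Real.sqrt n ^ m) := by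
        have h4 : Real.sqrt n ^ 4 = n ^ 2 := by
          rw [show (4 : ℕ) = 2 * 2 from rfl, pow_mul, Real.sq_sqrt hn0.le]
        rw [pow_add, h4]
        field_simp
    _ ≤ _ := by gcongr

/-- The gradient error bound at one point, with constants depending only on explicit bounds. -/
theorem exists_gradientError_le (hν : ∀ θ ∈ Θ, IsProbabilityMeasure (ν θ))
    (hg : GrowthBound Θ ν) {δ γ : Vec m × Vec p → ℝ}
    (hδc : ContinuousOn δ (interior (mgfDomain Θ ν)))
    (hδ : ∀ s θ, (s, θ) ∈ interior (mgfDomain Θ ν) → 0 < δ (s, θ) ∧ ∀ φ : Vec m,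
      ‖mgfC ν s φ θ / (mgf ν s θ : ℂ)‖ ≤ (1 + δ (s, θ) * ‖φ‖ ^ 2) ^ (-δ (s, θ)))
    (hγc : ContinuousOn γ (interior (mgfDomain Θ ν)))
    (hγ : ∀ s θ, (s, θ) ∈ interior (mgfDomain Θ ν) → ∀ (I : List (Fin p)) (J : List (Fin m)),
      ControlledOrder I.length J.length → ∀ φ : Vec m,
        ‖mgfPartial ν I J s φ θ‖ ≤ γ (s, θ) * (1 + ‖φ‖) ^ γ (s, θ))
    {δ₀ ε Y : ℝ} (hδ₀ : 0 < δ₀) (hε : 0 < ε) (hY : 0 ≤ Y) (G : ℕ) :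
    ∃ (n₀ : ℕ) (A : ℝ), 1 ≤ n₀ ∧ ∀ y θ, (y, θ) ∈ interior (saddleDomain Θ ν) →
      δ₀ < δ (saddlepoint ν θ y, θ) → γ (saddlepoint ν θ y, θ) < G →
      ε < realMoment (ν θ) [] (saddlepoint ν θ y) → ‖y‖ ≤ Y → ∀ n ≥ n₀,
        LogGradientsExist (sumLaw ν n) θ ((n : ℝ) • y) ∧
        ‖gradientError (sumLaw ν n) θ ((n : ℝ) • y)‖ ≤ A * (1 / (n : ℝ)) := by
  have hd : DecayBound Θ ν := ⟨δ, hδc, hδ⟩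
  obtain ⟨n₁, C, hn₁, hC, hcore⟩ := exists_norm_integral_theta_sub_le hd hg hδ₀ hε hY G
  obtain ⟨n₂, c, hn₂, hc, hlow⟩ := exists_le_re_integral_centeredChar_pow m δ₀
    (weightBound m G ε Y) hδ₀
  obtain ⟨n₃, C₃, hn₃, hC₃, henv⟩ := env_moment_sub (m := m) δ₀ hδ₀ 0 G
  refine ⟨n₁ + n₂ + n₃, p * (C / c), by omega, ?_⟩
  intro y θ hyθ hδs hγs hεs hy n hn
  have hn1 : 1 ≤ n := by omega
  have hn0 : (0 : ℝ) < n := by positivity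
  obtain ⟨σ, hσ, hsad⟩ := exists_hasFDerivAt_log_saddleLikelihood hν hd hg hyθ
  obtain ⟨DS, hDS, hDSv⟩ := hsad n hn1
  obtain ⟨hθ, hex, hint⟩ := interior_subset hyθ
  have hprob := hν θ hθ
  set s := saddlepoint ν θ y with hs
  have hmean : meanVec ν s θ = y := (isSaddlepoint_iff hg hint y).1 (isSaddlepoint_saddlepoint hex)
  have hb : BoundsAt ν δ₀ ε G s θ := boundsAt_of_le hδ₀ hδs.le (hδ s θ hint).2 hγs.le
    (hγ s θ hint) hεs.le
  have hemb : ContinuousAt (fun θ' : Vec p => (s, θ')) θ := Continuous.continuousAt (by fun_prop)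
  have hevint : ∀ᶠ θ' in 𝓝 θ, (s, θ') ∈ interior (mgfDomain Θ ν) :=
    hemb.eventually_mem (isOpen_interior.mem_nhds hint)
  have hMcont : ContinuousAt (fun θ' => realMoment (ν θ') [] s) θ :=
    ContinuousAt.comp (x := θ) (f := fun θ' : Vec p => (s, θ'))
      (g := fun q : Vec m × Vec p => realMoment (ν q.2) [] q.1)
      (continuousAt_realMoment hg hint [] (by simp)) hemb
  have hδcont : ContinuousAt (fun θ' => δ (s, θ')) θ :=
    ContinuousAt.comp (x := θ) (f := fun θ' : Vec p => (s, θ'))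
      (hδc.continuousAt (isOpen_interior.mem_nhds hint)) hemb
  have hγcont : ContinuousAt (fun θ' => γ (s, θ')) θ :=
    ContinuousAt.comp (x := θ) (f := fun θ' : Vec p => (s, θ'))
      (hγc.continuousAt (isOpen_interior.mem_nhds hint)) hemb
  set M := realMoment (ν θ) [] s with hM
  have hMpos : 0 < M := hε.trans hεs
  -- The bounds at (s, θ) are strict, so by continuity they persist for nearby parameters at the
  -- same s.
  have hnear : ∀ᶠ θ' in 𝓝 θ, (s, θ') ∈ interior (mgfDomain Θ ν) ∧
      (∀ φ, ‖expMoment (ν θ') [] s φ‖ ≤ (M + 1) * env δ₀ φ) ∧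
      ∀ i φ, ‖mgfPartial ν [i] [] s φ θ'‖ ≤ G * (1 + ‖φ‖) ^ G := by
    filter_upwards [hevint, hMcont.eventually_lt_const (show M < M + 1 by linarith),
      hMcont.eventually_const_lt hεs, hδcont.eventually_const_lt hδs,
      hγcont.eventually_lt_const hγs] with θ' h1 h2 h3 h4 h5
    have := hν θ' (mem_of_mem_interior h1)
    have hb' : BoundsAt ν δ₀ ε G s θ' := boundsAt_of_le hδ₀ h4.le (hδ s θ' h1).2 h5.le
      (hγ s θ' h1) h3.le
    refine ⟨h1, fun φ => (norm_expMoment_le h1 hδ₀ le_rfl hb'.decay φ).trans ?_,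
      fun i φ => hb'.norm_theta_le i (by simp) φ⟩
    exact mul_le_mul_of_nonneg_right h2.le (env_pos hδ₀ φ).le
  have hienv0 : Integrable fun φ : Vec m => env δ₀ φ ^ n := by
    refine (henv n (by omega) 0 (by norm_num)).1.mono'
      ((continuous_env hδ₀).pow n).aestronglyMeasurable (Eventually.of_forall fun φ => ?_)
    have h1 : 0 ≤ env δ₀ φ ^ n := pow_nonneg (env_pos hδ₀ φ).le n
    rw [Real.norm_of_nonneg h1, pow_zero, one_mul, Nat.sub_zero]
    exact le_mul_of_one_le_left h1 (one_le_pow₀ (by linarith [norm_nonneg φ]))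
  have hienv1 : Integrable fun φ : Vec m => (1 + ‖φ‖) ^ G * env δ₀ φ ^ (n - 1) := by
    simpa using (henv n (by omega) 1 (by norm_num)).1
  obtain ⟨DΦ, hDΦ, hDΦv⟩ := exists_hasFDerivAt_integral hg hint hδ₀ (by linarith) hnear hienv0
    hienv1 ((n : ℝ) • y)
  set Φ : Vec p → ℂ := fun θ' => ∫ φ, Complex.exp (-((inner ℝ φ ((n : ℝ) • y) : ℝ) * Complex.I)) *
    expMoment (ν θ') [] s φ ^ n with hΦ
  set κ : ℝ := Real.exp (-inner ℝ s ((n : ℝ) • y)) * ((2 * Real.pi) ^ m)⁻¹ with hκ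
  have hκ0 : 0 < κ := by positivity
  have hlik : ∀ᶠ θ' in 𝓝 θ, (∃ f, IsContDensity (sumLaw ν n θ') f) ∧
      likelihood (sumLaw ν n) θ' ((n : ℝ) • y) = κ * (Φ θ').re := by
    filter_upwards [hnear] with θ' hθ'
    obtain ⟨h1, h2, -⟩ := hθ'
    have := hν θ' (mem_of_mem_interior h1)
    have hi : Integrable fun φ => expMoment (ν θ') [] s φ ^ n := by
      refine (hienv0.const_mul ((M + 1) ^ n)).mono'
        ((continuous_expMoment h1 []).pow n).aestronglyMeasurable (Eventually.of_forall fun φ => ?_)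
      rw [norm_pow, ← mul_pow]
      exact pow_le_pow_left₀ (norm_nonneg _) (h2 φ) n
    obtain ⟨h3, h4⟩ := likelihood_sumLaw h1 hn1 hi ((n : ℝ) • y)
    exact ⟨h3, by rw [h4, hκ, hΦ, mul_assoc]⟩
  set I : ℂ := ∫ φ, centeredChar (tilt ν s θ) y φ ^ n with hI
  have hprobt := isProbabilityMeasure_tilt hint
  have hIlow : c / Real.sqrt n ^ m ≤ I.re :=
    (hlow (tilt ν s θ) y (integrable_weight_tilt hint y 5) (integral_weight_le hint hb hε hy)
      (by rw [← hmean]; exact integral_inner_tilt hint) (norm_integral_cexp_tilt_le hb.decay)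
      n (by omega)).2
  have hIpos : 0 < I.re := lt_of_lt_of_le (by positivity) hIlow
  have hΦθ : Φ θ = ((M ^ n : ℝ) : ℂ) * I := by
    simp only [hΦ, hI, cexp_mul_expMoment_pow hint]
    rw [integral_const_mul]
    push_cast
    rfl
  have hΦre : (Φ θ).re = M ^ n * I.re := by rw [hΦθ, Complex.re_ofReal_mul]
  have hΦpos : 0 < (Φ θ).re := by rw [hΦre]; positivity
  have hred : HasFDerivAt (fun θ' => (Φ θ').re) (Complex.reCLM.comp DΦ) θ :=
    Complex.reCLM.hasFDerivAt.comp θ hDΦ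
  have hpos : ∀ᶠ θ' in 𝓝 θ, 0 < likelihood (sumLaw ν n) θ' ((n : ℝ) • y) := by
    filter_upwards [hlik, hred.continuousAt.eventually_const_lt hΦpos] with θ' h1 h2
    rw [h1.2]
    positivity
  have hDL := (hred.const_mul κ).log (mul_pos hκ0 hΦpos).ne'
  have hDL' := hDL.congr_of_eventuallyEq (f₁ := fun θ' =>
    Real.log (likelihood (sumLaw ν n) θ' ((n : ℝ) • y)))
    (hlik.mono fun θ' h => by simp only [h.2])
  refine ⟨⟨?_, hDL'.differentiableAt, hDS.differentiableAt⟩, ?_⟩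
  · filter_upwards [hlik, hpos, eventually_mem_saddleDomain hyθ] with θ' h1 h2 h3
    have h4 := interior_subset h3
    have := hν θ' h4.1
    refine ⟨h1.1, h2, ?_, (log_saddleLikelihood hν hd hg h4 hn1).1⟩
    obtain ⟨s', hs'⟩ := h4.2.1
    exact ⟨s', (isSaddlepoint_sumLaw hn1 y s').2 hs'⟩
  · have hcomp : ∀ i, |gradientError (sumLaw ν n) θ ((n : ℝ) • y) i| ≤ C / c * (1 / n) := by
      intro i
      have hJ := hcore s y (σ i) θ i hprob hint hb hy hmean (hσ i) n (by omega)
      set J : ℂ := ∫ φ, mgfPartial ν [i] [] s φ θ / (M : ℂ) *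
          Complex.exp (-((inner ℝ y φ : ℝ) * Complex.I)) *
          centeredChar (tilt ν s θ) y φ ^ (n - 1) with hJdef
      have h1 := abs_ratio_sub_le hn1 hc hC hIlow hJ
      have h2 : DΦ (basisVec i) = ((n * M ^ n : ℝ) : ℂ) * J := by
        rw [hDΦv]
        simp only [cexp_mul_expMoment_pow_sub hint hn1]
        rw [integral_const_mul, hJdef]
        push_cast
        rfl
      refine le_trans (le_of_eq ?_) h1
      congr 1
      rw [gradientError, PiLp.sub_apply, gradient_apply_eq hDS, gradient_apply_eq hDL', hDSv]
      simp only [_root_.smul_apply, ContinuousLinearMap.comp_apply, h2, Complex.reCLM_apply,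
        Complex.re_ofReal_mul, smul_eq_mul, hΦre]
      -- The prefactors do not matter for the logarithmic derivative.
      have e1 : (κ * (M ^ n * I.re))⁻¹ * (κ * (n * M ^ n * J.re)) = n * J.re / I.re := by
        field_simp
      rw [e1]
      simp only [hessDeriv]
      ring
    calc _ ≤ ∑ i, |gradientError (sumLaw ν n) θ ((n : ℝ) • y) i| := norm_le_sum_abs _
      _ ≤ ∑ _i : Fin p, C / c * (1 / (n : ℝ)) := Finset.sum_le_sum fun i _ => hcomp i
      _ = _ := by simp; ring

end GradientError

/-! ### Uniformity on compact sets -/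

section Compact

variable {m p : ℕ} {Θ : Set (Vec p)} {ν : Vec p → Measure (Vec m)}

/-- The gradient error bound, uniformly on compact sets. -/
theorem exists_gradientError_le_of_isCompact (hν : ∀ θ ∈ Θ, IsProbabilityMeasure (ν θ))
    (hd : DecayBound Θ ν) (hg : GrowthBound Θ ν) {C : Set (Vec m × Vec p)} (hC : IsCompact C)
    (hCsub : C ⊆ interior (saddleDomain Θ ν)) :
    ∃ (n₀ : ℕ) (A : ℝ), 1 ≤ n₀ ∧ ∀ n : ℕ, n₀ ≤ n → ∀ (y : Vec m) (θ : Vec p), (y, θ) ∈ C →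
      LogGradientsExist (sumLaw ν n) θ ((n : ℝ) • y) ∧
      ‖gradientError (sumLaw ν n) θ ((n : ℝ) • y)‖ ≤ A * (1 / (n : ℝ)) := by
  obtain ⟨δ, hδc, hδ⟩ := id hd
  obtain ⟨γ, hγc, hγ0, hγ⟩ := id hg
  set ψ : Vec m × Vec p → Vec m × Vec p := fun q => (saddlepoint ν q.2 q.1, q.2) with hψ
  have hψmem : ∀ q ∈ C, ψ q ∈ interior (mgfDomain Θ ν) := fun q hq =>
    (interior_subset (hCsub hq)).2.2
  have hψc : ∀ q ∈ C, ContinuousAt ψ q := fun q hq => by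
    obtain ⟨T, -, hT, -⟩ := exists_hasStrictFDerivAt_saddlepoint hν hd hg (hCsub hq)
    exact hT.continuousAt.prodMk continuousAt_snd
  have hδψ : ContinuousOn (fun q => δ (ψ q)) C := fun q hq =>
    (ContinuousAt.comp (hδc.continuousAt (isOpen_interior.mem_nhds (hψmem q hq)))
      (hψc q hq)).continuousWithinAt
  have hγψ : ContinuousOn (fun q => γ (ψ q)) C := fun q hq =>
    (ContinuousAt.comp (hγc.continuousAt (isOpen_interior.mem_nhds (hψmem q hq)))
      (hψc q hq)).continuousWithinAt
  have hMψ : ContinuousOn (fun q => realMoment (ν (ψ q).2) [] (ψ q).1) C := fun q hq =>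
    (ContinuousAt.comp (f := ψ) (g := fun r : Vec m × Vec p => realMoment (ν r.2) [] r.1)
      (continuousAt_realMoment hg (hψmem q hq) [] (by simp)) (hψc q hq)).continuousWithinAt
  -- Along the continuous saddlepoint map the decay rate and the moment generating function have
  -- positive lower bounds on C. Half of each is used below, to make the required inequalities
  -- strict.
  obtain ⟨δ₀, hδ₀, hδle⟩ := hC.exists_forall_le' hδψ (a := 0)
    fun q hq => (hδ _ _ (hψmem q hq)).1
  obtain ⟨ε, hε, hεle⟩ := hC.exists_forall_le' hMψ (a := 0) fun q hq => by
    have := hν q.2 (mem_of_mem_interior (hψmem q hq))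
    exact realMoment_nil_pos (mem_interior_expSet (hψmem q hq))
  obtain ⟨Γ, hΓ⟩ := hC.exists_bound_of_continuousOn hγψ
  obtain ⟨G, hG⟩ := exists_nat_gt Γ
  obtain ⟨Y, hY⟩ := hC.exists_bound_of_continuousOn continuousOn_fst
  obtain ⟨n₀, A, hn₀, key⟩ := exists_gradientError_le hν hg hδc hδ hγc
    (fun s θ h I J hIJ φ => ((hγ I J hIJ).1 s θ h φ).2) (half_pos hδ₀) (half_pos hε)
    (abs_nonneg Y) G
  refine ⟨n₀, A, hn₀, fun n hn y θ hq => key y θ (hCsub hq) ?_ ?_ ?_ ?_ n hn⟩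
  · exact (half_lt_self hδ₀).trans_le (hδle _ hq)
  · exact ((le_abs_self _).trans (hΓ _ hq)).trans_lt hG
  · exact (half_lt_self hε).trans_le (hεle _ hq)
  · exact (hY _ hq).trans (le_abs_self Y)

end Compact

end Saddle

end

theorem mainTheorem1 {m p : ℕ} (Θ : Set (Saddle.Vec p)) (hΘ : IsOpen Θ)
    (ν : Saddle.Vec p → Measure (Saddle.Vec m))
    (hν : ∀ θ ∈ Θ, IsProbabilityMeasure (ν θ))
    (hdecay : Saddle.DecayBound Θ ν) (hgrowth : Saddle.GrowthBound Θ ν) :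
    (∀ (y : Saddle.Vec m) (θ : Saddle.Vec p), (y, θ) ∈ interior (Saddle.saddleDomain Θ ν) →
      (∀ᶠ n : ℕ in atTop, Saddle.LogGradientsExist (Saddle.sumLaw ν n) θ ((n : ℝ) • y)) ∧
      (fun n : ℕ => Saddle.gradientError (Saddle.sumLaw ν n) θ ((n : ℝ) • y))
        =O[atTop] (fun n : ℕ => 1 / (n : ℝ))) ∧
    (∀ C : Set (Saddle.Vec m × Saddle.Vec p),
      IsCompact C → C ⊆ interior (Saddle.saddleDomain Θ ν) →
      ∃ (n₀ : ℕ) (A : ℝ), 1 ≤ n₀ ∧ ∀ n : ℕ, n₀ ≤ n → ∀ (y : Saddle.Vec m) (θ : Saddle.Vec p),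
        (y, θ) ∈ C →
        Saddle.LogGradientsExist (Saddle.sumLaw ν n) θ ((n : ℝ) • y) ∧
        ‖Saddle.gradientError (Saddle.sumLaw ν n) θ ((n : ℝ) • y)‖ ≤ A * (1 / (n : ℝ))) := by
  have key := fun (C : Set (Saddle.Vec m × Saddle.Vec p)) (hC : IsCompact C)
    (hCsub : C ⊆ interior (Saddle.saddleDomain Θ ν)) =>
    Saddle.exists_gradientError_le_of_isCompact hν hdecay hgrowth hC hCsub
  refine ⟨fun y θ h => ?_, key⟩
  -- The pointwise statement is the uniform one for a singleton.
  obtain ⟨n₀, A, -, hA⟩ := key {(y, θ)} isCompact_singleton (Set.singleton_subset_iff.2 h)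
  refine ⟨?_, Asymptotics.IsBigO.of_bound A ?_⟩
  · filter_upwards [eventually_ge_atTop n₀] with n hn
    exact (hA n hn y θ rfl).1
  · filter_upwards [eventually_ge_atTop n₀] with n hn
    rw [Real.norm_of_nonneg (by positivity : (0 : ℝ) ≤ 1 / (n : ℝ))]
    exact (hA n hn y θ rfl).2
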